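/- Let $T>0$ and $\nu\in\mathbb{R}$, and let $u_0\in H^2(\mathbb{R})$, $u_1\in H^1(\mathbb{R})$, $\zeta,P\in C^2([0,T])$ and $f,p\in C^0([0,T];H^2(\mathbb{R}))$ (all functions real-valued). Consider the Gao beam equation with a moving Dirac mass on the infinite line, $$u_{tt}+\delta(x-\zeta(t))u_{tt}-\delta'(x-\zeta(t))\dot\zeta(t)u_t+u_{xxxx}-(u_x^2-\nu p)u_{xx}=f+\delta(x-\zeta(t))P(t),\qquad u(0,\cdot)=u_0,\quad u_t(0,\cdot)=u_1 .$$ It has a weak solution in the following sense: there is a function $u$ with $u\in C^0([0,T);H^{2-\alpha}_{\mathrm{loc}}(\mathbb{R}))$ for every $\alpha\in(0,2)$, with $u\in L^\infty(0,T;H^2(\mathbb{R}))$ and $u_t\in L^\infty(0,T;L^2(\mathbb{R}))$, such that for every $v\in C^2([0,T];H^2(\mathbb{R}))$ with compact support in $[0,T)\times\mathbb{R}$, $$\begin{aligned} &\int_0^T\!\!\int_{\mathbb{R}}u_tv_t\,dx\,dt-\int_0^T\!\!\int_{\mathbb{R}}u_{xx}v_{xx}\,dx\,dt-\frac13\int_0^T\!\!\int_{\mathbb{R}}u_x^3v_x\,dx\,dt-\int_0^T\!\!\int_{\mathbb{R}}\nu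 p\,u_{xx}v\,dx\,dt\\ &-u_0(\zeta(0))v_t(0,\zeta(0))-\int_0^Tu(t,\zeta(t))v_{tt}(t,\zeta(t))\,dt-\int_0^T\dot\zeta(t)u_x(t,\zeta(t))v_t(t,\zeta(t))\,dt\\ &-\int_0^T\dot\zeta(t)u(t,\zeta(t))v_{xt}(t,\zeta(t))\,dt+\int_0^T\!\!\int_{\mathbb{R}}fv\,dx\,dt+\int_0^TP(t)v(t,\zeta(t))\,dt\\ &+\int_{\mathbb{R}}u_1v(0,\cdot)\,dx+u_1(\zeta(0))v(0,\zeta(0))=0, \end{aligned}$$ and moreover $u(0,\cdot)=u_0$. Point values are those of the continuous representatives. -/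

import Mathlib

open MeasureTheory Filter Topology Set
open scoped ENNReal ContDiff FourierTransform

noncomputable section

namespace GaoBeam

/-- The real Hilbert space `L²(ℝ)`. -/
abbrev L2 : Type := Lp ℝ 2 (volume : Measure ℝ)

/-- `g` is the weak derivative of `f` on the real line. -/
def IsWeakDeriv (f g : L2) : Prop :=
  ∀ φ : ℝ → ℝ, ContDiff ℝ ∞ φ → HasCompactSupport φ →
    ∫ x, f x * deriv φ x = -∫ x, g x * φ x

theorem integrable_mul_of_compactSupport (f : L2) {φ : ℝ → ℝ} (hφ : Continuous φ)
    (hc : HasCompactSupport φ) : Integrable (fun x => f x * φ x) :=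
  (Lp.memLp f).integrable_mul (q := 2) (hφ.memLp_of_hasCompactSupport hc)

theorem integral_add_mul (f g : L2) {φ : ℝ → ℝ} (hφ : Continuous φ) (hc : HasCompactSupport φ) :
    ∫ x, (f + g) x * φ x = (∫ x, f x * φ x) + ∫ x, g x * φ x := by
  rw [← integral_add (integrable_mul_of_compactSupport f hφ hc)
    (integrable_mul_of_compactSupport g hφ hc)]
  refine integral_congr_ae ?_
  filter_upwards [Lp.coeFn_add f g] with x hx
  rw [hx, Pi.add_apply, add_mul]

theorem integral_smul_mul (c : ℝ) (f : L2) (φ : ℝ → ℝ) :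
    ∫ x, (c • f) x * φ x = c * ∫ x, f x * φ x := by
  rw [← integral_const_mul]
  refine integral_congr_ae ?_
  filter_upwards [Lp.coeFn_smul c f] with x hx
  rw [hx, Pi.smul_apply, smul_eq_mul, mul_assoc]

theorem IsWeakDeriv.zero : IsWeakDeriv 0 0 := by
  intro φ _ _
  have h0 := integral_smul_mul 0 0 φ
  have h1 := integral_smul_mul 0 0 (deriv φ)
  rw [zero_smul, zero_mul] at h0 h1
  rw [h0, h1, neg_zero]

theorem IsWeakDeriv.add {f g f' g' : L2} (h : IsWeakDeriv f g) (h' : IsWeakDeriv f' g') :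
    IsWeakDeriv (f + f') (g + g') := by
  intro φ hφ hc
  rw [integral_add_mul f f' (hφ.continuous_deriv (by simp)) hc.deriv,
    integral_add_mul g g' hφ.continuous hc, h φ hφ hc, h' φ hφ hc]
  ring

theorem IsWeakDeriv.smul {f g : L2} (c : ℝ) (h : IsWeakDeriv f g) :
    IsWeakDeriv (c • f) (c • g) := by
  intro φ hφ hc
  rw [integral_smul_mul, integral_smul_mul, h φ hφ hc]
  ring

/-- The Sobolev space `H^k(ℝ)`, `k ∈ ℕ`: an element is the tuple `(w, w', …, w^{(k)})` of a function
`w ∈ L²(ℝ)` and its successive weak derivatives, all in `L²(ℝ)`.  The norm inherited from the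
`ℓ²`-product is the usual one, `‖w‖² = ∑_{j ≤ k} ‖w^{(j)}‖²_{L²}`. -/
def sobolevH (k : ℕ) : Submodule ℝ (PiLp 2 (fun _ : Fin (k + 1) => L2)) where
  carrier := {w | ∀ j : Fin k, IsWeakDeriv (w j.castSucc) (w j.succ)}
  zero_mem' := fun _ => IsWeakDeriv.zero
  add_mem' := fun ha hb j => (ha j).add (hb j)
  smul_mem' := fun c _ ha j => (ha j).smul c

/-- `H¹(ℝ)`. -/
abbrev H1 : Type := sobolevH 1

/-- `H²(ℝ)`. -/
abbrev H2 : Type := sobolevH 2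

/-- `w.d j` is the `j`-th weak derivative of `w ∈ H^k(ℝ)` (`w.d 0` is `w` itself). -/
def d {k : ℕ} (w : sobolevH k) (j : Fin (k + 1)) : L2 := w.1 j

/-- The continuous representative of (the a.e. class of) `g`, where there is one; it is then
unique.  For `w ∈ H^k(ℝ)` this applies to the weak derivatives of order less than `k`. -/
def contRep (g : ℝ → ℝ) : ℝ → ℝ :=
  Classical.epsilon fun c : ℝ → ℝ => Continuous c ∧ g =ᵐ[volume] c

/-- The norm of `H^s(ℝ)` for real `s`, `‖(1 + ξ²)^{s/2} ĝ‖_{L²}`, on integrable `g` with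
`ĝ(ξ) = ∫ e^{-2πixξ} g(x) dx`. -/
def fracNorm (s : ℝ) (g : ℝ → ℝ) : ℝ≥0∞ :=
  eLpNorm (fun ξ : ℝ => (1 + ξ ^ 2) ^ (s / 2) • 𝓕 (fun x : ℝ => (g x : ℂ)) ξ) 2 volume

/-- `u ∈ C⁰(I; H^s_loc(ℝ))` for `s ≥ 0`: for every cutoff `χ ∈ C_c^∞(ℝ)`, the map `t ↦ χ u(t)`
takes values in `H^s(ℝ)` and is continuous on `I` for the norm of `H^s(ℝ)`. -/
def ContinuousOnHLoc (s : ℝ) (I : Set ℝ) (u : ℝ → ℝ → ℝ) : Prop :=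
  ∀ χ : ℝ → ℝ, ContDiff ℝ ∞ χ → HasCompactSupport χ →
    (∀ t ∈ I, MemLp (fun x => χ x * u t x) 2 volume ∧ fracNorm s (fun x => χ x * u t x) < ⊤) ∧
    ∀ t₀ ∈ I, Tendsto (fun t => fracNorm s (fun x => χ x * (u t x - u t₀ x))) (𝓝[I] t₀) (𝓝 0)

/-- `W` is the weak time derivative of `U` on `(0, T)` (both Bochner integrable in time). -/
def IsWeakTimeDeriv (T : ℝ) (U W : ℝ → L2) : Prop :=
  ∀ φ : ℝ → ℝ, ContDiff ℝ ∞ φ → HasCompactSupport φ → tsupport φ ⊆ Ioo 0 T →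
    ∫ t in (0 : ℝ)..T, deriv φ t • U t = -∫ t in (0 : ℝ)..T, φ t • W t

/-- `v ∈ C²([0,T]; H²(ℝ))` with compact support in `[0,T) × ℝ`. -/
structure IsTestFunction (T : ℝ) (v : ℝ → H2) : Prop where
  contDiffOn : ContDiffOn ℝ 2 v (Icc 0 T)
  compact_support : ∃ T' < T, ∃ M : ℝ, ∀ t ∈ Icc 0 T,
    (T' < t → v t = 0) ∧ ∀ᵐ x : ℝ, M < |x| → d (v t) 0 x = 0

/-- The left-hand side of the weak formulation.  Here `u` is the displacement, `ut` its time
derivative, `v` the test function; the three local definitions are `ζ̇`, `v_t` and `v_tt`. -/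
def weakForm (T ν : ℝ) (u₀ : H2) (u₁ : H1) (ζ P : ℝ → ℝ) (f p : ℝ → H2)
    (u : ℝ → H2) (ut : ℝ → L2) (v : ℝ → H2) : ℝ :=
  let ζ' : ℝ → ℝ := derivWithin ζ (Icc 0 T)
  let vt : ℝ → H2 := derivWithin v (Icc 0 T)
  let vtt : ℝ → H2 := iteratedDerivWithin 2 v (Icc 0 T)
  (∫ t in (0 : ℝ)..T, ∫ x, ut t x * d (vt t) 0 x)
    - (∫ t in (0 : ℝ)..T, ∫ x, d (u t) 2 x * d (v t) 2 x)
    - 1 / 3 * (∫ t in (0 : ℝ)..T, ∫ x, d (u t) 1 x ^ 3 * d (v t) 1 x)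
    - (∫ t in (0 : ℝ)..T, ∫ x, ν * d (p t) 0 x * d (u t) 2 x * d (v t) 0 x)
    - contRep (d u₀ 0) (ζ 0) * contRep (d (vt 0) 0) (ζ 0)
    - (∫ t in (0 : ℝ)..T, contRep (d (u t) 0) (ζ t) * contRep (d (vtt t) 0) (ζ t))
    - (∫ t in (0 : ℝ)..T, ζ' t * contRep (d (u t) 1) (ζ t) * contRep (d (vt t) 0) (ζ t))
    - (∫ t in (0 : ℝ)..T, ζ' t * contRep (d (u t) 0) (ζ t) * contRep (d (vt t) 1) (ζ t))
    + (∫ t in (0 : ℝ)..T, ∫ x, d (f t) 0 x * d (v t) 0 x)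
    + (∫ t in (0 : ℝ)..T, P t * contRep (d (v t) 0) (ζ t))
    + (∫ x, d u₁ 0 x * d (v 0) 0 x)
    + contRep (d u₁ 0) (ζ 0) * contRep (d (v 0) 0) (ζ 0)

end GaoBeam

end

/-!
The solution is a limit of solutions of frequency-truncated problems, and the whole argument rests
on one a priori bound that does not depend on the truncation.

Testing the equation with `u_t`, as for a beam without a moving mass, does not give such a bound:
the power of the inertial force of the mass contains `ζ̇ u_{xt}(t, ζ(t)) u_t(t, ζ(t))`, which the
energy does not control. The velocity that the mass sees is the derivative `u_t + ζ̇ u_x` along its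
trajectory, and testing with this instead cancels the dangerous term. The corresponding energy is
the sum of the kinetic energy of beam and mass, the bending energy, the potential of the cubic term
and the cross term `ζ̇ ⟪M u_t, u_x⟫`, where `M = 1 + δ_{ζ(t)}`; a multiple of `‖u‖²` makes it
coercive (`MovingMassSystem.energy_lower`). The cubic term is harmless, since it is orthogonal to
`u_x`. Point values are absorbed by `|w(x)|² ≤ 2 ‖w‖ ‖w'‖`, and Grönwall's inequality gives the
bound (`MovingMassSystem.IsSolution.energy_le`).

For this computation only a bounded skew operator `D` in place of `∂ₓ`, and vectors `k x` with
`k' = -D k` in place of the Dirac masses, are needed; this is `MovingMassSystem`. Such a system is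
an ordinary differential equation with Lipschitz right-hand side, because `M` is a rank-one
perturbation of the identity with an explicit inverse. The beam provides instances on the frequency
side: on the complex space `L²` of Fourier transforms, regarded as a real Hilbert space, `D` is
multiplication by `2πiξ 1_{|ξ| ≤ n}` and `k x` is `1_{|ξ| ≤ n} e^{-2πixξ}`; the cubic nonlinearity
is truncated at a height `K` to make it Lipschitz (`BeamData.system`). The bound depends neither on
`n` nor on `K`, so `K` may be chosen so large that the truncation is never active.

The bound is in `H²` for the displacement and in `L²` for the velocity. By weak compactness a
subsequence of the velocities converges weakly in `L²(0,T; L²)`, hence the displacements converge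
weakly in `H²` at every time (`exists_isWeakLimit`). Weak convergence in `H²` gives pointwise
convergence of the displacements and of their slopes, so that in the weak formulation the term with
the velocity passes to the limit by weak convergence and all others by dominated convergence in time
(`BeamData.weak_form_of_isWeakLimit`). Finally the limit is bounded in `H²` and Lipschitz in time
with values in `L²`, and interpolation gives continuity in `H^s_loc` for `s < 2`
(`continuousOnHLoc_of_lipschitz`).
-/

open scoped InnerProductSpace

noncomputable section

namespace GaoBeam

/-! ### Ordinary differential equations and extension of curves -/

/-- `x` solves `x' = F(t, x)` on the closed interval `[a, b]`, with one-sided derivatives at the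
end points. -/
def SolvesOn {E : Type*} [NormedAddCommGroup E] [NormedSpace ℝ E] (F : ℝ → E → E) (x : ℝ → E)
    (a b : ℝ) : Prop :=
  ∀ t ∈ Icc a b, HasDerivWithinAt x (F t (x t)) (Icc a b) t

section ODE

variable {E : Type*} [NormedAddCommGroup E] [NormedSpace ℝ E]

theorem SolvesOn.glue {F : ℝ → E → E} {x y : ℝ → E} {a b c : ℝ} (hab : a ≤ b) (hbc : b ≤ c)
    (hx : SolvesOn F x a b) (hy : SolvesOn F y b c) (hxy : x b = y b) :
    SolvesOn F (fun t => if t ≤ b then x t else y t) a c := by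
  have key : ∀ t ∈ Icc a c, ∀ v, (t ≤ b → HasDerivWithinAt x v (Icc a b) t) →
      (b ≤ t → HasDerivWithinAt y v (Icc b c) t) →
      HasDerivWithinAt (fun t => if t ≤ b then x t else y t) v (Icc a c) t := by
    intro t ht v h1 h2
    rw [← Icc_union_Icc_eq_Icc hab hbc]
    refine HasDerivWithinAt.union ?_ ?_
    · by_cases htb : t ≤ b
      · refine (h1 htb).congr (fun s hs => by simp [hs.2]) (by simp [htb])
      · refine HasFDerivWithinAt.of_notMem_closure ?_
        rw [isClosed_Icc.closure_eq]
        exact fun h => htb h.2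
    · by_cases htb : b ≤ t
      · have hc : ∀ s ∈ Icc b c, (if s ≤ b then x s else y s) = y s := by
          intro s hs
          split_ifs with h
          · rw [le_antisymm h hs.1, hxy]
          · rfl
        exact (h2 htb).congr hc (hc t ⟨htb, ht.2⟩)
      · refine HasFDerivWithinAt.of_notMem_closure ?_
        rw [isClosed_Icc.closure_eq]
        exact fun h => htb h.1
  intro t ht
  refine key t ht _ (fun htb => ?_) (fun htb => ?_)
  · simpa [htb] using hx t ⟨ht.1, htb⟩
  · have := hy t ⟨htb, ht.2⟩
    dsimp only
    split_ifs with h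
    · have h' : t = b := le_antisymm h htb
      subst h'
      rwa [hxy]
    · exact this

/-- A vector field that is Lipschitz in space with constant `K` admits solutions through every
point on the time scale `1 / (2 (K + 1))`, irrespective of its size. -/
theorem exists_solvesOn_short [CompleteSpace E] {F : ℝ → E → E} {K : NNReal}
    (hL : ∀ t, LipschitzWith K (F t)) (hc : ∀ x, Continuous fun t => F t x) (t₀ : ℝ) (x₀ : E) :
    ∃ x : ℝ → E, x t₀ = x₀ ∧
      SolvesOn F x (t₀ - 1 / (2 * (K + 1))) (t₀ + 1 / (2 * (K + 1))) := by
  set h : ℝ := 1 / (2 * (K + 1)) with hh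
  have hK : (0 : ℝ) ≤ K := K.2
  have hpos : 0 < h := by positivity
  obtain ⟨C, hC⟩ := isCompact_Icc.exists_bound_of_continuousOn (s := Icc (t₀ - h) (t₀ + h))
    (hc x₀).continuousOn
  have hC0 : 0 ≤ C := (norm_nonneg _).trans (hC t₀ ⟨by linarith, by linarith⟩)
  -- On the ball of radius `C` the field is at most `(K + 1) C`, hence moves a point by less than
  -- `C` during the time `h`.
  lift C to NNReal using hC0
  have hPL : IsPicardLindelof F (tmin := t₀ - h) (tmax := t₀ + h) ⟨t₀, by constructor <;> linarith⟩
      x₀ C 0 (C + K * C) K := by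
    refine ⟨fun t _ => (hL t).lipschitzOnWith, fun x _ => (hc x).continuousOn, ?_, ?_⟩
    · intro t ht x hx
      have h1 : ‖F t x - F t x₀‖ ≤ K * ‖x - x₀‖ := by
        simpa [dist_eq_norm] using (hL t).dist_le_mul x x₀
      have h2 : ‖x - x₀‖ ≤ C := by simpa [dist_eq_norm] using hx
      have h3 := hC t ht
      calc ‖F t x‖ = ‖F t x₀ + (F t x - F t x₀)‖ := by congr 1; abel
        _ ≤ ‖F t x₀‖ + ‖F t x - F t x₀‖ := norm_add_le _ _
        _ ≤ C + K * C := by gcongr; exact h1.trans (by gcongr)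
    · have : max (t₀ + h - t₀) (t₀ - (t₀ - h)) = h := by simp
      simp only [NNReal.coe_add, NNReal.coe_mul, NNReal.coe_zero, sub_zero]
      rw [this, hh]
      field_simp
      nlinarith
  obtain ⟨x, hx0, hx⟩ := hPL.exists_eq_forall_mem_Icc_hasDerivWithinAt₀
  exact ⟨x, hx0, hx⟩

theorem SolvesOn.mono {F : ℝ → E → E} {x : ℝ → E} {a b a' b' : ℝ} (hx : SolvesOn F x a b)
    (ha : a ≤ a') (hb : b' ≤ b) : SolvesOn F x a' b' := fun t ht =>
  (hx t ⟨ha.trans ht.1, ht.2.trans hb⟩).mono (Icc_subset_Icc ha hb)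

/-- Global existence for a Lipschitz vector field. -/
theorem exists_hasDerivAt_of_lipschitz [CompleteSpace E] {F : ℝ → E → E} {K : NNReal}
    (hL : ∀ t, LipschitzWith K (F t)) (hc : ∀ x, Continuous fun t => F t x) (x₀ : E) (T : ℝ) :
    ∃ x : ℝ → E, x 0 = x₀ ∧ ∀ t ∈ Icc 0 T, HasDerivAt x (F t (x t)) t := by
  set h : ℝ := 1 / (2 * (K + 1)) with hh
  have hpos : 0 < h := by have : (0 : ℝ) ≤ K := K.2; positivity
  have key : ∀ n : ℕ, ∃ x : ℝ → E, x 0 = x₀ ∧ SolvesOn F x (-h) (h + n * h) := by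
    intro n
    induction n with
    | zero =>
      obtain ⟨x, hx0, hx⟩ := exists_solvesOn_short hL hc 0 x₀
      exact ⟨x, hx0, by simpa [← hh] using hx⟩
    | succ n ih =>
      obtain ⟨x, hx0, hx⟩ := ih
      obtain ⟨y, hy0, hy⟩ := exists_solvesOn_short hL hc (h + n * h) (x (h + n * h))
      have hn : 0 ≤ h + n * h := by positivity
      refine ⟨_, ?_, hx.glue (y := y) (by linarith) (c := h + (n + 1 : ℕ) * h) ?_ ?_ hy0.symm⟩
      · simp [hn, hx0]
      · push_cast; linarith
      · refine hy.mono (by linarith) ?_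
        push_cast
        linarith
  obtain ⟨n, hn⟩ := exists_nat_gt (T / h)
  rw [div_lt_iff₀ hpos] at hn
  obtain ⟨x, hx0, hx⟩ := key n
  refine ⟨x, hx0, fun t ht => ?_⟩
  have h1 : -h < t := by linarith [ht.1]
  have h2 : t < h + n * h := by linarith [ht.2]
  exact (hx t ⟨h1.le, h2.le⟩).hasDerivAt (Icc_mem_nhds h1 h2)

end ODE

/-- A `C²` curve on `[0, T]` extends to a `C²` curve on the line. -/
theorem exists_extension_of_contDiffOn {E : Type*} [NormedAddCommGroup E] [NormedSpace ℝ E]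
    [CompleteSpace E] {T : ℝ} (hT : 0 < T) {g : ℝ → E} (hg : ContDiffOn ℝ 2 g (Icc 0 T)) :
    ∃ G G' G'' : ℝ → E, (∀ t, HasDerivAt G (G' t) t) ∧ (∀ t, HasDerivAt G' (G'' t) t) ∧
      Continuous G'' ∧ ∀ t ∈ Icc 0 T, G t = g t ∧ G' t = derivWithin g (Icc 0 T) t ∧
        G'' t = iteratedDerivWithin 2 g (Icc 0 T) t := by
  have hu : UniqueDiffOn ℝ (Icc 0 T) := uniqueDiffOn_Icc hT
  have hcont : ContinuousOn (iteratedDerivWithin 2 g (Icc 0 T)) (Icc 0 T) :=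
    hg.continuousOn_iteratedDerivWithin (by simp) hu
  have hg1 : ∀ t ∈ Icc 0 T, HasDerivWithinAt g (derivWithin g (Icc 0 T) t) (Icc 0 T) t :=
    fun t ht => (hg.differentiableOn (by simp) t ht).hasDerivWithinAt
  have hg2 : ∀ t ∈ Icc 0 T, HasDerivWithinAt (derivWithin g (Icc 0 T))
      (iteratedDerivWithin 2 g (Icc 0 T) t) (Icc 0 T) t := by
    intro t ht
    have h1 : DifferentiableOn ℝ (iteratedDerivWithin 1 g (Icc 0 T)) (Icc 0 T) :=
      hg.differentiableOn_iteratedDerivWithin (by norm_num) hu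
    have h2 := (h1 t ht).hasDerivWithinAt
    rw [iteratedDerivWithin_succ]
    simpa only [iteratedDerivWithin_one] using h2
  set G2 : ℝ → E := fun t => iteratedDerivWithin 2 g (Icc 0 T) (projIcc 0 T hT.le t) with hG2
  have hG2c : Continuous G2 :=
    hcont.comp_continuous (continuous_subtype_val.comp continuous_projIcc)
      fun t => Subtype.coe_prop _
  have hG2e : ∀ t ∈ Icc 0 T, G2 t = iteratedDerivWithin 2 g (Icc 0 T) t := fun t ht => by
    simp [hG2, projIcc_of_mem hT.le ht]
  set G1 : ℝ → E := fun t => derivWithin g (Icc 0 T) 0 + ∫ s in (0 : ℝ)..t, G2 s with hG1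
  have hG1d : ∀ t, HasDerivAt G1 (G2 t) t := fun t =>
    (hG2c.integral_hasStrictDerivAt 0 t).hasDerivAt.const_add _
  have hG1c : Continuous G1 := continuous_iff_continuousAt.2 fun t => (hG1d t).continuousAt
  set G0 : ℝ → E := fun t => g 0 + ∫ s in (0 : ℝ)..t, G1 s with hG0
  have hG0d : ∀ t, HasDerivAt G0 (G1 t) t := fun t =>
    (hG1c.integral_hasStrictDerivAt 0 t).hasDerivAt.const_add _
  have ftc : ∀ (a b a' b' : ℝ → E), a 0 = b 0 → (∀ t, HasDerivAt a (a' t) t) →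
      (∀ t ∈ Icc 0 T, HasDerivWithinAt b (b' t) (Icc 0 T) t) → (∀ t ∈ Icc 0 T, a' t = b' t) →
      ∀ t ∈ Icc 0 T, a t = b t := by
    intro a b a' b' h0 ha hb hab t ht
    have := (convex_Icc (0 : ℝ) T).is_const_of_fderivWithin_eq_zero (𝕜 := ℝ)
      (f := fun t => a t - b t)
      (fun s hs => ((ha s).hasDerivWithinAt.sub (hb s hs)).differentiableWithinAt) ?_
      ht (left_mem_Icc.2 hT.le)
    · simpa [h0, sub_eq_zero] using this
    · intro s hs
      have h3 := (ha s).hasDerivWithinAt.sub (hb s hs)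
      rw [hab s hs, sub_self] at h3
      have h4 := h3.hasFDerivWithinAt.fderivWithin (hu s hs)
      exact h4.trans (by ext; simp)
  have e1 : ∀ t ∈ Icc 0 T, G1 t = derivWithin g (Icc 0 T) t :=
    ftc G1 _ G2 _ (by simp [hG1]) hG1d hg2 hG2e
  exact ⟨G0, G1, G2, hG0d, hG1d, hG2c, fun t ht =>
    ⟨ftc G0 _ G1 _ (by simp [hG0]) hG0d hg1 e1 t ht, e1 t ht, hG2e t ht⟩⟩

/-! ### An abstract moving-mass system with bounded operators -/

/-- A regularised moving-mass beam in a real Hilbert space `Y`.  The bounded skew-adjoint operator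
`D` plays the part of `∂ₓ`, the vector `k x` represents point evaluation at `x`, so that
`k' = -D k`; `N` is the gradient of the potential `Ψ` of the nonlinear stiffness, and `ζ` is the
trajectory of the mass.  All bounds are expressed through the single constant `Z`; the Lipschitz
constant of `N` and the norms of `D` and `k` do not take part in the a priori estimate. -/
structure MovingMassSystem (Y : Type*) [NormedAddCommGroup Y] [InnerProductSpace ℝ Y] where
  /-- the regularised space derivative -/
  D : Y →L[ℝ] Y
  /-- the regularised Dirac masses -/
  k : ℝ → Y
  skew : ∀ a b, ⟪D a, b⟫_ℝ = -⟪a, D b⟫_ℝ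
  hasDerivAt_k : ∀ x, HasDerivAt k (-(D (k x))) x
  trace_sq_le : ∀ b x, ⟪b, k x⟫_ℝ ^ 2 ≤ 2 * ‖b‖ * ‖D b‖
  /-- the nonlinear force -/
  N : Y → Y
  /-- the Lipschitz constant of the nonlinear force -/
  L : NNReal
  lipschitz_N : LipschitzWith L N
  /-- the potential of the nonlinear force -/
  Ψ : Y → ℝ
  Ψ_nonneg : ∀ a, 0 ≤ Ψ a
  hasFDerivAt_Ψ : ∀ a, HasFDerivAt Ψ (innerSL ℝ (N a)) a
  inner_N_D : ∀ a, ⟪N a, D a⟫_ℝ = 0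
  /-- the trajectory of the mass -/
  ζ : ℝ → ℝ
  /-- the velocity of the trajectory -/
  ζ' : ℝ → ℝ
  /-- the acceleration of the trajectory -/
  ζ'' : ℝ → ℝ
  hasDerivAt_ζ : ∀ t, HasDerivAt ζ (ζ' t) t
  hasDerivAt_ζ' : ∀ t, HasDerivAt ζ' (ζ'' t) t
  /-- the linear axial load -/
  B : ℝ → Y →L[ℝ] Y
  continuous_B : Continuous B
  /-- the distributed force -/
  F : ℝ → Y
  continuous_F : Continuous F
  /-- the force at the position of the mass -/
  P : ℝ → ℝ
  continuous_P : Continuous P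
  /-- the length of the time interval -/
  T : ℝ
  /-- a common bound for the data -/
  Z : ℝ
  one_le_Z : 1 ≤ Z
  ζ'_le : ∀ t ∈ Icc 0 T, |ζ' t| ≤ Z
  ζ''_le : ∀ t ∈ Icc 0 T, |ζ'' t| ≤ Z
  B_le : ∀ t a, ‖B t a‖ ≤ Z * ‖D (D a)‖
  F_le : ∀ t, ‖F t‖ ≤ Z
  P_le : ∀ t, |P t| ≤ Z

namespace MovingMassSystem

variable {Y : Type*} [NormedAddCommGroup Y] [InnerProductSpace ℝ Y] (s : MovingMassSystem Y)

/-- The mass operator `z ↦ z + δ_{ζ(t)} z` at time `t`. -/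
def mass (t : ℝ) (z : Y) : Y := z + ⟪z, s.k (s.ζ t)⟫_ℝ • s.k (s.ζ t)

/-- The inverse of the mass operator. -/
def massInv (t : ℝ) (q : Y) : Y :=
  q - (⟪q, s.k (s.ζ t)⟫_ℝ / (1 + ‖s.k (s.ζ t)‖ ^ 2)) • s.k (s.ζ t)

/-- The total force in the configuration `a` at time `t`. -/
def force (t : ℝ) (a : Y) : Y :=
  -(s.D (s.D (s.D (s.D a)))) - s.N a - s.B t a + s.F t + s.P t • s.k (s.ζ t)

/-- `a` with velocity `z` and acceleration `z'` solves the system on `[0, T]`. -/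
structure IsSolution (a z z' : ℝ → Y) : Prop where
  hasDerivAt : ∀ t ∈ Icc 0 s.T, HasDerivAt a (z t) t
  hasDerivAt_velocity : ∀ t ∈ Icc 0 s.T, HasDerivAt z (z' t) t
  hasDerivAt_mass : ∀ t ∈ Icc 0 s.T, HasDerivAt (fun r => s.mass r (z r)) (s.force t (a t)) t

theorem mass_massInv (t : ℝ) (q : Y) : s.mass t (s.massInv t q) = q := by
  have h : (1 + ‖s.k (s.ζ t)‖ ^ 2) ≠ 0 := by positivity
  simp only [mass, massInv, inner_sub_left, real_inner_smul_left, real_inner_self_eq_norm_sq]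
  rw [sub_add, ← sub_smul]
  convert sub_zero q
  rw [smul_eq_zero]
  left
  field_simp
  ring

theorem massInv_mass (t : ℝ) (z : Y) : s.massInv t (s.mass t z) = z := by
  have h : (1 + ‖s.k (s.ζ t)‖ ^ 2) ≠ 0 := by positivity
  simp only [mass, massInv, inner_add_left, real_inner_smul_left, real_inner_self_eq_norm_sq]
  rw [add_sub_assoc, ← sub_smul]
  convert add_zero z
  rw [smul_eq_zero]
  left
  field_simp
  ring

theorem inner_D_self (a : Y) : ⟪a, s.D a⟫_ℝ = 0 := by
  have h := s.skew a a
  rw [real_inner_comm] at h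
  linarith

theorem norm_D_sq_le (a : Y) : ‖s.D a‖ ^ 2 ≤ ‖a‖ * ‖s.D (s.D a)‖ := by
  have h := s.skew a (s.D a)
  rw [real_inner_self_eq_norm_sq] at h
  rw [h]
  exact (neg_le_abs _).trans (abs_real_inner_le_norm _ _)

theorem hasDerivAt_k_comp (t : ℝ) :
    HasDerivAt (fun r => s.k (s.ζ r)) (-(s.ζ' t • s.D (s.k (s.ζ t)))) t := by
  have := (s.hasDerivAt_k (s.ζ t)).scomp t (s.hasDerivAt_ζ t)
  rwa [smul_neg] at this

theorem continuous_k_comp : Continuous fun t => s.k (s.ζ t) :=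
  continuous_iff_continuousAt.2 fun t => (s.hasDerivAt_k_comp t).continuousAt

/-- The derivative of the trace `⟪b(t), k(ζ(t))⟫` is the convective derivative
`⟪b' + ζ' D b, k(ζ(t))⟫`. -/
theorem hasDerivAt_trace {b : ℝ → Y} {b' : Y} {t : ℝ} (hb : HasDerivAt b b' t) :
    HasDerivAt (fun r => ⟪b r, s.k (s.ζ r)⟫_ℝ)
      (⟪b', s.k (s.ζ t)⟫_ℝ + s.ζ' t * ⟪s.D (b t), s.k (s.ζ t)⟫_ℝ) t := by
  have := hb.inner ℝ (s.hasDerivAt_k_comp t)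
  refine this.congr_deriv ?_
  rw [inner_neg_right, real_inner_smul_right, s.skew]
  ring

theorem norm_massInv_le (t : ℝ) (q : Y) : ‖s.massInv t q‖ ≤ 2 * ‖q‖ := by
  have h : 0 < (1 + ‖s.k (s.ζ t)‖ ^ 2) := by positivity
  refine (norm_sub_le _ _).trans ?_
  have : ‖(⟪q, s.k (s.ζ t)⟫_ℝ / (1 + ‖s.k (s.ζ t)‖ ^ 2)) • s.k (s.ζ t)‖ ≤ ‖q‖ := by
    rw [norm_smul, norm_div, Real.norm_eq_abs, Real.norm_of_nonneg h.le, div_mul_eq_mul_div,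
      div_le_iff₀ h]
    have h1 := abs_real_inner_le_norm q (s.k (s.ζ t))
    nlinarith [norm_nonneg q, norm_nonneg (s.k (s.ζ t)),
      mul_le_mul_of_nonneg_right h1 (norm_nonneg (s.k (s.ζ t)))]
  linarith

theorem massInv_sub (t : ℝ) (q q' : Y) :
    s.massInv t q - s.massInv t q' = s.massInv t (q - q') := by
  simp only [massInv, inner_sub_left, sub_div, sub_smul]
  abel

theorem lipschitz_massInv (t : ℝ) : LipschitzWith 2 (s.massInv t) :=
  LipschitzWith.of_dist_le_mul fun q q' => by
    rw [dist_eq_norm, dist_eq_norm, massInv_sub]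
    exact s.norm_massInv_le t _

theorem lipschitz_force (t : ℝ) : LipschitzWith
    (‖s.D‖₊ * (‖s.D‖₊ * (‖s.D‖₊ * ‖s.D‖₊)) + s.L + (Real.toNNReal s.Z * (‖s.D‖₊ * ‖s.D‖₊)))
    (s.force t) := by
  have h4 : LipschitzWith (‖s.D‖₊ * (‖s.D‖₊ * (‖s.D‖₊ * ‖s.D‖₊)))
      fun a => s.D (s.D (s.D (s.D a))) :=
    s.D.lipschitz.comp (s.D.lipschitz.comp (s.D.lipschitz.comp s.D.lipschitz))
  have hB : LipschitzWith (Real.toNNReal s.Z * (‖s.D‖₊ * ‖s.D‖₊)) fun a => s.B t a := by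
    refine LipschitzWith.of_dist_le_mul fun a b => ?_
    rw [dist_eq_norm, dist_eq_norm, ← map_sub]
    have hZ : 0 ≤ s.Z := zero_le_one.trans s.one_le_Z
    refine (s.B_le t _).trans ?_
    push_cast
    rw [Real.coe_toNNReal _ hZ, mul_assoc, mul_assoc]
    gcongr
    exact (s.D.le_opNorm _).trans (by gcongr; exact s.D.le_opNorm _)
  have := ((h4.neg.sub s.lipschitz_N).sub hB).add
    (LipschitzWith.const (s.F t + s.P t • s.k (s.ζ t)))
  rw [add_zero] at this
  have e : s.force t = fun a => -(s.D (s.D (s.D (s.D a)))) - s.N a - s.B t a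
      + (s.F t + s.P t • s.k (s.ζ t)) := by
    funext a
    rw [force, add_assoc]
  rw [e]
  exact this

theorem continuous_force_left (a : Y) : Continuous fun t => s.force t a := by
  have := s.continuous_k_comp
  have hB := s.continuous_B
  have hF := s.continuous_F
  have hP := s.continuous_P
  unfold force
  fun_prop

theorem hasDerivAt_massInv {q : ℝ → Y} {q' : Y} {t : ℝ} (hq : HasDerivAt q q' t) :
    DifferentiableAt ℝ (fun r => s.massInv r (q r)) t := by
  have hk := (s.hasDerivAt_k_comp t).differentiableAt
  have hq' := hq.differentiableAt
  unfold massInv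
  have h1 : DifferentiableAt ℝ (fun r => ⟪q r, s.k (s.ζ r)⟫_ℝ) t := hq'.inner ℝ hk
  have h2 : DifferentiableAt ℝ (fun r => 1 + ‖s.k (s.ζ r)‖ ^ 2) t :=
    (hk.norm_sq ℝ).const_add 1
  exact hq'.sub ((h1.div h2 (by positivity)).smul hk)

theorem exists_isSolution [CompleteSpace Y] (a₀ z₀ : Y) :
    ∃ a z z' : ℝ → Y, a 0 = a₀ ∧ z 0 = z₀ ∧ s.IsSolution a z z' := by
  set K := (‖s.D‖₊ * (‖s.D‖₊ * (‖s.D‖₊ * ‖s.D‖₊)) + s.L +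
    (Real.toNNReal s.Z * (‖s.D‖₊ * ‖s.D‖₊)))
  obtain ⟨x, hx0, hx⟩ := exists_hasDerivAt_of_lipschitz (E := Y × Y)
    (F := fun t x => (s.massInv t x.2, s.force t x.1)) (K := max 2 K)
    (fun t => by
      have h1 := (s.lipschitz_massInv t).comp (LipschitzWith.prod_snd (α := Y) (β := Y))
      have h2 := (s.lipschitz_force t).comp (LipschitzWith.prod_fst (α := Y) (β := Y))
      simpa using h1.prodMk h2)
    (fun x => by
      refine Continuous.prodMk ?_ (s.continuous_force_left _)
      refine continuous_iff_continuousAt.2 fun t => ?_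
      exact (s.hasDerivAt_massInv (q := fun _ => x.2) (hasDerivAt_const t x.2)).continuousAt)
    (a₀, s.mass 0 z₀) s.T
  have hq : ∀ t ∈ Icc 0 s.T, HasDerivAt (fun r => (x r).2) (s.force t (x t).1) t :=
    fun t ht => (hasFDerivAt_snd (𝕜 := ℝ) (p := x t)).comp_hasDerivAt t (hx t ht)
  refine ⟨fun t => (x t).1, fun t => s.massInv t (x t).2,
    deriv fun t => s.massInv t (x t).2, by simp [hx0], by simp [hx0, massInv_mass], ?_, ?_, ?_⟩
  · exact fun t ht => (hasFDerivAt_fst (𝕜 := ℝ) (p := x t)).comp_hasDerivAt t (hx t ht)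
  · exact fun t ht => (s.hasDerivAt_massInv (hq t ht)).hasDerivAt
  · intro t ht
    simpa only [mass_massInv] using hq t ht

/-- The energy of the system: the Hamiltonian `⟪M z, z + ζ' D a⟫ - ½ ⟪M z, z⟫ + ½ ‖D² a‖² + Ψ a`
in the frame that moves with the mass, plus a multiple of `‖a‖²` that makes it coercive:
`162 Z⁸ ‖a‖²` is what absorbing the cross term costs. -/
def energy (t : ℝ) (a z : Y) : ℝ :=
  1 / 2 * ‖z‖ ^ 2 + 1 / 2 * ⟪z, s.k (s.ζ t)⟫_ℝ ^ 2 + 1 / 2 * ‖s.D (s.D a)‖ ^ 2 + s.Ψ a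
    + s.ζ' t * ⟪s.mass t z, s.D a⟫_ℝ + 163 * s.Z ^ 8 * ‖a‖ ^ 2

theorem inner_mass (t : ℝ) (z b : Y) :
    ⟪s.mass t z, b⟫_ℝ = ⟪z, b⟫_ℝ + ⟪z, s.k (s.ζ t)⟫_ℝ * ⟪b, s.k (s.ζ t)⟫_ℝ := by
  rw [mass, inner_add_left, real_inner_smul_left, real_inner_comm b (s.k _)]

theorem inner_force (t : ℝ) (a b : Y) :
    ⟪s.force t a, b⟫_ℝ = -⟪s.D (s.D a), s.D (s.D b)⟫_ℝ - ⟪s.N a, b⟫_ℝ - ⟪s.B t a, b⟫_ℝ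
      + ⟪s.F t, b⟫_ℝ + s.P t * ⟪b, s.k (s.ζ t)⟫_ℝ := by
  rw [force, inner_add_left, inner_add_left, inner_sub_left, inner_sub_left, inner_neg_left,
    real_inner_smul_left, real_inner_comm b (s.k _), s.skew (s.D (s.D (s.D a))) b,
    s.skew (s.D (s.D a)) (s.D b), neg_neg]

theorem energy_lower {t : ℝ} (ht : t ∈ Icc 0 s.T) (a z : Y) :
    1 / 4 * (‖z‖ ^ 2 + ⟪z, s.k (s.ζ t)⟫_ℝ ^ 2 + ‖s.D (s.D a)‖ ^ 2) + ‖a‖ ^ 2 + s.Ψ a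
      ≤ s.energy t a z := by
  have hZ := s.one_le_Z
  have hζ := s.ζ'_le t ht
  have hA := s.norm_D_sq_le a
  have hμ := s.trace_sq_le (s.D a) (s.ζ t)
  have hX := abs_real_inner_le_norm z (s.D a)
  rw [energy, inner_mass]
  generalize ⟪z, s.k (s.ζ t)⟫_ℝ = l at *
  generalize ⟪s.D a, s.k (s.ζ t)⟫_ℝ = μ at *
  generalize ⟪z, s.D a⟫_ℝ = w at *
  generalize ‖s.D (s.D a)‖ = A₂ at *
  generalize ‖s.D a‖ = A₁ at *
  have hA0 := norm_nonneg a
  generalize ‖a‖ = A at *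
  generalize ‖z‖ = X at *
  generalize s.ζ' t = y at *
  generalize s.Z = Z at *
  have hy2 : y ^ 2 ≤ Z ^ 2 := sq_le_sq' (by linarith [neg_abs_le y]) (le_of_abs_le hζ)
  have hw2 : w ^ 2 ≤ X ^ 2 * A₁ ^ 2 := by
    rw [← mul_pow]; exact sq_le_sq' (by linarith [neg_abs_le w]) (le_of_abs_le hX)
  have h1 : -(y * w) ≤ 1 / 4 * X ^ 2 + Z ^ 2 * A₁ ^ 2 := by
    refine (neg_le_abs _).trans (abs_le_of_sq_le_sq ?_ (by positivity))
    have : (y * w) ^ 2 ≤ Z ^ 2 * (X ^ 2 * A₁ ^ 2) := by rw [mul_pow]; gcongr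
    nlinarith [sq_nonneg (1 / 4 * X ^ 2 - Z ^ 2 * A₁ ^ 2)]
  have h2 : -(y * (l * μ)) ≤ 1 / 4 * l ^ 2 + Z ^ 2 * μ ^ 2 := by
    have : y ^ 2 * μ ^ 2 ≤ Z ^ 2 * μ ^ 2 := by gcongr
    nlinarith [sq_nonneg (1 / 2 * l + y * μ)]
  have h3 : Z ^ 2 * μ ^ 2 ≤ 1 / 8 * A₂ ^ 2 + 8 * Z ^ 4 * A₁ ^ 2 := by
    have : Z ^ 2 * μ ^ 2 ≤ Z ^ 2 * (2 * A₁ * A₂) := by gcongr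
    nlinarith [sq_nonneg (A₂ - 8 * Z ^ 2 * A₁)]
  have h4 : Z ^ 2 * A₁ ^ 2 ≤ Z ^ 4 * A₁ ^ 2 := by gcongr; norm_num
  have h5 : 9 * Z ^ 4 * A₁ ^ 2 ≤ 1 / 8 * A₂ ^ 2 + 162 * Z ^ 8 * A ^ 2 := by
    have : 9 * Z ^ 4 * A₁ ^ 2 ≤ 9 * Z ^ 4 * (A * A₂) := by gcongr
    nlinarith [sq_nonneg (A₂ - 36 * Z ^ 4 * A)]
  have h6 : A ^ 2 ≤ Z ^ 8 * A ^ 2 := le_mul_of_one_le_left (sq_nonneg _) (one_le_pow₀ hZ)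
  nlinarith


variable {s}

/-- The power balance: the multiplier `z + ζ' D a` removes every term that the energy does not
control, in particular `⟪z, k⟫ ⟪D z, k⟫`. -/
theorem IsSolution.hasDerivAt_energy {a z z' : ℝ → Y} (h : s.IsSolution a z z') {t : ℝ}
    (ht : t ∈ Icc 0 s.T) :
    HasDerivAt (fun r => s.energy r (a r) (z r))
      (s.ζ'' t * ⟪s.mass t (z t), s.D (a t)⟫_ℝ - ⟪s.B t (a t), z t + s.ζ' t • s.D (a t)⟫_ℝ
        + ⟪s.F t, z t + s.ζ' t • s.D (a t)⟫_ℝ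
        + s.P t * ⟪z t + s.ζ' t • s.D (a t), s.k (s.ζ t)⟫_ℝ
        + 163 * s.Z ^ 8 * (2 * ⟪a t, z t⟫_ℝ)) t := by
  have ha := h.hasDerivAt t ht
  have hz := h.hasDerivAt_velocity t ht
  have hq := h.hasDerivAt_mass t ht
  have hDa : HasDerivAt (fun r => s.D (a r)) (s.D (z t)) t := s.D.hasFDerivAt.comp_hasDerivAt t ha
  have hDDa : HasDerivAt (fun r => s.D (s.D (a r))) (s.D (s.D (z t))) t :=
    s.D.hasFDerivAt.comp_hasDerivAt t hDa
  have hl := s.hasDerivAt_trace hz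
  have hΨ := (s.hasFDerivAt_Ψ (a t)).comp_hasDerivAt t ha
  have e1 := (((((hz.norm_sq.const_mul (1 / 2)).add ((hl.pow 2).const_mul (1 / 2))).add
    (hDDa.norm_sq.const_mul (1 / 2))).add hΨ).add
    ((s.hasDerivAt_ζ' t).mul (hq.inner ℝ hDa))).add
    (ha.norm_sq.const_mul (163 * s.Z ^ 8))
  refine e1.congr_deriv ?_
  have k1 := s.inner_D_self (z t)
  have k2 := s.inner_D_self (s.D (s.D (a t)))
  have k3 := s.inner_N_D (a t)
  -- Both expressions for the derivative of `⟪M z, z⟫ = ‖z‖² + ⟪z, k⟫²`.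
  have k4 : ⟪s.mass t (z t), z' t⟫_ℝ + ⟪s.force t (a t), z t⟫_ℝ =
      2 * ⟪z t, z' t⟫_ℝ + (2 : ℕ) * ⟪z t, s.k (s.ζ t)⟫_ℝ ^ (2 - 1) *
        (⟪z' t, s.k (s.ζ t)⟫_ℝ + s.ζ' t * ⟪s.D (z t), s.k (s.ζ t)⟫_ℝ) := by
    refine (hq.inner ℝ hz).unique ((hz.norm_sq.add (hl.pow 2)).congr_of_eventuallyEq ?_)
    filter_upwards with r
    rw [inner_mass, real_inner_self_eq_norm_sq]
    simp [sq]
  simp only [inner_force, inner_mass, inner_add_right, inner_add_left, real_inner_smul_right,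
    real_inner_smul_left, innerSL_apply_apply, k1, k2, k3] at k4 ⊢
  push_cast at k4 ⊢
  linear_combination -k4

/-- The numerical inequality behind the bound of the power by the energy: `X`, `l`, `A`, `A₁`, `A₂`
and `μ` stand for `‖z‖`, `⟪z, k⟫`, `‖a‖`, `‖D a‖`, `‖D² a‖` and `⟪D a, k⟫`. -/
theorem power_le_aux {Z X l A A₁ A₂ μ y₁ y₂ π w₁ w₂ w₃ w₄ w₅ w₆ En : ℝ} (hZ : 1 ≤ Z)
    (hA : A₁ ^ 2 ≤ A * A₂) (hμ : μ ^ 2 ≤ 2 * A₁ * A₂)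
    (b1 : |y₁| ≤ Z) (b2 : |y₂| ≤ Z) (b5 : |π| ≤ Z) (i1 : |w₁| ≤ X * A₁) (i2 : |w₂| ≤ Z * A₂ * X)
    (i3 : |w₃| ≤ Z * A₂ * A₁) (i4 : |w₄| ≤ Z * X) (i5 : |w₅| ≤ Z * A₁) (i6 : |w₆| ≤ A * X)
    (hE : 1 / 4 * (X ^ 2 + l ^ 2 + A₂ ^ 2) + A ^ 2 ≤ En) :
    y₂ * (w₁ + l * μ) - (w₂ + y₁ * w₃) + (w₄ + y₁ * w₅) + π * (l + y₁ * μ)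
      + 163 * Z ^ 8 * (2 * w₆) ≤ 800 * Z ^ 8 * (En + 1) := by
  have z2 : 1 ≤ Z ^ 2 := one_le_pow₀ hZ
  have z8 : Z ^ 2 ≤ Z ^ 8 := pow_le_pow_right₀ hZ (by norm_num)
  have z1 : Z ≤ Z ^ 2 := by nlinarith only [hZ]
  obtain ⟨N, hN⟩ : ∃ N, N = X ^ 2 + l ^ 2 + A₂ ^ 2 + A ^ 2 := ⟨_, rfl⟩
  have hN4 : N ≤ 4 * En := by linarith only [hN, hE, sq_nonneg A]
  have hN0 : 0 ≤ N := by rw [hN]; positivity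
  have sX := sq_nonneg X
  have sl := sq_nonneg l
  have sA := sq_nonneg A
  have sA2 := sq_nonneg A₂
  have a1 : A₁ ^ 2 ≤ N / 2 := by linarith only [sq_nonneg (A - A₂), hA, hN, sX, sl]
  have aμ : μ ^ 2 ≤ 2 * N := by
    linarith only [sq_nonneg (A₁ - A₂), hμ, a1, hN, sX, sl, sA, sA2, hN0]
  have prod : ∀ c w x b : ℝ, |c| ≤ b → |w| ≤ x → c * w ≤ b * x := fun c w x b h1 h2 =>
    (le_abs_self _).trans ((abs_mul c w).trans_le
      (mul_le_mul h1 h2 (abs_nonneg _) ((abs_nonneg _).trans h1)))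
  have hZ0 : 0 ≤ Z := by linarith only [hZ]
  have t1 : y₂ * (w₁ + l * μ) ≤ Z * (3 * N) := by
    refine prod _ _ _ _ b2 ((abs_add_le _ _).trans ?_)
    have h1 : |l * μ| ≤ 2 * N := by
      rw [abs_le]
      constructor <;> linarith only [sq_nonneg (l + μ), sq_nonneg (l - μ), aμ, hN, sX, sA, sA2]
    linarith only [sq_nonneg (X - A₁), h1, i1, a1, hN, sX, sl, sA, sA2]
  have x1 : A₂ * X ≤ N := by linarith only [sq_nonneg (X - A₂), hN, sX, sl, sA, sA2]
  have x2 : A₂ * A₁ ≤ N := by linarith only [sq_nonneg (A₁ - A₂), a1, hN, sX, sl, sA, sA2]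
  have t2 : -w₂ ≤ Z * N := (neg_le_abs _).trans (i2.trans (by rw [mul_assoc]; gcongr))
  have t3 : y₁ * (-w₃) ≤ Z * (Z * N) := prod _ _ _ _ b1
    (by rw [abs_neg]; exact i3.trans (by rw [mul_assoc]; gcongr))
  have x3 : X ≤ 1 + N := by linarith only [sq_nonneg (X - 1), hN, sX, sl, sA, sA2]
  have x4 : A₁ ≤ 1 + N := by linarith only [sq_nonneg (A₁ - 1), a1, hN, hN0]
  have t4 : w₄ ≤ Z * (1 + N) := (le_abs_self _).trans (i4.trans (by gcongr))
  have t5 : y₁ * w₅ ≤ Z * (Z * (1 + N)) := prod _ _ _ _ b1 (i5.trans (by gcongr))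
  have x5 : |l| ≤ 1 + N := abs_le.2
    ⟨by linarith only [sq_nonneg (l + 1), hN, sX, sl, sA, sA2],
      by linarith only [sq_nonneg (l - 1), hN, sX, sl, sA, sA2]⟩
  have x6 : |μ| ≤ 1 + N := abs_le.2
    ⟨by linarith only [sq_nonneg (μ + 2), aμ, hN0], by linarith only [sq_nonneg (μ - 2), aμ, hN0]⟩
  have t6 : π * l ≤ Z * (1 + N) := prod _ _ _ _ b5 x5
  have t7 : π * (y₁ * μ) ≤ Z * (Z * (1 + N)) := prod _ _ _ _ b5
    (by rw [abs_mul]; exact mul_le_mul b1 x6 (abs_nonneg _) hZ0)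
  have t8 : Z ^ 8 * w₆ ≤ Z ^ 8 * (N / 2) := by
    gcongr
    exact (le_abs_self _).trans
      (i6.trans (by linarith only [sq_nonneg (X - A), hN, sX, sl, sA, sA2]))
  have m1 : Z * N ≤ Z ^ 8 * N := by gcongr; linarith only [z1, z8]
  have m2 : Z ^ 2 * N ≤ Z ^ 8 * N := by gcongr
  have m3 : Z ≤ Z ^ 8 := by linarith only [z1, z8]
  have m4 : Z ^ 8 * N ≤ Z ^ 8 * (4 * En) := by gcongr
  have m5 : 0 ≤ Z ^ 8 := by positivity
  have m6 : 0 ≤ Z ^ 8 * En := mul_nonneg m5 (by linarith only [hN4, hN0])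
  linarith only [t1, t2, t3, t4, t5, t6, t7, t8, m1, m2, m3, m4, m5, m6, z8]

/-- The a priori estimate.  The bound involves the initial energy, `Z` and `T` only. -/
theorem IsSolution.energy_le {a z z' : ℝ → Y} (h : s.IsSolution a z z') {t : ℝ}
    (ht : t ∈ Icc 0 s.T) :
    s.energy t (a t) (z t) + 1 ≤
      (s.energy 0 (a 0) (z 0) + 1) * Real.exp (800 * s.Z ^ 8 * s.T) := by
  have hZ := s.one_le_Z
  have hT : 0 ≤ s.T := ht.1.trans ht.2
  set E' : ℝ → ℝ := fun t => s.ζ'' t * ⟪s.mass t (z t), s.D (a t)⟫_ℝ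
    - ⟪s.B t (a t), z t + s.ζ' t • s.D (a t)⟫_ℝ + ⟪s.F t, z t + s.ζ' t • s.D (a t)⟫_ℝ
    + s.P t * ⟪z t + s.ζ' t • s.D (a t), s.k (s.ζ t)⟫_ℝ + 163 * s.Z ^ 8 * (2 * ⟪a t, z t⟫_ℝ)
    with hE'
  have hd : ∀ t ∈ Icc 0 s.T, HasDerivAt (fun r => s.energy r (a r) (z r)) (E' t) t :=
    fun t ht => h.hasDerivAt_energy ht
  have hE : ∀ t ∈ Icc 0 s.T, E' t ≤ 800 * s.Z ^ 8 * (s.energy t (a t) (z t) + 1) := by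
    intro t ht
    have hlow := s.energy_lower ht (a t) (z t)
    have hΨ := s.Ψ_nonneg (a t)
    have hA := s.norm_D_sq_le (a t)
    have hμ := s.trace_sq_le (s.D (a t)) (s.ζ t)
    have b1 := s.ζ'_le t ht
    have b2 := s.ζ''_le t ht
    have b3 := s.B_le t (a t)
    have b4 := s.F_le t
    have b5 := s.P_le t
    have i1 := abs_real_inner_le_norm (z t) (s.D (a t))
    have i2 := abs_real_inner_le_norm (s.B t (a t)) (z t)
    have i3 := abs_real_inner_le_norm (s.B t (a t)) (s.D (a t))
    have i4 := abs_real_inner_le_norm (s.F t) (z t)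
    have i5 := abs_real_inner_le_norm (s.F t) (s.D (a t))
    have i6 := abs_real_inner_le_norm (a t) (z t)
    simp only [hE', inner_mass, inner_add_right, inner_add_left, real_inner_smul_right,
      real_inner_smul_left]
    exact power_le_aux hZ hA hμ b1 b2
      b5 (i1.trans le_rfl) (i2.trans (mul_le_mul_of_nonneg_right b3 (norm_nonneg _)))
      (i3.trans (mul_le_mul_of_nonneg_right b3 (norm_nonneg _)))
      (i4.trans (mul_le_mul_of_nonneg_right b4 (norm_nonneg _)))
      (i5.trans (mul_le_mul_of_nonneg_right b4 (norm_nonneg _))) i6 (by linarith)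
  have hanti : AntitoneOn (fun r => (s.energy r (a r) (z r) + 1) *
      Real.exp (-(800 * s.Z ^ 8 * r))) (Icc 0 s.T) := by
    have hd2 : ∀ t ∈ Icc 0 s.T, HasDerivAt (fun r => (s.energy r (a r) (z r) + 1) *
        Real.exp (-(800 * s.Z ^ 8 * r)))
        ((E' t - 800 * s.Z ^ 8 * (s.energy t (a t) (z t) + 1)) *
          Real.exp (-(800 * s.Z ^ 8 * t))) t := by
      intro t ht
      refine (((hd t ht).add_const 1).mul
        (((hasDerivAt_id t).const_mul (800 * s.Z ^ 8)).neg.exp)).congr_deriv ?_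
      simp
      ring
    refine antitoneOn_of_deriv_nonpos (convex_Icc _ _)
      (fun t ht => (hd2 t ht).continuousAt.continuousWithinAt)
      (fun t ht => (hd2 t (interior_subset ht)).differentiableAt.differentiableWithinAt) ?_
    intro t ht
    rw [(hd2 t (interior_subset ht)).deriv]
    exact mul_nonpos_of_nonpos_of_nonneg (by linarith [hE t (interior_subset ht)])
      (Real.exp_pos _).le
  have h0 := hanti (left_mem_Icc.2 hT) ht ht.1
  simp only [mul_zero, neg_zero, Real.exp_zero, mul_one] at h0
  rw [Real.exp_neg, ← div_eq_mul_inv, div_le_iff₀ (Real.exp_pos _)] at h0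
  refine h0.trans ?_
  have hpos : 0 ≤ s.energy 0 (a 0) (z 0) + 1 := by
    have := s.energy_lower (left_mem_Icc.2 hT) (a 0) (z 0)
    have := s.Ψ_nonneg (a 0)
    nlinarith [sq_nonneg ‖z 0‖, sq_nonneg ⟪z 0, s.k (s.ζ 0)⟫_ℝ, sq_nonneg ‖s.D (s.D (a 0))‖,
      sq_nonneg ‖a 0‖]
  gcongr
  exact ht.2

end MovingMassSystem

/-! ### The Fourier transform on `L²` -/

theorem ae_eq_of_integral_schwartz_smul_eq {g h : ℝ → ℂ} (hg : LocallyIntegrable g)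
    (hh : LocallyIntegrable h)
    (H : ∀ φ : SchwartzMap ℝ ℂ, ∫ x, φ x • g x = ∫ x, φ x • h x) : g =ᵐ[volume] h := by
  refine ae_eq_of_integral_contDiff_smul_eq hg hh fun φ hφ hc => ?_
  have hφ1 : HasCompactSupport (Complex.ofRealCLM ∘ φ) := hc.comp_left rfl
  have hφ2 : ContDiff ℝ ∞ (Complex.ofRealCLM ∘ φ) := by fun_prop
  simpa using H (hφ1.toSchwartzMap hφ2)

/-- On `L¹ ∩ L²` the Fourier transform of `L²` is given by the integral. -/
theorem coeFn_fourier_toLp {g : ℝ → ℂ} (h1 : Integrable g) (h2 : MemLp g 2 volume) :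
    ⇑(𝓕 (h2.toLp g) : Lp ℂ 2 (volume : Measure ℝ)) =ᵐ[volume] 𝓕 g := by
  have hc : Continuous (𝓕 g) := VectorFourier.fourierIntegral_continuous
    Real.continuous_fourierChar continuous_inner h1
  refine ae_eq_of_integral_schwartz_smul_eq ((Lp.memLp _).locallyIntegrable one_le_two)
    hc.locallyIntegrable fun φ => ?_
  have e1 := DFunLike.congr_fun (Lp.fourier_toTemperedDistribution_eq (h2.toLp g)) φ
  rw [TemperedDistribution.fourier_apply, Lp.toTemperedDistribution_apply,
    Lp.toTemperedDistribution_apply] at e1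
  rw [← e1]
  have e2 := VectorFourier.integral_fourierIntegral_smul_eq_flip (L := innerₗ ℝ)
    Real.continuous_fourierChar continuous_inner (φ.integrable (μ := volume)) h1
  rw [flip_innerₗ] at e2
  refine Eq.trans (integral_congr_ae ?_) e2
  filter_upwards [h2.coeFn_toLp] with x hx
  rw [hx]
  rfl

/-- On `L¹ ∩ L²` the inverse Fourier transform of `L²` is given by the integral. -/
theorem coeFn_fourierInv_toLp {g : ℝ → ℂ} (h1 : Integrable g) (h2 : MemLp g 2 volume) :
    ⇑(𝓕⁻ (h2.toLp g) : Lp ℂ 2 (volume : Measure ℝ)) =ᵐ[volume] 𝓕⁻ g := by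
  have hL : Continuous fun p : ℝ × ℝ => (-innerₗ ℝ) p.1 p.2 := continuous_inner.neg
  have hc : Continuous (𝓕⁻ g) := VectorFourier.fourierIntegral_continuous
    Real.continuous_fourierChar hL h1
  refine ae_eq_of_integral_schwartz_smul_eq ((Lp.memLp _).locallyIntegrable one_le_two)
    hc.locallyIntegrable fun φ => ?_
  have e1 := DFunLike.congr_fun (Lp.fourierInv_toTemperedDistribution_eq (h2.toLp g)) φ
  rw [TemperedDistribution.fourierInv_apply, Lp.toTemperedDistribution_apply,
    Lp.toTemperedDistribution_apply] at e1
  rw [← e1]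
  have e2 := VectorFourier.integral_fourierIntegral_smul_eq_flip (L := -innerₗ ℝ)
    Real.continuous_fourierChar hL (φ.integrable (μ := volume)) h1
  have e3 : (-innerₗ ℝ : ℝ →ₗ[ℝ] ℝ →ₗ[ℝ] ℝ).flip = -innerₗ ℝ := by
    ext; simp
  rw [e3] at e2
  refine Eq.trans (integral_congr_ae ?_) e2
  filter_upwards [h2.coeFn_toLp] with x hx
  rw [hx, SchwartzMap.fourierInv_coe]
  rfl

/-- Complex-valued `L²` functions of the frequency, regarded as a real Hilbert space. -/
abbrev Freq : Type := Lp ℂ 2 (volume : Measure ℝ)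

/-- The real part of the inverse Fourier transform. -/
def synth : Freq →L[ℝ] L2 :=
  (Complex.reCLM.compLpL 2 volume).comp
    ((Lp.fourierTransformₗᵢ ℝ ℂ).symm.toLinearIsometry.toContinuousLinearMap.restrictScalars ℝ)

/-- The Fourier transform of a real function; the adjoint, and a right inverse, of `synth`. -/
def analysis : L2 →L[ℝ] Freq :=
  ((Lp.fourierTransformₗᵢ ℝ ℂ).toLinearIsometry.toContinuousLinearMap.restrictScalars ℝ).comp
    (Complex.ofRealCLM.compLpL 2 volume)

theorem synth_apply (a : Freq) : synth a = Complex.reCLM.compLp (𝓕⁻ a) := rfl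

theorem analysis_apply (w : L2) : analysis w = 𝓕 (Complex.ofRealCLM.compLp w) := rfl

theorem coeFn_synth (a : Freq) : synth a =ᵐ[volume] fun x => (𝓕⁻ a : Freq) x |>.re :=
  Complex.reCLM.coeFn_compLp _

theorem inner_freq (a b : Freq) : ⟪a, b⟫_ℝ = ∫ ξ, (starRingEnd ℂ (a ξ) * b ξ).re := by
  rw [L2.inner_def]
  refine integral_congr_ae (Eventually.of_forall fun ξ => ?_)
  simp [Complex.inner, mul_comm]

theorem inner_L2 (v w : L2) : ⟪v, w⟫_ℝ = ∫ x, v x * w x := by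
  rw [L2.inner_def]
  refine integral_congr_ae (Eventually.of_forall fun x => ?_)
  simp [mul_comm]

theorem synth_analysis (w : L2) : synth (analysis w) = w := by
  rw [synth_apply, analysis_apply, FourierTransform.fourierInv_fourier_eq]
  refine Lp.ext ?_
  filter_upwards [Complex.reCLM.coeFn_compLp (Complex.ofRealCLM.compLp w),
    Complex.ofRealCLM.coeFn_compLp w] with x h1 h2
  rw [h1, h2]
  simp

theorem inner_freq_fourier (a b : Freq) : ⟪𝓕 a, 𝓕 b⟫_ℝ = ⟪a, b⟫_ℝ := by
  have h := Lp.inner_fourier_eq a b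
  rw [L2.inner_def, L2.inner_def] at h
  have h2 := congrArg Complex.re h
  rw [← Complex.reCLM_apply, ← Complex.reCLM_apply,
    ← Complex.reCLM.integral_comp_comm (L2.integrable_inner _ _),
    ← Complex.reCLM.integral_comp_comm (L2.integrable_inner _ _)] at h2
  rw [L2.inner_def, L2.inner_def]
  exact h2

theorem inner_synth (a : Freq) (w : L2) : ⟪synth a, w⟫_ℝ = ⟪a, analysis w⟫_ℝ := by
  rw [analysis_apply]
  have h := inner_freq_fourier (𝓕⁻ a) (Complex.ofRealCLM.compLp w)
  rw [FourierTransform.fourier_fourierInv_eq] at h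
  rw [h, inner_freq, inner_L2]
  refine integral_congr_ae ?_
  filter_upwards [coeFn_synth a, Complex.ofRealCLM.coeFn_compLp w] with x h1 h2
  rw [h1, h2]
  simp

theorem inner_analysis (a : Freq) (w : L2) : ⟪analysis w, a⟫_ℝ = ⟪w, synth a⟫_ℝ := by
  rw [real_inner_comm, ← inner_synth, real_inner_comm]

theorem norm_analysis (w : L2) : ‖analysis w‖ = ‖w‖ := by
  have h : ‖analysis w‖ ^ 2 = ‖w‖ ^ 2 := by
    rw [← real_inner_self_eq_norm_sq, inner_analysis, synth_analysis, real_inner_self_eq_norm_sq]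
  exact (sq_eq_sq₀ (norm_nonneg _) (norm_nonneg _)).1 h

theorem norm_synth_le (a : Freq) : ‖synth a‖ ≤ ‖a‖ := by
  have h : ‖synth a‖ ^ 2 ≤ ‖a‖ * ‖synth a‖ := by
    rw [← real_inner_self_eq_norm_sq, inner_synth, ← norm_analysis (synth a)]
    exact real_inner_le_norm _ _
  rcases (norm_nonneg (synth a)).eq_or_lt with h0 | h0
  · rw [← h0]; exact norm_nonneg _
  · exact le_of_mul_le_mul_right (by nlinarith) h0

/-! ### Frequency cut-off -/

/-- Multiplication by a bounded measurable function on `Lp 𝕜 2`. -/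
def mulL (𝕜 : Type*) [RCLike 𝕜] :
    Lp 𝕜 ∞ (volume : Measure ℝ) →L[ℝ] Lp 𝕜 2 (volume : Measure ℝ) →L[ℝ]
      Lp 𝕜 2 (volume : Measure ℝ) :=
  (ContinuousLinearMap.mul ℝ 𝕜).holderL volume ∞ 2 2

theorem coeFn_mulL {𝕜 : Type*} [RCLike 𝕜] (m : Lp 𝕜 ∞ (volume : Measure ℝ))
    (a : Lp 𝕜 2 (volume : Measure ℝ)) : mulL 𝕜 m a =ᵐ[volume] fun x => m x * a x :=
  ContinuousLinearMap.coeFn_holder _ _ _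

theorem norm_mulL_le {𝕜 : Type*} [RCLike 𝕜] (m : Lp 𝕜 ∞ (volume : Measure ℝ))
    (a : Lp 𝕜 2 (volume : Measure ℝ)) : ‖mulL 𝕜 m a‖ ≤ ‖m‖ * ‖a‖ := by
  refine ((ContinuousLinearMap.mul ℝ 𝕜).norm_holder_apply_apply_le (r := 2) m a).trans ?_
  gcongr
  exact mul_le_of_le_one_left (norm_nonneg _) (ContinuousLinearMap.opNorm_mul_le ℝ 𝕜)

/-- The indicator function of `[-n, n]`, complex valued. -/
def band (n : ℕ) : ℝ → ℂ := (Icc (-(n : ℝ)) n).indicator fun _ => 1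

theorem measurable_band (n : ℕ) : Measurable (band n) :=
  measurable_const.indicator measurableSet_Icc

theorem band_mul_self (n : ℕ) (ξ : ℝ) : band n ξ * band n ξ = band n ξ := by
  by_cases h : ξ ∈ Icc (-(n : ℝ)) n <;> simp [band, h]

theorem conj_band (n : ℕ) (ξ : ℝ) : starRingEnd ℂ (band n ξ) = band n ξ := by
  by_cases h : ξ ∈ Icc (-(n : ℝ)) n <;> simp [band, h]

theorem norm_band_le (n : ℕ) (ξ : ℝ) : ‖band n ξ‖ ≤ 1 := by
  by_cases h : ξ ∈ Icc (-(n : ℝ)) n <;> simp [band, h]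

theorem norm_mul_band_le (n : ℕ) (ξ : ℝ) : ‖(ξ : ℂ) * band n ξ‖ ≤ n := by
  by_cases h : ξ ∈ Icc (-(n : ℝ)) n
  · simpa [band, h] using abs_le.2 h
  · simp [band, h]

theorem memLp_band (n : ℕ) (p : ℝ≥0∞) : MemLp (band n) p volume :=
  memLp_indicator_const p measurableSet_Icc 1 (Or.inr (by simp))

/-- The symbol `2πiξ` of the derivative, cut off to `[-n, n]`. -/
def derivSymbol (n : ℕ) (ξ : ℝ) : ℂ := 2 * Real.pi * Complex.I * (ξ * band n ξ)

theorem memLp_derivSymbol (n : ℕ) : MemLp (derivSymbol n) ∞ volume := by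
  refine memLp_top_of_bound ?_ (2 * Real.pi * n) (Eventually.of_forall fun ξ => ?_)
  · exact (((Complex.measurable_ofReal.mul (measurable_band n))).const_mul _).aestronglyMeasurable
  · rw [derivSymbol, norm_mul]
    have := norm_mul_band_le n ξ
    have h2 : ‖(2 * Real.pi * Complex.I : ℂ)‖ = 2 * Real.pi := by
      simp [abs_of_pos Real.pi_pos]
    rw [h2]
    gcongr

/-- The spectral projection to the frequencies in `[-n, n]`. -/
def cutP (n : ℕ) : Freq →L[ℝ] Freq := mulL ℂ ((memLp_band n ∞).toLp)

/-- The derivative on the frequency side, cut off to `[-n, n]`. -/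
def cutD (n : ℕ) : Freq →L[ℝ] Freq := mulL ℂ ((memLp_derivSymbol n).toLp)

theorem coeFn_cutP (n : ℕ) (a : Freq) : cutP n a =ᵐ[volume] fun ξ => band n ξ * a ξ := by
  filter_upwards [coeFn_mulL ((memLp_band n ∞).toLp) a, (memLp_band n ∞).coeFn_toLp] with ξ h1 h2
  rw [cutP, h1, h2]

theorem coeFn_cutD (n : ℕ) (a : Freq) : cutD n a =ᵐ[volume] fun ξ => derivSymbol n ξ * a ξ := by
  filter_upwards [coeFn_mulL ((memLp_derivSymbol n).toLp) a,
    (memLp_derivSymbol n).coeFn_toLp] with ξ h1 h2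
  rw [cutD, h1, h2]

theorem cutD_skew (n : ℕ) (a b : Freq) : ⟪cutD n a, b⟫_ℝ = -⟪a, cutD n b⟫_ℝ := by
  rw [inner_freq, inner_freq, ← integral_neg]
  refine integral_congr_ae ?_
  filter_upwards [coeFn_cutD n a, coeFn_cutD n b] with ξ h1 h2
  rw [h1, h2, ← Complex.neg_re]
  congr 1
  simp only [derivSymbol, map_mul, conj_band, Complex.conj_I, Complex.conj_ofReal, map_ofNat]
  ring

theorem cutP_symm (n : ℕ) (a b : Freq) : ⟪cutP n a, b⟫_ℝ = ⟪a, cutP n b⟫_ℝ := by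
  rw [inner_freq, inner_freq]
  refine integral_congr_ae ?_
  filter_upwards [coeFn_cutP n a, coeFn_cutP n b] with ξ h1 h2
  rw [h1, h2]
  congr 1
  simp only [map_mul, conj_band]
  ring

theorem cutP_cutP (n : ℕ) (a : Freq) : cutP n (cutP n a) = cutP n a := by
  refine Lp.ext ?_
  filter_upwards [coeFn_cutP n a, coeFn_cutP n (cutP n a)] with ξ h1 h2
  rw [h2, h1, ← mul_assoc, band_mul_self]

theorem cutD_cutP (n : ℕ) (a : Freq) : cutD n (cutP n a) = cutD n a := by
  refine Lp.ext ?_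
  filter_upwards [coeFn_cutP n a, coeFn_cutD n (cutP n a), coeFn_cutD n a] with ξ h1 h2 h3
  rw [h2, h1, h3, derivSymbol, ← mul_assoc, mul_assoc _ _ (band n ξ), mul_assoc _ _ (band n ξ),
    band_mul_self]

theorem cutP_cutD (n : ℕ) (a : Freq) : cutP n (cutD n a) = cutD n a := by
  refine Lp.ext ?_
  filter_upwards [coeFn_cutD n a, coeFn_cutP n (cutD n a)] with ξ h1 h2
  rw [h2, h1, derivSymbol]
  linear_combination (2 * Real.pi * Complex.I * ξ * a ξ) * band_mul_self n ξ

theorem norm_cutP_le (n : ℕ) (a : Freq) : ‖cutP n a‖ ≤ ‖a‖ := by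
  refine Lp.norm_le_norm_of_ae_le ?_
  filter_upwards [coeFn_cutP n a] with ξ h
  rw [h, norm_mul]
  exact mul_le_of_le_one_left (norm_nonneg _) (norm_band_le n ξ)

theorem tendsto_cutP (a : Freq) : Tendsto (fun n => cutP n a) atTop (𝓝 a) := by
  have hint : Integrable (fun ξ => ‖a ξ‖ ^ 2) := (Lp.memLp a).integrable_norm_pow (by norm_num)
  have hre : ∀ (n : ℕ) ξ, (starRingEnd ℂ (a ξ) * (band n ξ * a ξ)).re =
      (band n ξ).re * ‖a ξ‖ ^ 2 := by
    intro n ξ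
    have h : starRingEnd ℂ (a ξ) * (band n ξ * a ξ) = band n ξ * ((‖a ξ‖ ^ 2 : ℝ) : ℂ) := by
      rw [mul_left_comm, Complex.conj_mul', Complex.ofReal_pow]
    rw [h, Complex.re_mul_ofReal]
  have hinner : ∀ n, ⟪a, cutP n a⟫_ℝ = ∫ ξ, (band n ξ).re * ‖a ξ‖ ^ 2 := by
    intro n
    rw [inner_freq]
    refine integral_congr_ae ?_
    filter_upwards [coeFn_cutP n a] with ξ h
    rw [h, hre]
  have hsq : ‖a‖ ^ 2 = ∫ ξ, ‖a ξ‖ ^ 2 := by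
    rw [← real_inner_self_eq_norm_sq, inner_freq]
    refine integral_congr_ae (Eventually.of_forall fun ξ => ?_)
    dsimp only
    rw [Complex.conj_mul', ← Complex.ofReal_pow, Complex.ofReal_re]
  have hlim : Tendsto (fun n => ⟪a, cutP n a⟫_ℝ) atTop (𝓝 (‖a‖ ^ 2)) := by
    simp_rw [hinner]
    rw [hsq]
    refine tendsto_integral_of_dominated_convergence _ (fun n => ?_) hint (fun n => ?_) ?_
    · exact (Complex.measurable_re.comp (measurable_band n)).aestronglyMeasurable.mul hint.1
    · refine Eventually.of_forall fun ξ => ?_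
      rw [norm_mul, norm_pow, norm_norm]
      exact mul_le_of_le_one_left (by positivity)
        ((Complex.abs_re_le_norm _).trans (norm_band_le n ξ))
    · refine Eventually.of_forall fun ξ => ?_
      obtain ⟨N, hN⟩ := exists_nat_ge |ξ|
      refine tendsto_const_nhds.congr' ?_
      filter_upwards [eventually_ge_atTop N] with n hn
      have : ξ ∈ Icc (-(n : ℝ)) n := abs_le.1 (hN.trans (by exact_mod_cast hn))
      simp [band, this]
  have hn : ∀ n, ‖cutP n a - a‖ = √(‖a‖ ^ 2 - ⟪a, cutP n a⟫_ℝ) := by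
    intro n
    rw [← Real.sqrt_sq (norm_nonneg (cutP n a - a)), norm_sub_sq_real,
      ← real_inner_self_eq_norm_sq (cutP n a), cutP_symm, cutP_cutP, cutP_symm]
    congr 1
    ring
  rw [tendsto_iff_norm_sub_tendsto_zero]
  simp_rw [hn]
  have := ((tendsto_const_nhds (x := ‖a‖ ^ 2)).sub hlim).sqrt
  simpa using this

/-- The oscillation `e^{-2πixξ}`. -/
def osc (x ξ : ℝ) : ℂ := Complex.exp (↑(-(2 * Real.pi * x * ξ)) * Complex.I)

theorem norm_osc (x ξ : ℝ) : ‖osc x ξ‖ = 1 := Complex.norm_exp_ofReal_mul_I _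

theorem measurable_osc (x : ℝ) : Measurable (osc x) := by
  unfold osc
  fun_prop

theorem memLp_band_mul_osc (n : ℕ) (x : ℝ) :
    MemLp (fun ξ => band n ξ * osc x ξ) 2 volume := by
  refine (memLp_band n 2).of_le
    ((measurable_band n).mul (measurable_osc x)).aestronglyMeasurable ?_
  refine Eventually.of_forall fun ξ => ?_
  rw [norm_mul, norm_osc, mul_one]

/-- The Fourier transform of the Dirac mass at `x`, cut off to the frequencies in `[-n, n]`. -/
def kernel (n : ℕ) (x : ℝ) : Freq := (memLp_band_mul_osc n x).toLp

theorem coeFn_kernel (n : ℕ) (x : ℝ) :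
    kernel n x =ᵐ[volume] fun ξ => band n ξ * osc x ξ := MemLp.coeFn_toLp _

theorem norm_taylor_osc (x y ξ : ℝ) (n : ℕ) (hξ : |ξ| ≤ n)
    (hxy : 2 * Real.pi * n * |y - x| ≤ 1) :
    ‖osc y ξ - osc x ξ + (y - x) * (2 * Real.pi * Complex.I * ξ * osc x ξ)‖ ≤
      (2 * Real.pi * n) ^ 2 * |y - x| ^ 2 := by
  set w : ℂ := ↑(-(2 * Real.pi * (y - x) * ξ)) * Complex.I with hw
  have hwn : ‖w‖ ≤ 2 * Real.pi * n * |y - x| := by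
    rw [hw, norm_mul, Complex.norm_I, mul_one, Complex.norm_real, Real.norm_eq_abs, abs_neg,
      abs_mul, abs_mul, abs_of_pos Real.two_pi_pos]
    nlinarith [mul_le_mul_of_nonneg_left hξ (mul_nonneg Real.two_pi_pos.le (abs_nonneg (y - x)))]
  have e : osc y ξ - osc x ξ + (y - x) * (2 * Real.pi * Complex.I * ξ * osc x ξ) =
      osc x ξ * (Complex.exp w - 1 - w) := by
    have : osc y ξ = osc x ξ * Complex.exp w := by
      rw [osc, osc, ← Complex.exp_add, hw]
      congr 1
      push_cast
      ring
    rw [this, hw]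
    push_cast
    ring
  rw [e, norm_mul, norm_osc, one_mul]
  refine (Complex.norm_exp_sub_one_sub_id_le (hwn.trans hxy)).trans ?_
  rw [← mul_pow]
  gcongr

theorem hasDerivAt_kernel (n : ℕ) (x : ℝ) :
    HasDerivAt (kernel n) (-(cutD n (kernel n x))) x := by
  have key : (fun y => kernel n y - kernel n x + (y - x) • cutD n (kernel n x)) =O[𝓝 x]
      fun y => ‖y - x‖ ^ 2 := by
    refine Asymptotics.IsBigO.of_bound ((2 * Real.pi * n) ^ 2 * ‖(memLp_band n 2).toLp‖) ?_
    have hev : ∀ᶠ y in 𝓝 x, 2 * Real.pi * n * |y - x| < 1 := by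
      have hc : ContinuousAt (fun y : ℝ => 2 * Real.pi * n * |y - x|) x := by fun_prop
      exact hc.eventually_lt continuousAt_const (by simp)
    filter_upwards [hev] with y hy
    rw [mul_assoc, mul_comm ‖(memLp_band n 2).toLp‖, ← mul_assoc]
    refine Lp.norm_le_mul_norm_of_ae_le_mul ?_
    filter_upwards [Lp.coeFn_add (kernel n y - kernel n x) ((y - x) • cutD n (kernel n x)),
      Lp.coeFn_sub (kernel n y) (kernel n x), Lp.coeFn_smul (y - x) (cutD n (kernel n x)),
      coeFn_cutD n (kernel n x), coeFn_kernel n x, coeFn_kernel n y,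
      (memLp_band n 2).coeFn_toLp] with ξ h1 h2 h3 h4 h5 h6 h7
    rw [h1, Pi.add_apply, h2, Pi.sub_apply, h3, Pi.smul_apply, h4, h5, h6, h7]
    by_cases hξ : ξ ∈ Icc (-(n : ℝ)) n
    · have hb : band n ξ = 1 := by simp [band, hξ]
      have := norm_taylor_osc x y ξ n (abs_le.2 hξ) hy.le
      rw [derivSymbol, hb]
      simp only [mul_one, one_mul, norm_one, Complex.real_smul, Real.norm_eq_abs, abs_pow, abs_abs]
      refine le_trans (le_of_eq ?_) this
      push_cast
      rfl
    · have hb : band n ξ = 0 := by simp [band, hξ]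
      simp [derivSymbol, hb]
  have h : HasFDerivAt (fun y => kernel n y - kernel n x + (y - x) • cutD n (kernel n x))
      (0 : ℝ →L[ℝ] Freq) x := key.hasFDerivAt (by norm_num)
  have h2 := (h.hasDerivAt.sub
    (((hasDerivAt_id x).sub_const x).smul_const (cutD n (kernel n x)))).add_const (kernel n x)
  refine (h2.congr_of_eventuallyEq (Eventually.of_forall fun y => ?_)).congr_deriv ?_
  · simp
  · simp

/-- The continuous representative of `synth (cutP n a)`. -/
def bandRep (n : ℕ) (a : Freq) (x : ℝ) : ℝ := ⟪a, kernel n x⟫_ℝ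

theorem coeFn_synth_cutP (n : ℕ) (a : Freq) :
    synth (cutP n a) =ᵐ[volume] bandRep n a := by
  have h2 : MemLp (fun ξ => band n ξ * a ξ) 2 volume :=
    (memLp_congr_ae (coeFn_cutP n a)).1 (Lp.memLp _)
  have h1 : Integrable (fun ξ => band n ξ * a ξ) := by
    have := (memLp_band n 2).integrable_mul (Lp.memLp a)
    exact this
  have e : cutP n a = h2.toLp := Lp.ext ((coeFn_cutP n a).trans h2.coeFn_toLp.symm)
  have h3 := coeFn_fourierInv_toLp h1 h2
  rw [← e] at h3
  filter_upwards [coeFn_synth (cutP n a), h3] with x hx hx3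
  rw [hx, hx3, bandRep, inner_freq, Real.fourierInv_eq', ← Complex.reCLM_apply,
    ← Complex.reCLM.integral_comp_comm]
  · refine integral_congr_ae ?_
    filter_upwards [coeFn_kernel n x] with ξ hξ
    rw [hξ, Complex.reCLM_apply, ← Complex.conj_re]
    congr 1
    simp only [smul_eq_mul, map_mul, conj_band, osc, ← Complex.exp_conj, Complex.conj_ofReal,
      Complex.conj_I]
    have : Complex.exp (↑(2 * Real.pi * ⟪ξ, x⟫_ℝ) * -Complex.I) =
        Complex.exp (↑(-(2 * Real.pi * x * ξ)) * Complex.I) := by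
      congr 1
      simp
      ring
    rw [this]
    ring
  · refine h1.mono ?_ (Eventually.of_forall fun ξ => ?_)
    · refine AEStronglyMeasurable.fun_smul ?_ h1.1
      fun_prop
    · rw [norm_smul, Complex.norm_exp_ofReal_mul_I, one_mul]

/-! ### Band-limited functions -/

theorem cutP_kernel (n : ℕ) (x : ℝ) : cutP n (kernel n x) = kernel n x := by
  refine Lp.ext ?_
  filter_upwards [coeFn_cutP n (kernel n x), coeFn_kernel n x] with ξ h1 h2
  rw [h1, h2, ← mul_assoc, band_mul_self]

theorem bandRep_cutP (n : ℕ) (a : Freq) : bandRep n (cutP n a) = bandRep n a := by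
  ext x
  rw [bandRep, cutP_symm, cutP_kernel, bandRep]

theorem hasDerivAt_bandRep (n : ℕ) (a : Freq) (x : ℝ) :
    HasDerivAt (bandRep n a) (bandRep n (cutD n a) x) x := by
  have h := (hasDerivAt_const x a).inner ℝ (hasDerivAt_kernel n x)
  refine h.congr_deriv ?_
  rw [inner_zero_left, add_zero, inner_neg_right, bandRep, cutD_skew]

theorem deriv_bandRep (n : ℕ) (a : Freq) : deriv (bandRep n a) = bandRep n (cutD n a) :=
  funext fun x => (hasDerivAt_bandRep n a x).deriv

theorem contDiff_bandRep (n : ℕ) (a : Freq) : ContDiff ℝ ∞ (bandRep n a) := by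
  rw [contDiff_infty]
  intro m
  induction m generalizing a with
  | zero =>
    exact contDiff_zero.2 (continuous_iff_continuousAt.2 fun x =>
      (hasDerivAt_bandRep n a x).continuousAt)
  | succ m ih =>
    rw [Nat.cast_succ, contDiff_succ_iff_deriv]
    refine ⟨fun x => (hasDerivAt_bandRep n a x).differentiableAt, by simp, ?_⟩
    rw [deriv_bandRep]
    exact ih _

theorem continuous_bandRep (n : ℕ) (a : Freq) : Continuous (bandRep n a) :=
  (contDiff_bandRep n a).continuous

theorem coeFn_synth_cutD (n : ℕ) (a : Freq) :
    synth (cutD n a) =ᵐ[volume] bandRep n (cutD n a) := by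
  rw [← cutP_cutD]
  exact (coeFn_synth_cutP n (cutD n a)).trans (by rw [cutP_cutD])

theorem memLp_bandRep (n : ℕ) (a : Freq) : MemLp (bandRep n a) 2 volume :=
  (memLp_congr_ae (coeFn_synth_cutP n a)).1 (Lp.memLp _)

theorem integral_abs_mul_le (v w : L2) : ∫ x, |v x * w x| ≤ ‖v‖ * ‖w‖ := by
  rw [← norm_abs_eq_norm v, ← norm_abs_eq_norm w]
  refine le_trans (le_of_eq ?_) (real_inner_le_norm |v| |w|)
  rw [inner_L2]
  refine integral_congr_ae ?_
  filter_upwards [Lp.coeFn_abs v, Lp.coeFn_abs w] with x h1 h2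
  rw [h1, h2, abs_mul]

theorem integrable_mul_L2 (v w : L2) : Integrable (fun x => v x * w x) :=
  (Lp.memLp v).integrable_mul (Lp.memLp w)

/-- The elementary bound `w(x)² ≤ 2 ‖w‖ ‖w'‖` for band-limited functions. -/
theorem bandRep_sq_le (n : ℕ) (a : Freq) (x : ℝ) :
    bandRep n a x ^ 2 ≤ 2 * ‖a‖ * ‖cutD n a‖ := by
  set y := bandRep n a
  set y' := bandRep n (cutD n a)
  have hd : ∀ z, HasDerivAt (fun z => y z ^ 2) (2 * (y z * y' z)) z := fun z => by
    refine ((hasDerivAt_bandRep n a z).pow 2).congr_deriv ?_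
    simp [y, y', mul_assoc]
  have hi2 : Integrable (fun z => y z ^ 2) := (memLp_bandRep n a).integrable_sq
  have hi' : Integrable (fun z => y z * y' z) :=
    (memLp_bandRep n a).integrable_mul (memLp_bandRep n (cutD n a))
  have h0 := tendsto_zero_of_hasDerivAt_of_integrableOn_Iic (a := x) (fun z _ => hd z)
    (hi'.const_mul 2).integrableOn hi2.integrableOn
  have h1 := integral_Iic_of_hasDerivAt_of_tendsto' (a := x) (fun z _ => hd z)
    (hi'.const_mul 2).integrableOn h0
  rw [sub_zero] at h1
  rw [← h1, integral_const_mul, mul_assoc]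
  gcongr
  calc ∫ z in Iic x, y z * y' z ≤ ∫ z in Iic x, |y z * y' z| :=
        integral_mono hi'.integrableOn hi'.abs.integrableOn fun z => le_abs_self _
    _ ≤ ∫ z, |y z * y' z| := setIntegral_le_integral hi'.abs
        (Eventually.of_forall fun z => abs_nonneg _)
    _ = ∫ z, |synth (cutP n a) z * synth (cutD n a) z| := by
        refine integral_congr_ae ?_
        filter_upwards [coeFn_synth_cutP n a, coeFn_synth_cutD n a] with z h1 h2
        rw [h1, h2]
    _ ≤ ‖synth (cutP n a)‖ * ‖synth (cutD n a)‖ := integral_abs_mul_le _ _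
    _ ≤ ‖a‖ * ‖cutD n a‖ := by
        gcongr
        · exact (norm_synth_le _).trans (norm_cutP_le _ _)
        · exact norm_synth_le _

/-! ### Weak derivatives -/

theorem isWeakDeriv_synth (n : ℕ) (a : Freq) :
    IsWeakDeriv (synth (cutP n a)) (synth (cutD n a)) := by
  intro φ hφ hc
  have e1 : ∫ x, synth (cutP n a) x * deriv φ x = ∫ x, bandRep n a x * deriv φ x := by
    refine integral_congr_ae ?_
    filter_upwards [coeFn_synth_cutP n a] with x hx
    rw [hx]
  have e2 : ∫ x, synth (cutD n a) x * φ x = ∫ x, bandRep n (cutD n a) x * φ x := by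
    refine integral_congr_ae ?_
    filter_upwards [coeFn_synth_cutD n a] with x hx
    rw [hx]
  have hφd : ∀ x, HasDerivAt φ (deriv φ x) x := fun x =>
    (hφ.differentiable (by simp) x).hasDerivAt
  have hφ' : Continuous (deriv φ) := hφ.continuous_deriv (by simp)
  rw [e1, e2]
  refine integral_mul_deriv_eq_deriv_mul_of_integrable (fun x _ => hasDerivAt_bandRep n a x)
    (fun x _ => hφd x) ?_ ?_ ?_
  · exact ((continuous_bandRep n a).mul hφ').integrable_of_hasCompactSupport hc.deriv.mul_left
  · exact ((continuous_bandRep n _).mul hφ.continuous).integrable_of_hasCompactSupport hc.mul_left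
  · exact ((continuous_bandRep n a).mul hφ.continuous).integrable_of_hasCompactSupport hc.mul_left

/-- There are smooth cut-off functions, equal to one on arbitrarily large intervals, with uniformly
bounded derivatives. -/
theorem exists_cutoff : ∃ (χ : ℕ → ℝ → ℝ) (C : ℝ), (∀ m, ContDiff ℝ ∞ (χ m)) ∧
    (∀ m, HasCompactSupport (χ m)) ∧ (∀ m x, |χ m x| ≤ 1) ∧ (∀ m x, |deriv (χ m) x| ≤ C) ∧
    ∀ x, ∀ᶠ m in atTop, χ m =ᶠ[𝓝 x] fun _ => 1 := by
  let b : ContDiffBump (0 : ℝ) := ⟨1, 2, one_pos, one_lt_two⟩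
  have hb : ContDiff ℝ ∞ b := b.contDiff
  obtain ⟨C, hC⟩ := (hb.continuous_deriv (by simp)).bounded_above_of_compact_support
    b.hasCompactSupport.deriv
  have hC0 : 0 ≤ C := (norm_nonneg _).trans (hC 0)
  have hpos : ∀ m : ℕ, (0 : ℝ) < (m + 1 : ℝ)⁻¹ := fun m => by positivity
  refine ⟨fun m x => b ((m + 1 : ℝ)⁻¹ * x), C, fun m => hb.comp (contDiff_const.mul contDiff_id),
    fun m => ?_, fun m x => ?_, fun m x => ?_, fun x => ?_⟩
  · exact b.hasCompactSupport.comp_homeomorph (Homeomorph.mulLeft₀ _ (hpos m).ne')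
  · rw [abs_of_nonneg b.nonneg]
    exact b.le_one
  · have hd : HasDerivAt (fun x => b ((m + 1 : ℝ)⁻¹ * x))
        (deriv b ((m + 1 : ℝ)⁻¹ * x) * ((m + 1 : ℝ)⁻¹ * 1)) x :=
      (hb.differentiable (by simp) _).hasDerivAt.comp x ((hasDerivAt_id x).const_mul _)
    rw [hd.deriv, abs_mul, mul_one, abs_of_pos (hpos m)]
    refine (mul_le_mul (hC _) (inv_le_one_of_one_le₀ (by simp)) (hpos m).le hC0).trans ?_
    rw [mul_one]
  · obtain ⟨N, hN⟩ := exists_nat_ge |x|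
    filter_upwards [eventually_ge_atTop N] with m hm
    have hlt : |x| < m + 1 := by
      have : (N : ℝ) ≤ m := by exact_mod_cast hm
      linarith
    filter_upwards [(isOpen_lt continuous_abs continuous_const).mem_nhds hlt] with y hy
    refine b.one_of_mem_closedBall ?_
    simp only [Metric.mem_closedBall, Real.dist_eq, sub_zero, abs_mul, abs_of_pos (hpos m)]
    rw [inv_mul_le_iff₀ (by positivity)]
    have : |y| < m + 1 := hy
    simpa [b] using this.le

/-- Weak derivatives may be tested with smooth `H¹` functions, compactly supported or not. -/
theorem IsWeakDeriv.integral_smooth {w w' : L2} (h : IsWeakDeriv w w') {y : ℝ → ℝ}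
    (hy : ContDiff ℝ ∞ y) (h0 : MemLp y 2 volume) (h1 : MemLp (deriv y) 2 volume) :
    ∫ x, w x * deriv y x = -∫ x, w' x * y x := by
  obtain ⟨χ, C, hχ, hc, hb, hb', hlim⟩ := exists_cutoff
  have hyd : ∀ x, HasDerivAt y (deriv y x) x := fun x =>
    (hy.differentiable (by simp) x).hasDerivAt
  have hχd : ∀ m x, HasDerivAt (χ m) (deriv (χ m) x) x := fun m x =>
    ((hχ m).differentiable (by simp) x).hasDerivAt
  have hyc' : Continuous (deriv y) := hy.continuous_deriv (by simp)
  have hχc' : ∀ m, Continuous (deriv (χ m)) := fun m => (hχ m).continuous_deriv (by simp)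
  have i0 : Integrable (fun x => w x * y x) := (Lp.memLp w).integrable_mul h0
  have i0' : Integrable (fun x => w' x * y x) := (Lp.memLp w').integrable_mul h0
  have i1 : Integrable (fun x => w x * deriv y x) := (Lp.memLp w).integrable_mul h1
  have hprod : ∀ m, deriv (fun x => χ m x * y x) =
      fun x => deriv (χ m) x * y x + χ m x * deriv y x := fun m =>
    funext fun x => ((hχd m x).mul (hyd x)).deriv
  have key : ∀ m, ∫ x, w x * (deriv (χ m) x * y x + χ m x * deriv y x) =
      -∫ x, w' x * (χ m x * y x) := by
    intro m
    have := h (fun x => χ m x * y x) ((hχ m).mul hy) (hc m).mul_right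
    rwa [hprod m] at this
  have l1 : Tendsto (fun m => ∫ x, w x * (deriv (χ m) x * y x + χ m x * deriv y x)) atTop
      (𝓝 (∫ x, w x * deriv y x)) := by
    refine tendsto_integral_of_dominated_convergence
      (fun x => C * |w x * y x| + |w x * deriv y x|) (fun m => ?_)
      ((i0.abs.const_mul C).add i1.abs) (fun m => Eventually.of_forall fun x => ?_)
      (Eventually.of_forall fun x => ?_)
    · exact (Lp.memLp w).1.mul (((hχc' m).mul hy.continuous).add
        ((hχ m).continuous.mul hyc')).aestronglyMeasurable
    · rw [mul_add, Real.norm_eq_abs]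
      refine (abs_add_le _ _).trans (add_le_add ?_ ?_)
      · rw [mul_left_comm, abs_mul]
        exact mul_le_mul_of_nonneg_right (hb' m x) (abs_nonneg _)
      · rw [mul_left_comm, abs_mul]
        exact mul_le_of_le_one_left (abs_nonneg _) (hb m x)
    · refine tendsto_const_nhds.congr' ?_
      filter_upwards [hlim x] with m hm
      rw [hm.deriv_eq, hm.eq_of_nhds]
      simp
  have l2 : Tendsto (fun m => ∫ x, w' x * (χ m x * y x)) atTop (𝓝 (∫ x, w' x * y x)) := by
    refine tendsto_integral_of_dominated_convergence (fun x => |w' x * y x|) (fun m => ?_)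
      i0'.abs (fun m => Eventually.of_forall fun x => ?_) (Eventually.of_forall fun x => ?_)
    · exact (Lp.memLp w').1.mul ((hχ m).continuous.mul hy.continuous).aestronglyMeasurable
    · rw [mul_left_comm, Real.norm_eq_abs, abs_mul]
      exact mul_le_of_le_one_left (abs_nonneg _) (hb m x)
    · refine tendsto_const_nhds.congr' ?_
      filter_upwards [hlim x] with m hm
      rw [hm.eq_of_nhds]
      simp
  refine tendsto_nhds_unique l1 ?_
  simp_rw [key]
  exact l2.neg

/-- On the frequency side a weak derivative is the multiplication by `2πiξ`. -/
theorem IsWeakDeriv.cutP_analysis {w w' : L2} (h : IsWeakDeriv w w') (n : ℕ) :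
    cutP n (analysis w') = cutD n (analysis w) := by
  refine ext_inner_right ℝ fun b => ?_
  rw [cutP_symm, cutD_skew, inner_analysis, inner_analysis, inner_L2, inner_L2]
  have := h.integral_smooth (contDiff_bandRep n b) (memLp_bandRep n b)
    (by rw [deriv_bandRep]; exact memLp_bandRep n _)
  rw [deriv_bandRep] at this
  have e1 : ∫ x, w x * bandRep n (cutD n b) x = ∫ x, w x * synth (cutD n b) x := by
    refine integral_congr_ae ?_
    filter_upwards [coeFn_synth_cutD n b] with x hx
    rw [hx]
  have e2 : ∫ x, w' x * bandRep n b x = ∫ x, w' x * synth (cutP n b) x := by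
    refine integral_congr_ae ?_
    filter_upwards [coeFn_synth_cutP n b] with x hx
    rw [hx]
  rw [e1, e2] at this
  rw [this, neg_neg]

theorem band_mul_band {n m : ℕ} (h : n ≤ m) (ξ : ℝ) : band m ξ * band n ξ = band n ξ := by
  by_cases hn : ξ ∈ Icc (-(n : ℝ)) n
  · have hnm : (n : ℝ) ≤ m := by exact_mod_cast h
    have hm : ξ ∈ Icc (-(m : ℝ)) m := ⟨by linarith [hn.1], by linarith [hn.2]⟩
    simp [band, hn, hm]
  · simp [band, hn]

theorem bandRep_cutP_of_le {n m : ℕ} (h : n ≤ m) (a : Freq) :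
    bandRep m (cutP n a) = bandRep n a := by
  ext x
  rw [bandRep, cutP_symm, bandRep]
  congr 1
  refine Lp.ext ?_
  filter_upwards [coeFn_cutP n (kernel m x), coeFn_kernel m x, coeFn_kernel n x] with ξ h1 h2 h3
  rw [h1, h2, h3, ← mul_assoc, mul_comm (band n ξ), band_mul_band h]

theorem cutD_cutP_of_le {n m : ℕ} (h : n ≤ m) (a : Freq) : cutD m (cutP n a) = cutD n a := by
  refine Lp.ext ?_
  filter_upwards [coeFn_cutP n a, coeFn_cutD m (cutP n a), coeFn_cutD n a] with ξ h1 h2 h3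
  rw [h2, h1, h3, derivSymbol, derivSymbol]
  linear_combination (2 * Real.pi * Complex.I * ξ * a ξ) * band_mul_band h ξ

theorem contRep_eq {g c : ℝ → ℝ} (hc : Continuous c) (h : g =ᵐ[volume] c) : contRep g = c := by
  have hs : Continuous (contRep g) ∧ g =ᵐ[volume] contRep g :=
    Classical.epsilon_spec (p := fun c : ℝ → ℝ => Continuous c ∧ g =ᵐ[volume] c) ⟨c, hc, h⟩
  exact (hs.1.ae_eq_iff_eq volume hc).1 (hs.2.symm.trans h)

/-- An `H¹` function has a continuous representative, the uniform limit of its frequency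
cut-offs. -/
theorem IsWeakDeriv.exists_rep {w w' : L2} (h : IsWeakDeriv w w') : ∃ c : ℝ → ℝ, Continuous c ∧
    w =ᵐ[volume] c ∧ (∀ x, Tendsto (fun n => bandRep n (analysis w) x) atTop (𝓝 (c x))) ∧
    ∀ x, c x ^ 2 ≤ 2 * ‖w‖ * ‖w'‖ := by
  set a := analysis w
  set a' := analysis w'
  set β : ℕ → ℝ := fun n => √(2 * ‖cutP n a - a‖ * (2 * ‖a'‖)) with hβ
  have hβ0 : Tendsto β atTop (𝓝 0) := by
    have h1 := tendsto_iff_norm_sub_tendsto_zero.1 (tendsto_cutP a)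
    have h2 := ((h1.const_mul 2).mul_const (2 * ‖a'‖)).sqrt
    rwa [mul_zero, zero_mul, Real.sqrt_zero] at h2
  have hdiff : ∀ n m, n ≤ m → ∀ x, |bandRep m a x - bandRep n a x| ≤ β n := by
    intro n m hnm x
    refine Real.abs_le_sqrt ?_
    have e : bandRep m a x - bandRep n a x = bandRep m (a - cutP n a) x := by
      rw [← bandRep_cutP_of_le hnm a, bandRep, bandRep, bandRep, inner_sub_left]
    rw [e]
    refine (bandRep_sq_le m _ x).trans ?_
    rw [norm_sub_rev a]
    gcongr
    rw [map_sub, cutD_cutP_of_le hnm, ← h.cutP_analysis, ← h.cutP_analysis]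
    refine (norm_sub_le _ _).trans ?_
    have := norm_cutP_le n a'
    have := norm_cutP_le m a'
    linarith
  have hcau : ∀ x, ∃ l, Tendsto (fun n => bandRep n a x) atTop (𝓝 l) := by
    intro x
    refine cauchySeq_tendsto_of_complete (cauchySeq_of_le_tendsto_0' β (fun n m hnm => ?_) hβ0)
    rw [dist_comm, Real.dist_eq]
    exact hdiff n m hnm x
  choose c hc using hcau
  have hunif : TendstoUniformly (fun n => bandRep n a) c atTop := by
    rw [Metric.tendstoUniformly_iff]
    intro ε hε
    filter_upwards [hβ0.eventually_lt_const hε] with n hn x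
    rw [Real.dist_eq]
    refine lt_of_le_of_lt ?_ hn
    refine le_of_tendsto (((hc x).sub_const _).abs) ?_
    filter_upwards [eventually_ge_atTop n] with m hm using hdiff n m hm x
  have hcont : Continuous c :=
    hunif.continuous (Frequently.of_forall fun n => continuous_bandRep n a)
  refine ⟨c, hcont, ?_, hc, fun x => ?_⟩
  · have hL2 : Tendsto (fun n => synth (cutP n a)) atTop (𝓝 w) := by
      have := (synth.continuous.tendsto a).comp (tendsto_cutP a)
      rwa [synth_analysis] at this
    obtain ⟨ns, hns, hae⟩ := (tendstoInMeasure_of_tendsto_Lp hL2).exists_seq_tendsto_ae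
    have hall : ∀ᵐ x, ∀ n, synth (cutP n a) x = bandRep n a x :=
      ae_all_iff.2 fun n => coeFn_synth_cutP n a
    filter_upwards [hae, hall] with x h1 h2
    refine tendsto_nhds_unique h1 ?_
    simp_rw [h2]
    exact (hc x).comp hns.tendsto_atTop
  · refine le_of_tendsto' ((hc x).pow 2) fun n => (bandRep_sq_le n a x).trans ?_
    rw [← h.cutP_analysis]
    have h1 := norm_cutP_le n a'
    rw [norm_analysis w'] at h1
    rw [norm_analysis w]
    gcongr

theorem IsWeakDeriv.continuous_contRep {w w' : L2} (h : IsWeakDeriv w w') :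
    Continuous (contRep w) := by
  obtain ⟨c, hc, hw, -⟩ := h.exists_rep
  rwa [contRep_eq hc hw]

theorem IsWeakDeriv.coeFn_eq_contRep {w w' : L2} (h : IsWeakDeriv w w') :
    w =ᵐ[volume] contRep w := by
  obtain ⟨c, hc, hw, -⟩ := h.exists_rep
  rwa [contRep_eq hc hw]

theorem IsWeakDeriv.tendsto_bandRep {w w' : L2} (h : IsWeakDeriv w w') (x : ℝ) :
    Tendsto (fun n => bandRep n (analysis w) x) atTop (𝓝 (contRep w x)) := by
  obtain ⟨c, hc, hw, h1, -⟩ := h.exists_rep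
  rw [contRep_eq hc hw]
  exact h1 x

theorem IsWeakDeriv.contRep_sq_le {w w' : L2} (h : IsWeakDeriv w w') (x : ℝ) :
    contRep w x ^ 2 ≤ 2 * ‖w‖ * ‖w'‖ := by
  obtain ⟨c, hc, hw, -, h2⟩ := h.exists_rep
  rw [contRep_eq hc hw]
  exact h2 x

theorem contRep_synth_cutP (n : ℕ) (a : Freq) : contRep (synth (cutP n a)) = bandRep n a :=
  contRep_eq (continuous_bandRep n a) (coeFn_synth_cutP n a)

theorem contRep_synth_cutD (n : ℕ) (a : Freq) :
    contRep (synth (cutD n a)) = bandRep n (cutD n a) :=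
  contRep_eq (continuous_bandRep n _) (coeFn_synth_cutD n a)

/-! ### The truncated cubic nonlinearity -/

/-- The function `s³ / 3`, frozen outside `[-K, K]`. -/
def truncCube (K : NNReal) (s : ℝ) : ℝ := max (-(K : ℝ)) (min s K) ^ 3 / 3

theorem truncCube_of_abs_le {K : NNReal} {s : ℝ} (h : |s| ≤ K) : truncCube K s = s ^ 3 / 3 := by
  rw [abs_le] at h
  rw [truncCube, min_eq_left h.2, max_eq_right h.1]

theorem truncCube_zero (K : NNReal) : truncCube K 0 = 0 := by
  rw [truncCube_of_abs_le (by simp)]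
  norm_num

theorem lipschitz_truncCube (K : NNReal) : LipschitzWith (K ^ 2) (truncCube K) := by
  have hclamp : LipschitzWith 1 fun s : ℝ => max (-(K : ℝ)) (min s K) :=
    (LipschitzWith.id.min_const _).const_max _
  refine LipschitzWith.of_dist_le_mul fun s t => ?_
  have h := hclamp.dist_le_mul s t
  rw [NNReal.coe_one, one_mul] at h
  have bd : ∀ r : ℝ, |max (-(K : ℝ)) (min r K)| ≤ K := fun r => by
    exact abs_le.2 ⟨le_max_left _ _, max_le (by simp) (min_le_right _ _)⟩
  have hs := bd s
  have ht := bd t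
  rw [Real.dist_eq] at h ⊢
  simp only [truncCube]
  generalize max (-(K : ℝ)) (min s K) = c at *
  generalize max (-(K : ℝ)) (min t K) = e at *
  have e1 : c ^ 3 / 3 - e ^ 3 / 3 = (c - e) * ((c ^ 2 + c * e + e ^ 2) / 3) := by ring
  rw [e1, abs_mul, mul_comm, NNReal.coe_pow]
  refine mul_le_mul ?_ h (abs_nonneg _) (by positivity)
  have h1 : c ^ 2 ≤ K ^ 2 := sq_le_sq' (by linarith [neg_abs_le c]) (le_of_abs_le hs)
  have h2 : e ^ 2 ≤ K ^ 2 := sq_le_sq' (by linarith [neg_abs_le e]) (le_of_abs_le ht)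
  rw [abs_le]
  constructor <;> nlinarith [sq_nonneg (c - e), sq_nonneg (c + e)]

theorem mul_truncCube_nonneg (K : NNReal) (s : ℝ) : 0 ≤ s * truncCube K s := by
  have hK := K.2
  rw [truncCube]
  rcases le_total 0 s with h | h
  · have : 0 ≤ max (-(K : ℝ)) (min s K) := le_max_of_le_right (le_min h hK)
    positivity
  · have h2 : max (-(K : ℝ)) (min s K) ≤ 0 :=
      max_le (neg_nonpos.2 hK) ((min_le_left _ _).trans h)
    have : max (-(K : ℝ)) (min s K) ^ 3 ≤ 0 := Odd.pow_nonpos (by decide) h2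
    nlinarith

theorem mul_truncCube_le (K : NNReal) (s : ℝ) : 0 ≤ s * (s ^ 3 / 3 - truncCube K s) := by
  have hK := K.2
  rw [truncCube]
  rcases le_total 0 s with h | h
  · have h1 : max (-(K : ℝ)) (min s K) ≤ s :=
      max_le ((neg_nonpos.2 hK).trans h) (min_le_left _ _)
    have : max (-(K : ℝ)) (min s K) ^ 3 ≤ s ^ 3 := (Odd.strictMono_pow (by decide)).monotone h1
    nlinarith
  · have h1 : s ≤ max (-(K : ℝ)) (min s K) := by
      rw [min_eq_left (show s ≤ (K : ℝ) from h.trans hK)]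
      exact le_max_right _ _
    have : s ^ 3 ≤ max (-(K : ℝ)) (min s K) ^ 3 := (Odd.strictMono_pow (by decide)).monotone h1
    nlinarith

theorem integral_nonneg_of_mul_nonneg {g : ℝ → ℝ} (h : ∀ s, 0 ≤ s * g s) (s : ℝ) :
    0 ≤ ∫ r in (0 : ℝ)..s, g r := by
  rcases le_total 0 s with hs | hs
  · refine intervalIntegral.integral_nonneg_of_ae_restrict hs ?_
    rw [Filter.EventuallyLE, ae_restrict_iff' measurableSet_Icc]
    have h0 : ∀ᵐ r : ℝ, r ≠ 0 := by simp [ae_iff]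
    filter_upwards [h0] with r hr0 hr
    exact nonneg_of_mul_nonneg_right (h r) (lt_of_le_of_ne hr.1 hr0.symm)
  · rw [intervalIntegral.integral_symm, ← intervalIntegral.integral_neg]
    refine intervalIntegral.integral_nonneg_of_ae_restrict hs ?_
    rw [Filter.EventuallyLE, ae_restrict_iff' measurableSet_Icc]
    have h0 : ∀ᵐ r : ℝ, r ≠ 0 := by simp [ae_iff]
    filter_upwards [h0] with r hr0 hr
    have : 0 ≤ (-r) * (-g r) := by simpa using h r
    exact nonneg_of_mul_nonneg_right this (neg_pos.2 (lt_of_le_of_ne hr.2 hr0))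

/-- The primitive of the truncated cube. -/
def truncPot (K : NNReal) (s : ℝ) : ℝ := ∫ r in (0 : ℝ)..s, truncCube K r

theorem continuous_truncCube (K : NNReal) : Continuous (truncCube K) :=
  (lipschitz_truncCube K).continuous

theorem hasDerivAt_truncPot (K : NNReal) (s : ℝ) :
    HasDerivAt (truncPot K) (truncCube K s) s :=
  ((continuous_truncCube K).integral_hasStrictDerivAt 0 s).hasDerivAt

theorem continuous_truncPot (K : NNReal) : Continuous (truncPot K) :=
  continuous_iff_continuousAt.2 fun s => (hasDerivAt_truncPot K s).continuousAt

theorem truncPot_nonneg (K : NNReal) (s : ℝ) : 0 ≤ truncPot K s :=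
  integral_nonneg_of_mul_nonneg (mul_truncCube_nonneg K) s

theorem truncPot_le (K : NNReal) (s : ℝ) : truncPot K s ≤ s ^ 4 / 12 := by
  have h := integral_nonneg_of_mul_nonneg (mul_truncCube_le K) s
  rw [intervalIntegral.integral_sub (Continuous.intervalIntegrable (by fun_prop) _ _)
    ((continuous_truncCube K).intervalIntegrable _ _), intervalIntegral.integral_div,
    integral_pow] at h
  rw [truncPot]
  norm_num at h
  linarith

theorem abs_truncPot_taylor_le (K : NNReal) (s h : ℝ) :
    |truncPot K (s + h) - truncPot K s - truncCube K s * h| ≤ K ^ 2 * h ^ 2 := by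
  have hi : ∀ a b, IntervalIntegrable (truncCube K) volume a b := fun a b =>
    (continuous_truncCube K).intervalIntegrable _ _
  have e : truncPot K (s + h) - truncPot K s - truncCube K s * h =
      ∫ r in s..s + h, (truncCube K r - truncCube K s) := by
    rw [intervalIntegral.integral_sub (hi _ _) (by simp), truncPot, truncPot,
      intervalIntegral.integral_interval_sub_left (hi _ _) (hi _ _)]
    simp
    ring
  rw [e]
  have := intervalIntegral.norm_integral_le_of_norm_le_const (a := s) (b := s + h)
    (C := K ^ 2 * |h|) (f := fun r => truncCube K r - truncCube K s) (fun r hr => ?_)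
  · rw [Real.norm_eq_abs] at this
    refine this.trans (le_of_eq ?_)
    rw [add_sub_cancel_left, mul_assoc, ← sq, sq_abs]
  · have hl := (lipschitz_truncCube K).dist_le_mul r s
    rw [Real.dist_eq, Real.dist_eq, NNReal.coe_pow] at hl
    refine hl.trans (mul_le_mul_of_nonneg_left ?_ (by positivity))
    rcases le_total 0 h with h0 | h0
    · rw [uIoc_of_le (by linarith)] at hr
      rw [abs_of_nonneg (by linarith [hr.1]), abs_of_nonneg h0]
      linarith [hr.2]
    · rw [uIoc_of_ge (by linarith)] at hr
      rw [abs_of_nonpos (by linarith [hr.2]), abs_of_nonpos h0]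
      linarith [hr.1]

theorem truncPot_le_sq (K : NNReal) (s : ℝ) : truncPot K s ≤ K ^ 2 * s ^ 2 := by
  have h := abs_truncPot_taylor_le K 0 s
  rw [truncCube_zero, zero_mul, sub_zero, zero_add] at h
  have h0 : truncPot K 0 = 0 := by simp [truncPot]
  rw [h0, sub_zero] at h
  exact (le_abs_self _).trans h

theorem integrable_truncPot (K : NNReal) {w : ℝ → ℝ} (hw : MemLp w 2 volume) :
    Integrable fun x => truncPot K (w x) := by
  refine (hw.integrable_sq.const_mul ((K : ℝ) ^ 2)).mono'
    ((continuous_truncPot K).comp_aestronglyMeasurable hw.1) (Eventually.of_forall fun x => ?_)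
  rw [Real.norm_of_nonneg (truncPot_nonneg K _)]
  exact truncPot_le_sq K _

/-- The superposition operator of the truncated cube on `L²`. -/
def truncCubeL (K : NNReal) (w : L2) : L2 := (lipschitz_truncCube K).compLp (truncCube_zero K) w

theorem coeFn_truncCubeL (K : NNReal) (w : L2) :
    truncCubeL K w =ᵐ[volume] fun x => truncCube K (w x) :=
  (lipschitz_truncCube K).coeFn_compLp (truncCube_zero K) w

theorem lipschitz_truncCubeL (K : NNReal) : LipschitzWith (K ^ 2) (truncCubeL K) :=
  (lipschitz_truncCube K).lipschitzWith_compLp (truncCube_zero K)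

/-- The potential energy of the truncated nonlinearity. -/
def truncPotL (K : NNReal) (w : L2) : ℝ := ∫ x, truncPot K (w x)

theorem norm_sq_L2 (w : L2) : ‖w‖ ^ 2 = ∫ x, w x ^ 2 := by
  rw [← real_inner_self_eq_norm_sq, inner_L2]
  simp_rw [sq]

theorem hasFDerivAt_truncPotL (K : NNReal) (w : L2) :
    HasFDerivAt (truncPotL K) (innerSL ℝ (truncCubeL K w)) w := by
  have key : ∀ h : L2, |truncPotL K (w + h) - truncPotL K w - ⟪truncCubeL K w, h⟫_ℝ| ≤
      K ^ 2 * ‖h‖ ^ 2 := by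
    intro h
    have i1 := integrable_truncPot K (Lp.memLp (w + h))
    have i2 := integrable_truncPot K (Lp.memLp w)
    have i3 := integrable_mul_L2 (truncCubeL K w) h
    have e : truncPotL K (w + h) - truncPotL K w - ⟪truncCubeL K w, h⟫_ℝ =
        ∫ x, ((truncPot K ((w + h) x) - truncPot K (w x)) - truncCubeL K w x * h x) := by
      have i12 : Integrable fun x => truncPot K ((w + h) x) - truncPot K (w x) := i1.sub i2
      rw [integral_sub i12 i3, integral_sub i1 i2, inner_L2]
      rfl
    rw [e, norm_sq_L2, ← integral_const_mul]
    refine abs_integral_le_integral_abs.trans ?_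
    refine integral_mono_ae ((i1.sub i2).sub i3).abs
      ((Lp.memLp h).integrable_sq.const_mul _) ?_
    filter_upwards [coeFn_truncCubeL K w, Lp.coeFn_add w h] with x h1 h2
    rw [h1, h2]
    exact abs_truncPot_taylor_le K (w x) (h x)
  rw [hasFDerivAt_iff_isLittleO_nhds_zero]
  have hO : (fun h : L2 => truncPotL K (w + h) - truncPotL K w - innerSL ℝ (truncCubeL K w) h)
      =O[𝓝 0] fun h => ‖h‖ ^ 2 := by
    refine Asymptotics.IsBigO.of_bound ((K : ℝ) ^ 2) (Eventually.of_forall fun h => ?_)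
    rw [Real.norm_eq_abs, innerSL_apply_apply, norm_pow, norm_norm]
    exact key h
  exact hO.trans_isLittleO (by simpa using Asymptotics.isLittleO_norm_pow_id (E' := L2) one_lt_two)

/-- The nonlinear force on the frequency side. -/
def cubicForce (K : NNReal) (n : ℕ) (a : Freq) : Freq :=
  -(cutD n (analysis (truncCubeL K (synth (cutD n a)))))

theorem inner_cubicForce (K : NNReal) (n : ℕ) (a b : Freq) :
    ⟪cubicForce K n a, b⟫_ℝ = ⟪truncCubeL K (synth (cutD n a)), synth (cutD n b)⟫_ℝ := by
  rw [cubicForce, inner_neg_left, cutD_skew, neg_neg, inner_analysis]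

/-- The potential of the nonlinear force on the frequency side. -/
def cubicPot (K : NNReal) (n : ℕ) (a : Freq) : ℝ := truncPotL K (synth (cutD n a))

theorem hasFDerivAt_cubicPot (K : NNReal) (n : ℕ) (a : Freq) :
    HasFDerivAt (cubicPot K n) (innerSL ℝ (cubicForce K n a)) a := by
  have h := (hasFDerivAt_truncPotL K (synth (cutD n a))).comp a
    ((synth.comp (cutD n)).hasFDerivAt (x := a))
  refine h.congr_fderiv ?_
  ext b
  simp [inner_cubicForce]

theorem lipschitz_cubicForce (K : NNReal) (n : ℕ) :
    LipschitzWith (‖cutD n‖₊ * (‖analysis‖₊ * (K ^ 2 * (‖synth‖₊ * ‖cutD n‖₊))))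
      (cubicForce K n) :=
  ((cutD n).lipschitz.comp (analysis.lipschitz.comp ((lipschitz_truncCubeL K).comp
    (synth.lipschitz.comp (cutD n).lipschitz)))).neg

/-- Translation invariance of the nonlinear potential. -/
theorem inner_cubicForce_cutD (K : NNReal) (n : ℕ) (a : Freq) :
    ⟪cubicForce K n a, cutD n a⟫_ℝ = 0 := by
  rw [inner_cubicForce, inner_L2]
  have e : ∫ x, truncCubeL K (synth (cutD n a)) x * synth (cutD n (cutD n a)) x =
      ∫ x, truncCube K (bandRep n (cutD n a) x) * bandRep n (cutD n (cutD n a)) x := by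
    refine integral_congr_ae ?_
    filter_upwards [coeFn_truncCubeL K (synth (cutD n a)), coeFn_synth_cutD n a,
      coeFn_synth_cutD n (cutD n a)] with x h1 h2 h3
    rw [h1, h2, h3]
  rw [e]
  refine integral_eq_zero_of_hasDerivAt_of_integrable
    (f := fun x => truncPot K (bandRep n (cutD n a) x)) (fun x => ?_) ?_ ?_
  · exact (hasDerivAt_truncPot K _).comp x (hasDerivAt_bandRep n (cutD n a) x)
  · refine (integrable_mul_L2 (truncCubeL K (synth (cutD n a)))
      (synth (cutD n (cutD n a)))).congr ?_
    filter_upwards [coeFn_truncCubeL K (synth (cutD n a)), coeFn_synth_cutD n a,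
      coeFn_synth_cutD n (cutD n a)] with x h1 h2 h3
    rw [h1, h2, h3]
  · exact integrable_truncPot K (memLp_bandRep n _)

/-! ### The Sobolev spaces -/

section Sobolev

variable {k : ℕ}

/-- The `j`-th weak derivative as a continuous linear map. -/
def dL (k : ℕ) (j : Fin (k + 1)) : sobolevH k →L[ℝ] L2 :=
  (PiLp.proj 2 (fun _ : Fin (k + 1) => L2) j).comp (sobolevH k).subtypeL

theorem norm_sq_sobolevH (w : sobolevH k) : ‖w‖ ^ 2 = ∑ j, ‖d w j‖ ^ 2 :=
  PiLp.norm_sq_eq_of_L2 _ (w : PiLp 2 fun _ : Fin (k + 1) => L2)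

theorem norm_d_le (w : sobolevH k) (j : Fin (k + 1)) : ‖d w j‖ ≤ ‖w‖ := by
  refine (sq_le_sq₀ (norm_nonneg _) (norm_nonneg _)).1 ?_
  rw [norm_sq_sobolevH]
  exact Finset.single_le_sum (f := fun j => ‖d w j‖ ^ 2) (fun _ _ => sq_nonneg _)
    (Finset.mem_univ j)

theorem integral_mul_eq_inner_toLp (f : L2) {φ : ℝ → ℝ} (hφ : MemLp φ 2 volume) :
    ∫ x, f x * φ x = ⟪f, hφ.toLp⟫_ℝ := by
  rw [inner_L2]
  refine integral_congr_ae ?_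
  filter_upwards [hφ.coeFn_toLp] with x hx
  rw [hx]

theorem isWeakDeriv_iff_inner {f g : L2} : IsWeakDeriv f g ↔
    ∀ (φ : ℝ → ℝ) (hφ : ContDiff ℝ ∞ φ) (hc : HasCompactSupport φ),
      ⟪f, ((hφ.continuous_deriv (by simp)).memLp_of_hasCompactSupport hc.deriv :
        MemLp (deriv φ) 2 volume).toLp⟫_ℝ =
      -⟪g, (hφ.continuous.memLp_of_hasCompactSupport hc : MemLp φ 2 volume).toLp⟫_ℝ := by
  refine forall_congr' fun φ => forall_congr' fun hφ => forall_congr' fun hc => ?_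
  rw [integral_mul_eq_inner_toLp f ((hφ.continuous_deriv (by simp)).memLp_of_hasCompactSupport
    hc.deriv), integral_mul_eq_inner_toLp g (hφ.continuous.memLp_of_hasCompactSupport hc)]

theorem isClosed_sobolevH (k : ℕ) :
    IsClosed (sobolevH k : Set (PiLp 2 fun _ : Fin (k + 1) => L2)) := by
  have e : (sobolevH k : Set (PiLp 2 fun _ : Fin (k + 1) => L2)) =
      {w | ∀ j : Fin k, IsWeakDeriv (w j.castSucc) (w j.succ)} := rfl
  rw [e]
  simp only [isWeakDeriv_iff_inner, Set.ofPred_forall]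
  refine isClosed_iInter fun j => isClosed_iInter fun φ => isClosed_iInter fun hφ =>
    isClosed_iInter fun hc => isClosed_eq ?_ ?_
  · exact (PiLp.continuous_apply 2 _ _).inner continuous_const
  · exact ((PiLp.continuous_apply 2 _ _).inner continuous_const).neg

instance instCompleteSpaceSobolevH (k : ℕ) : CompleteSpace (sobolevH k) :=
  (isClosed_sobolevH k).completeSpace_coe

theorem isWeakDeriv_d01 (w : H2) : IsWeakDeriv (d w 0) (d w 1) := w.2 0

theorem isWeakDeriv_d12 (w : H2) : IsWeakDeriv (d w 1) (d w 2) := w.2 1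

/-- The element of `H²` with given weak derivatives. -/
def mkH2 (w₀ w₁ w₂ : L2) (h₁ : IsWeakDeriv w₀ w₁) (h₂ : IsWeakDeriv w₁ w₂) : H2 :=
  ⟨WithLp.toLp 2 ![w₀, w₁, w₂], fun j => by
    fin_cases j
    · exact h₁
    · exact h₂⟩

theorem d_mkH2_zero {w₀ w₁ w₂ : L2} (h₁ : IsWeakDeriv w₀ w₁) (h₂ : IsWeakDeriv w₁ w₂) :
    d (mkH2 w₀ w₁ w₂ h₁ h₂) 0 = w₀ := rfl

theorem d_mkH2_one {w₀ w₁ w₂ : L2} (h₁ : IsWeakDeriv w₀ w₁) (h₂ : IsWeakDeriv w₁ w₂) :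
    d (mkH2 w₀ w₁ w₂ h₁ h₂) 1 = w₁ := rfl

theorem d_mkH2_two {w₀ w₁ w₂ : L2} (h₁ : IsWeakDeriv w₀ w₁) (h₂ : IsWeakDeriv w₁ w₂) :
    d (mkH2 w₀ w₁ w₂ h₁ h₂) 2 = w₂ := rfl

theorem IsWeakDeriv.unique {f g g' : L2} (h : IsWeakDeriv f g) (h' : IsWeakDeriv f g') :
    g = g' := by
  refine Lp.ext ?_
  refine ae_eq_of_integral_contDiff_smul_eq ((Lp.memLp g).locallyIntegrable one_le_two)
    ((Lp.memLp g').locallyIntegrable one_le_two) fun φ hφ hc => ?_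
  have h1 := h φ hφ hc
  have h2 := h' φ hφ hc
  simp only [smul_eq_mul, mul_comm (φ _)]
  linarith

theorem H2_ext {v w : H2} (h : d v 0 = d w 0) : v = w := by
  have h1 : d v 1 = d w 1 := (isWeakDeriv_d01 v).unique (h ▸ isWeakDeriv_d01 w)
  have h2 : d v 2 = d w 2 := (isWeakDeriv_d12 v).unique (h1 ▸ isWeakDeriv_d12 w)
  refine Subtype.ext (PiLp.ext fun j => ?_)
  fin_cases j
  · exact h
  · exact h1
  · exact h2

theorem norm_sq_H2 (w : H2) : ‖w‖ ^ 2 = ‖d w 0‖ ^ 2 + ‖d w 1‖ ^ 2 + ‖d w 2‖ ^ 2 := by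
  rw [norm_sq_sobolevH, Fin.sum_univ_three]

theorem IsWeakDeriv.abs_contRep_le {w w' : L2} (h : IsWeakDeriv w w') {C : ℝ} (h1 : ‖w‖ ≤ C)
    (h2 : ‖w'‖ ≤ C) (x : ℝ) : |contRep w x| ≤ 2 * C := by
  have hC : 0 ≤ C := (norm_nonneg _).trans h1
  refine abs_le_of_sq_le_sq ((h.contRep_sq_le x).trans ?_) (by positivity)
  have : ‖w‖ * ‖w'‖ ≤ C * C := mul_le_mul h1 h2 (norm_nonneg _) hC
  nlinarith

theorem isWeakDeriv_d (w : H2) (j : Fin 2) : IsWeakDeriv (d w j.castSucc) (d w j.succ) := w.2 j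

theorem IsWeakDeriv.contRep_add {v v' w w' : L2} (hv : IsWeakDeriv v v') (hw : IsWeakDeriv w w') :
    contRep (v + w : L2) = contRep v + contRep w := by
  refine contRep_eq (hv.continuous_contRep.add hw.continuous_contRep) ?_
  filter_upwards [Lp.coeFn_add v w, hv.coeFn_eq_contRep, hw.coeFn_eq_contRep] with x h1 h2 h3
  rw [h1, Pi.add_apply, Pi.add_apply, ← h2, ← h3]

theorem IsWeakDeriv.contRep_smul {v v' : L2} (c : ℝ) (hv : IsWeakDeriv v v') :
    contRep (c • v : L2) = c • contRep v := by
  refine contRep_eq (hv.continuous_contRep.const_smul c) ?_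
  filter_upwards [Lp.coeFn_smul c v, hv.coeFn_eq_contRep] with x h1 h2
  rw [h1, Pi.smul_apply, Pi.smul_apply, ← h2]

/-- The value at `x` of the continuous representative of the `j`-th derivative, `j < 2`, of an
`H²` function. -/
def traceL (j : Fin 2) (x : ℝ) : H2 →L[ℝ] ℝ :=
  LinearMap.mkContinuous
    { toFun := fun w => contRep (d w j.castSucc) x
      map_add' := fun v w => congrFun ((isWeakDeriv_d v j).contRep_add (isWeakDeriv_d w j)) x
      map_smul' := fun c w => congrFun ((isWeakDeriv_d w j).contRep_smul c) x } 2
    fun w => (isWeakDeriv_d w j).abs_contRep_le (norm_d_le _ _) (norm_d_le _ _) x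

theorem traceL_zero (w : H2) (x : ℝ) : traceL 0 x w = contRep (d w 0) x := rfl

theorem traceL_one (w : H2) (x : ℝ) : traceL 1 x w = contRep (d w 1) x := rfl

theorem abs_trace_le (w : H2) (j : Fin 2) (x : ℝ) : |contRep (d w j.castSucc) x| ≤ 2 * ‖w‖ :=
  (isWeakDeriv_d w j).abs_contRep_le (norm_d_le _ _) (norm_d_le _ _) x

theorem memLp_top_H2 (w : H2) : MemLp (d w 0) ∞ volume := by
  refine memLp_top_of_bound (Lp.memLp _).1 (2 * ‖w‖) ?_
  filter_upwards [(isWeakDeriv_d01 w).coeFn_eq_contRep] with x hx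
  rw [hx]
  exact abs_trace_le w 0 x

/-- The embedding of `H²` into `L^∞`. -/
def toLinf : H2 →L[ℝ] Lp ℝ ∞ (volume : Measure ℝ) :=
  LinearMap.mkContinuous
    { toFun := fun w => (memLp_top_H2 w).toLp
      map_add' := fun v w => by
        refine Lp.ext ?_
        filter_upwards [(memLp_top_H2 (v + w)).coeFn_toLp, (memLp_top_H2 v).coeFn_toLp,
          (memLp_top_H2 w).coeFn_toLp, Lp.coeFn_add (memLp_top_H2 v).toLp (memLp_top_H2 w).toLp,
          Lp.coeFn_add (d v 0) (d w 0)] with x h1 h2 h3 h4 h5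
        rw [h1, h4, Pi.add_apply, h2, h3]
        exact h5
      map_smul' := fun c w => by
        refine Lp.ext ?_
        filter_upwards [(memLp_top_H2 (c • w)).coeFn_toLp, (memLp_top_H2 w).coeFn_toLp,
          Lp.coeFn_smul c (memLp_top_H2 w).toLp, Lp.coeFn_smul c (d w 0)] with x h1 h2 h3 h4
        rw [h1, RingHom.id_apply, h3, Pi.smul_apply, h2]
        exact h4 } 2
    fun w => by
      change ‖(memLp_top_H2 w).toLp‖ ≤ 2 * ‖w‖
      rw [Lp.norm_toLp]
      refine ENNReal.toReal_le_of_le_ofReal (by positivity) ?_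
      rw [eLpNorm_exponent_top]
      refine eLpNormEssSup_le_of_ae_bound ?_
      filter_upwards [(isWeakDeriv_d01 w).coeFn_eq_contRep] with x hx
      rw [hx]
      exact abs_trace_le w 0 x

theorem coeFn_toLinf (w : H2) : toLinf w =ᵐ[volume] d w 0 := (memLp_top_H2 w).coeFn_toLp

/-- The band-limited function with spectrum `a`, as an element of `H²`. -/
def bandH2 (n : ℕ) (a : Freq) : H2 :=
  mkH2 (synth (cutP n a)) (synth (cutD n a)) (synth (cutD n (cutD n a))) (isWeakDeriv_synth n a)
    (by simpa only [cutP_cutD] using isWeakDeriv_synth n (cutD n a))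

theorem d_bandH2_zero (n : ℕ) (a : Freq) : d (bandH2 n a) 0 = synth (cutP n a) := rfl

theorem d_bandH2_one (n : ℕ) (a : Freq) : d (bandH2 n a) 1 = synth (cutD n a) := rfl

theorem d_bandH2_two (n : ℕ) (a : Freq) : d (bandH2 n a) 2 = synth (cutD n (cutD n a)) := rfl

end Sobolev

/-! ### Weak convergence -/

/-- Weak convergence of sequences in a normed space. -/
def WeakTendsto {E : Type*} [NormedAddCommGroup E] [NormedSpace ℝ E] (u : ℕ → E) (x : E) : Prop :=
  ∀ l : E →L[ℝ] ℝ, Tendsto (fun n => l (u n)) atTop (𝓝 (l x))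

section Weak

variable {E : Type*} [NormedAddCommGroup E] [InnerProductSpace ℝ E]

theorem weakTendsto_of_inner [CompleteSpace E] {u : ℕ → E} {x : E}
    (h : ∀ v, Tendsto (fun n => ⟪u n, v⟫_ℝ) atTop (𝓝 ⟪x, v⟫_ℝ)) : WeakTendsto u x := by
  intro l
  have := h ((InnerProductSpace.toDual ℝ E).symm l)
  simpa only [real_inner_comm ((InnerProductSpace.toDual ℝ E).symm l),
    InnerProductSpace.toDual_symm_apply] using this

theorem WeakTendsto.inner {u : ℕ → E} {x : E} (h : WeakTendsto u x) (v : E) :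
    Tendsto (fun n => ⟪u n, v⟫_ℝ) atTop (𝓝 ⟪x, v⟫_ℝ) := by
  simpa only [innerSL_apply_apply, real_inner_comm] using h (innerSL ℝ v)

theorem WeakTendsto.comp {u : ℕ → E} {x : E} (h : WeakTendsto u x) {φ : ℕ → ℕ}
    (hφ : StrictMono φ) : WeakTendsto (u ∘ φ) x := fun l => (h l).comp hφ.tendsto_atTop

theorem WeakTendsto.map {F : Type*} [NormedAddCommGroup F] [NormedSpace ℝ F] {u : ℕ → E} {x : E}
    (h : WeakTendsto u x) (A : E →L[ℝ] F) : WeakTendsto (fun n => A (u n)) (A x) :=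
  fun l => h (l.comp A)

theorem WeakTendsto.norm_le {u : ℕ → E} {x : E} (h : WeakTendsto u x) {C : ℝ}
    (hC : ∀ n, ‖u n‖ ≤ C) : ‖x‖ ≤ C := by
  have h1 : ⟪x, x⟫_ℝ ≤ C * ‖x‖ := le_of_tendsto' (h.inner x) fun n =>
    (real_inner_le_norm _ _).trans (mul_le_mul_of_nonneg_right (hC n) (norm_nonneg _))
  rw [real_inner_self_eq_norm_sq] at h1
  rcases (norm_nonneg x).eq_or_lt with h0 | h0
  · rw [← h0]; exact (norm_nonneg _).trans (hC 0)
  · exact le_of_mul_le_mul_right (by nlinarith) h0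

theorem WeakTendsto.unique {u : ℕ → E} {x y : E} (hx : WeakTendsto u x) (hy : WeakTendsto u y) :
    x = y :=
  ext_inner_right ℝ fun v => tendsto_nhds_unique (hx.inner v) (hy.inner v)

/-- A pairing of a weakly convergent bounded sequence with a strongly convergent one. -/
theorem WeakTendsto.inner_strong {u v : ℕ → E} {x y : E} (h : WeakTendsto u x) {C : ℝ}
    (hC : ∀ n, ‖u n‖ ≤ C) (hv : Tendsto v atTop (𝓝 y)) :
    Tendsto (fun n => ⟪u n, v n⟫_ℝ) atTop (𝓝 ⟪x, y⟫_ℝ) := by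
  have h0 : Tendsto (fun n => ⟪u n, v n - y⟫_ℝ) atTop (𝓝 0) := by
    have h1 := (tendsto_iff_norm_sub_tendsto_zero.1 hv).const_mul C
    rw [mul_zero] at h1
    refine squeeze_zero_norm (fun n => ?_) h1
    exact (abs_real_inner_le_norm _ _).trans (mul_le_mul_of_nonneg_right (hC n) (norm_nonneg _))
  have h2 := h0.add (h.inner y)
  simpa [inner_sub_right] using h2

/-- Bounded sequences in a separable Hilbert space have weakly convergent subsequences. -/
theorem exists_weakTendsto_subseq [CompleteSpace E] [TopologicalSpace.SeparableSpace E]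
    {u : ℕ → E} {C : ℝ} (hC : ∀ n, ‖u n‖ ≤ C) :
    ∃ (x : E) (φ : ℕ → ℕ), StrictMono φ ∧ WeakTendsto (u ∘ φ) x := by
  obtain ⟨l, -, φ, hφ, hl⟩ := WeakDual.isSeqCompact_closedBall ℝ E 0 C
    (x := fun n => StrongDual.toWeakDual (InnerProductSpace.toDual ℝ E (u n)))
    (fun n => by simpa using hC n)
  refine ⟨(InnerProductSpace.toDual ℝ E).symm (WeakDual.toStrongDual l), φ, hφ,
    weakTendsto_of_inner fun v => ?_⟩
  have := tendsto_iff_forall_eval_tendsto_topDualPairing.1 hl v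
  rw [InnerProductSpace.toDual_symm_apply]
  exact this

/-- A sequence that is bounded in `E` and converges weakly after an injective continuous linear map
converges weakly in `E`. -/
theorem exists_weakTendsto_of_injective [CompleteSpace E] [TopologicalSpace.SeparableSpace E]
    {F : Type*} [NormedAddCommGroup F] [InnerProductSpace ℝ F] {A : E →L[ℝ] F}
    (hA : Function.Injective A) {u : ℕ → E} {C : ℝ} (hC : ∀ n, ‖u n‖ ≤ C) {y : F}
    (hy : WeakTendsto (fun n => A (u n)) y) : ∃ x, A x = y ∧ WeakTendsto u x := by
  obtain ⟨x, φ, hφ, hx⟩ := exists_weakTendsto_subseq hC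
  have hxy : A x = y := (hx.map A).unique (hy.comp hφ)
  refine ⟨x, hxy, fun l => tendsto_of_subseq_tendsto fun ns hns => ?_⟩
  obtain ⟨ψ₀, hψ₀, hmono⟩ := strictMono_subseq_of_tendsto_atTop hns
  obtain ⟨x', ψ, hψ, hx'⟩ := exists_weakTendsto_subseq (u := u ∘ (ns ∘ ψ₀)) fun n => hC _
  have : x' = x := hA (((hx'.map A).unique (hy.comp (hmono.comp hψ))).trans hxy.symm)
  exact ⟨ψ₀ ∘ ψ, this ▸ hx' l⟩

end Weak

/-! ### The weak formulation of a moving-mass system -/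

namespace MovingMassSystem

variable {Y : Type*} [NormedAddCommGroup Y] [InnerProductSpace ℝ Y] {s : MovingMassSystem Y}

/-- The weak formulation of the system: the mass term is integrated by parts twice in time. -/
theorem IsSolution.weak_form {a z z' : ℝ → Y} (h : s.IsSolution a z z') (hT : 0 ≤ s.T)
    {b b' b'' : ℝ → Y} (hb : ∀ t, HasDerivAt b (b' t) t) (hb' : ∀ t, HasDerivAt b' (b'' t) t)
    (hb'' : Continuous b'') (hbT : b s.T = 0) (hbT' : b' s.T = 0) :
    (∫ t in (0 : ℝ)..s.T, ⟪z t, b' t⟫_ℝ)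
      - (∫ t in (0 : ℝ)..s.T, ⟪s.D (s.D (a t)), s.D (s.D (b t))⟫_ℝ)
      - (∫ t in (0 : ℝ)..s.T, ⟪s.N (a t), b t⟫_ℝ)
      - (∫ t in (0 : ℝ)..s.T, ⟪s.B t (a t), b t⟫_ℝ)
      - ⟪a 0, s.k (s.ζ 0)⟫_ℝ * ⟪b' 0, s.k (s.ζ 0)⟫_ℝ
      - (∫ t in (0 : ℝ)..s.T, ⟪a t, s.k (s.ζ t)⟫_ℝ * ⟪b'' t, s.k (s.ζ t)⟫_ℝ)
      - (∫ t in (0 : ℝ)..s.T, s.ζ' t * ⟪s.D (a t), s.k (s.ζ t)⟫_ℝ * ⟪b' t, s.k (s.ζ t)⟫_ℝ)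
      - (∫ t in (0 : ℝ)..s.T, s.ζ' t * ⟪a t, s.k (s.ζ t)⟫_ℝ * ⟪s.D (b' t), s.k (s.ζ t)⟫_ℝ)
      + (∫ t in (0 : ℝ)..s.T, ⟪s.F t, b t⟫_ℝ)
      + (∫ t in (0 : ℝ)..s.T, s.P t * ⟪b t, s.k (s.ζ t)⟫_ℝ)
      + ⟪z 0, b 0⟫_ℝ + ⟪z 0, s.k (s.ζ 0)⟫_ℝ * ⟪b 0, s.k (s.ζ 0)⟫_ℝ = 0 := by
  have ca : ContinuousOn a (Icc 0 s.T) :=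
    fun t ht => (h.hasDerivAt t ht).continuousAt.continuousWithinAt
  have cz : ContinuousOn z (Icc 0 s.T) :=
    fun t ht => (h.hasDerivAt_velocity t ht).continuousAt.continuousWithinAt
  have cb : Continuous b := continuous_iff_continuousAt.2 fun t => (hb t).continuousAt
  have cb' : Continuous b' := continuous_iff_continuousAt.2 fun t => (hb' t).continuousAt
  have ck := s.continuous_k_comp
  have cζ' : Continuous s.ζ' := continuous_iff_continuousAt.2 fun t =>
    (s.hasDerivAt_ζ' t).continuousAt
  have cN := s.lipschitz_N.continuous
  have cF := s.continuous_F
  have cP := s.continuous_P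
  have cB : ContinuousOn (fun t => s.B t (a t)) (Icc 0 s.T) :=
    s.continuous_B.continuousOn.clm_apply ca
  have ii : ∀ {g : ℝ → ℝ}, ContinuousOn g (Icc 0 s.T) → IntervalIntegrable g volume 0 s.T :=
    fun hg => hg.intervalIntegrable_of_Icc hT
  have cDDa : ContinuousOn (fun t => s.D (s.D (a t))) (Icc 0 s.T) := by fun_prop
  have cNa : ContinuousOn (fun t => s.N (a t)) (Icc 0 s.T) := cN.comp_continuousOn ca
  have i1 := ii (g := fun t => ⟪z t, b' t⟫_ℝ) (by fun_prop)
  have i2 := ii (g := fun t => ⟪s.D (s.D (a t)), s.D (s.D (b t))⟫_ℝ) (by fun_prop)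
  have i3 := ii (g := fun t => ⟪s.N (a t), b t⟫_ℝ) (by fun_prop)
  have i4 := ii (g := fun t => ⟪s.B t (a t), b t⟫_ℝ) (by fun_prop)
  have ctr : ∀ {g : ℝ → Y}, ContinuousOn g (Icc 0 s.T) →
      ContinuousOn (fun t => ⟪g t, s.k (s.ζ t)⟫_ℝ) (Icc 0 s.T) :=
    fun hg => hg.inner ck.continuousOn
  have cDa : ContinuousOn (fun t => s.D (a t)) (Icc 0 s.T) := by fun_prop
  have i5 := ii (g := fun t => ⟪a t, s.k (s.ζ t)⟫_ℝ * ⟪b'' t, s.k (s.ζ t)⟫_ℝ)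
    ((ctr ca).mul (ctr hb''.continuousOn))
  have i6 := ii (g := fun t => s.ζ' t * ⟪s.D (a t), s.k (s.ζ t)⟫_ℝ * ⟪b' t, s.k (s.ζ t)⟫_ℝ)
    ((cζ'.continuousOn.mul (ctr cDa)).mul (ctr cb'.continuousOn))
  have i7 := ii (g := fun t => s.ζ' t * ⟪a t, s.k (s.ζ t)⟫_ℝ * ⟪s.D (b' t), s.k (s.ζ t)⟫_ℝ)
    ((cζ'.continuousOn.mul (ctr ca)).mul
    (ctr (s.D.continuous.comp cb').continuousOn))
  have i8 := ii (g := fun t => ⟪s.F t, b t⟫_ℝ) (by fun_prop)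
  have i9 := ii (g := fun t => s.P t * ⟪b t, s.k (s.ζ t)⟫_ℝ)
    (cP.continuousOn.mul (ctr cb.continuousOn))
  have hd : ∀ t ∈ uIcc 0 s.T, HasDerivAt
      (fun r => ⟪s.mass r (z r), b r⟫_ℝ - ⟪a r, s.k (s.ζ r)⟫_ℝ * ⟪b' r, s.k (s.ζ r)⟫_ℝ)
      (⟪z t, b' t⟫_ℝ - ⟪s.D (s.D (a t)), s.D (s.D (b t))⟫_ℝ - ⟪s.N (a t), b t⟫_ℝ
        - ⟪s.B t (a t), b t⟫_ℝ - ⟪a t, s.k (s.ζ t)⟫_ℝ * ⟪b'' t, s.k (s.ζ t)⟫_ℝ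
        - s.ζ' t * ⟪s.D (a t), s.k (s.ζ t)⟫_ℝ * ⟪b' t, s.k (s.ζ t)⟫_ℝ
        - s.ζ' t * ⟪a t, s.k (s.ζ t)⟫_ℝ * ⟪s.D (b' t), s.k (s.ζ t)⟫_ℝ
        + ⟪s.F t, b t⟫_ℝ + s.P t * ⟪b t, s.k (s.ζ t)⟫_ℝ) t := by
    intro t ht
    rw [uIcc_of_le hT] at ht
    refine (((h.hasDerivAt_mass t ht).inner ℝ (hb t)).sub
      ((s.hasDerivAt_trace (h.hasDerivAt t ht)).mul (s.hasDerivAt_trace (hb' t)))).congr_deriv ?_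
    rw [inner_mass, inner_force]
    ring
  have hftc := intervalIntegral.integral_eq_sub_of_hasDerivAt hd
    (((((((((i1.sub i2).sub i3).sub i4).sub i5).sub i6).sub i7).add i8).add i9))
  rw [intervalIntegral.integral_add (((((((i1.sub i2).sub i3).sub i4).sub i5).sub i6).sub i7).add
      i8) i9,
    intervalIntegral.integral_add ((((((i1.sub i2).sub i3).sub i4).sub i5).sub i6).sub i7) i8,
    intervalIntegral.integral_sub (((((i1.sub i2).sub i3).sub i4).sub i5).sub i6) i7,
    intervalIntegral.integral_sub ((((i1.sub i2).sub i3).sub i4).sub i5) i6,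
    intervalIntegral.integral_sub (((i1.sub i2).sub i3).sub i4) i5,
    intervalIntegral.integral_sub ((i1.sub i2).sub i3) i4,
    intervalIntegral.integral_sub (i1.sub i2) i3,
    intervalIntegral.integral_sub i1 i2, hbT, hbT'] at hftc
  simp only [inner_mass, inner_zero_right, inner_zero_left, mul_zero, sub_zero] at hftc
  linarith

end MovingMassSystem

/-! ### The frequency-truncated beam -/

/-- The data of the moving-mass beam, extended to all times. -/
structure BeamData where
  /-- the length of the time interval -/
  T : ℝ
  hT : 0 < T
  /-- the coefficient of the axial load -/
  ν : ℝ
  /-- the trajectory of the mass -/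
  ζ : ℝ → ℝ
  /-- the velocity of the trajectory -/
  ζ' : ℝ → ℝ
  /-- the acceleration of the trajectory -/
  ζ'' : ℝ → ℝ
  /-- the force at the position of the mass -/
  P : ℝ → ℝ
  /-- the distributed force -/
  f : ℝ → H2
  /-- the axial load -/
  p : ℝ → H2
  hasDerivAt_ζ : ∀ t, HasDerivAt ζ (ζ' t) t
  hasDerivAt_ζ' : ∀ t, HasDerivAt ζ' (ζ'' t) t
  continuous_P : Continuous P
  continuous_f : Continuous f
  continuous_p : Continuous p
  /-- a common bound for the data -/
  Z : ℝ
  one_le_Z : 1 ≤ Z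
  ζ'_le : ∀ t ∈ Icc 0 T, |ζ' t| ≤ Z
  ζ''_le : ∀ t ∈ Icc 0 T, |ζ'' t| ≤ Z
  p_le : ∀ t, |ν| * ‖toLinf (p t)‖ ≤ Z
  f_le : ∀ t, ‖f t‖ ≤ Z
  P_le : ∀ t, |P t| ≤ Z

namespace BeamData

variable (D : BeamData)

/-- The product of the axial load `p(t)` with an `L²` function. -/
def loadMul (t : ℝ) : L2 →L[ℝ] L2 := mulL ℝ (toLinf (D.p t))

theorem coeFn_loadMul (t : ℝ) (w : L2) :
    D.loadMul t w =ᵐ[volume] fun x => d (D.p t) 0 x * w x := by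
  filter_upwards [coeFn_mulL (toLinf (D.p t)) w, coeFn_toLinf (D.p t)] with x h1 h2
  rw [loadMul, h1, h2]

theorem continuous_loadMul : Continuous D.loadMul :=
  (mulL ℝ).continuous.comp (toLinf.continuous.comp D.continuous_p)

theorem norm_loadMul_le (t : ℝ) (w : L2) : |D.ν| * ‖D.loadMul t w‖ ≤ D.Z * ‖w‖ := by
  have h1 := norm_mulL_le (toLinf (D.p t)) w
  calc |D.ν| * ‖D.loadMul t w‖ ≤ |D.ν| * (‖toLinf (D.p t)‖ * ‖w‖) := by gcongr; exact h1
    _ = |D.ν| * ‖toLinf (D.p t)‖ * ‖w‖ := by ring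
    _ ≤ D.Z * ‖w‖ := by gcongr; exact D.p_le t

/-- The beam with frequencies cut off to `[-n, n]` and the nonlinearity truncated at height `K`. -/
def system (K : NNReal) (n : ℕ) : MovingMassSystem Freq where
  D := cutD n
  k := kernel n
  skew := cutD_skew n
  hasDerivAt_k := hasDerivAt_kernel n
  trace_sq_le := bandRep_sq_le n
  N := cubicForce K n
  L := _
  lipschitz_N := lipschitz_cubicForce K n
  Ψ := cubicPot K n
  Ψ_nonneg a := integral_nonneg fun x => truncPot_nonneg K _
  hasFDerivAt_Ψ := hasFDerivAt_cubicPot K n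
  inner_N_D := inner_cubicForce_cutD K n
  ζ := D.ζ
  ζ' := D.ζ'
  ζ'' := D.ζ''
  hasDerivAt_ζ := D.hasDerivAt_ζ
  hasDerivAt_ζ' := D.hasDerivAt_ζ'
  B t := analysis.comp ((D.ν • D.loadMul t).comp (synth.comp ((cutD n).comp (cutD n))))
  continuous_B := by
    have := D.continuous_loadMul
    exact continuous_const.clm_comp ((this.const_smul D.ν).clm_comp continuous_const)
  F t := analysis (d (D.f t) 0)
  continuous_F := analysis.continuous.comp ((dL 2 0).continuous.comp D.continuous_f)
  P := D.P
  continuous_P := D.continuous_P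
  T := D.T
  Z := D.Z
  one_le_Z := D.one_le_Z
  ζ'_le := D.ζ'_le
  ζ''_le := D.ζ''_le
  B_le t a := by
    have hZ : 0 ≤ D.Z := zero_le_one.trans D.one_le_Z
    have h1 := D.norm_loadMul_le t (synth (cutD n (cutD n a)))
    change ‖analysis (D.ν • D.loadMul t (synth (cutD n (cutD n a))))‖ ≤ _
    rw [norm_analysis, norm_smul, Real.norm_eq_abs]
    exact h1.trans (mul_le_mul_of_nonneg_left (norm_synth_le _) hZ)
  F_le t := by
    rw [norm_analysis]
    exact (norm_d_le _ _).trans (D.f_le t)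
  P_le := D.P_le

/-- The uniform bound for the frequency-truncated solutions with initial data of size `R`. -/
def bound (R : ℝ) : ℝ :=
  √(4 * ((2 * R ^ 2 + 1 / 6 * R ^ 4 + 3 * D.Z * R ^ 2 + 163 * D.Z ^ 8 * R ^ 2 + 1) *
    Real.exp (800 * D.Z ^ 8 * D.T)))

theorem cubicPot_le (K : NNReal) (n : ℕ) {a : Freq} {R : ℝ} (h1 : ‖cutD n a‖ ≤ R)
    (h2 : ‖cutD n (cutD n a)‖ ≤ R) : cubicPot K n a ≤ 1 / 6 * R ^ 4 := by
  have hR : 0 ≤ R := (norm_nonneg _).trans h1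
  have e : cubicPot K n a = ∫ x, truncPot K (bandRep n (cutD n a) x) := by
    refine integral_congr_ae ?_
    filter_upwards [coeFn_synth_cutD n a] with x hx
    rw [hx]
  have hint := (memLp_bandRep n (cutD n a)).integrable_sq
  have hsq : ∫ x, bandRep n (cutD n a) x ^ 2 = ‖synth (cutD n a)‖ ^ 2 := by
    rw [norm_sq_L2]
    refine integral_congr_ae ?_
    filter_upwards [coeFn_synth_cutD n a] with x hx
    rw [hx]
  calc cubicPot K n a = ∫ x, truncPot K (bandRep n (cutD n a) x) := e
    _ ≤ ∫ x, 1 / 6 * R ^ 2 * bandRep n (cutD n a) x ^ 2 := by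
        refine integral_mono (integrable_truncPot K (memLp_bandRep n _)) (hint.const_mul _)
          fun x => (truncPot_le K _).trans ?_
        have hb := bandRep_sq_le n (cutD n a) x
        have hb2 : ‖cutD n a‖ * ‖cutD n (cutD n a)‖ ≤ R * R :=
          mul_le_mul h1 h2 (norm_nonneg _) hR
        nlinarith [sq_nonneg (bandRep n (cutD n a) x)]
    _ = 1 / 6 * R ^ 2 * ‖synth (cutD n a)‖ ^ 2 := by rw [integral_const_mul, hsq]
    _ ≤ 1 / 6 * R ^ 2 * R ^ 2 := by
        gcongr
        exact (norm_synth_le _).trans h1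
    _ = 1 / 6 * R ^ 4 := by ring

theorem energy_initial_le (K : NNReal) (n : ℕ) {a z : Freq} {R : ℝ} (h0 : ‖a‖ ≤ R)
    (h1 : ‖cutD n a‖ ≤ R) (h2 : ‖cutD n (cutD n a)‖ ≤ R) (hz : ‖z‖ ≤ R) (hz1 : ‖cutD n z‖ ≤ R) :
    (D.system K n).energy 0 a z ≤
      2 * R ^ 2 + 1 / 6 * R ^ 4 + 3 * D.Z * R ^ 2 + 163 * D.Z ^ 8 * R ^ 2 := by
  have hR : 0 ≤ R := (norm_nonneg _).trans h1
  have hΨ := cubicPot_le K n h1 h2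
  have hl : bandRep n z (D.ζ 0) ^ 2 ≤ 2 * R ^ 2 := by
    have hb2 : ‖z‖ * ‖cutD n z‖ ≤ R * R := mul_le_mul hz hz1 (norm_nonneg _) hR
    nlinarith [bandRep_sq_le n z (D.ζ 0)]
  have hμ : bandRep n (cutD n a) (D.ζ 0) ^ 2 ≤ 2 * R ^ 2 := by
    have hb2 : ‖cutD n a‖ * ‖cutD n (cutD n a)‖ ≤ R * R := mul_le_mul h1 h2 (norm_nonneg _) hR
    nlinarith [bandRep_sq_le n (cutD n a) (D.ζ 0)]
  have hζ := D.ζ'_le 0 (left_mem_Icc.2 D.hT.le)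
  rw [MovingMassSystem.energy, MovingMassSystem.inner_mass]
  change 1 / 2 * ‖z‖ ^ 2 + 1 / 2 * bandRep n z (D.ζ 0) ^ 2 + 1 / 2 * ‖cutD n (cutD n a)‖ ^ 2
    + cubicPot K n a + D.ζ' 0 * (⟪z, cutD n a⟫_ℝ + bandRep n z (D.ζ 0) *
    bandRep n (cutD n a) (D.ζ 0)) + 163 * D.Z ^ 8 * ‖a‖ ^ 2 ≤ _
  have e1 : ‖z‖ ^ 2 ≤ R ^ 2 := by gcongr
  have e2 : ‖cutD n (cutD n a)‖ ^ 2 ≤ R ^ 2 := by gcongr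
  have e3 : D.Z ^ 8 * ‖a‖ ^ 2 ≤ D.Z ^ 8 * R ^ 2 := by
    have := D.one_le_Z
    gcongr
  have e4 : |⟪z, cutD n a⟫_ℝ + bandRep n z (D.ζ 0) * bandRep n (cutD n a) (D.ζ 0)| ≤
      3 * R ^ 2 := by
    refine (abs_add_le _ _).trans ?_
    have f1 : |⟪z, cutD n a⟫_ℝ| ≤ R * R :=
      (abs_real_inner_le_norm _ _).trans (mul_le_mul hz h1 (norm_nonneg _) hR)
    have f2 : |bandRep n z (D.ζ 0) * bandRep n (cutD n a) (D.ζ 0)| ≤ 2 * R ^ 2 := by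
      rw [abs_le]
      constructor <;>
        linarith [sq_nonneg (bandRep n z (D.ζ 0) - bandRep n (cutD n a) (D.ζ 0)),
          sq_nonneg (bandRep n z (D.ζ 0) + bandRep n (cutD n a) (D.ζ 0))]
    linarith
  have e5 : D.ζ' 0 * (⟪z, cutD n a⟫_ℝ + bandRep n z (D.ζ 0) * bandRep n (cutD n a) (D.ζ 0)) ≤
      D.Z * (3 * R ^ 2) := (le_abs_self _).trans ((abs_mul _ _).trans_le
        (mul_le_mul hζ e4 (abs_nonneg _) ((abs_nonneg _).trans hζ)))
  linarith

/-- The frequency-truncated solutions are bounded uniformly in the frequency cut-off and in the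
truncation of the nonlinearity. -/
theorem solution_bounds {K : NNReal} {n : ℕ} {a z z' : ℝ → Freq}
    (h : (D.system K n).IsSolution a z z') {R : ℝ} (h0 : ‖a 0‖ ≤ R)
    (h1 : ‖cutD n (a 0)‖ ≤ R) (h2 : ‖cutD n (cutD n (a 0))‖ ≤ R) (hz : ‖z 0‖ ≤ R)
    (hz1 : ‖cutD n (z 0)‖ ≤ R) {t : ℝ} (ht : t ∈ Icc 0 D.T) :
    ‖a t‖ ≤ D.bound R ∧ ‖cutD n (a t)‖ ≤ D.bound R ∧ ‖cutD n (cutD n (a t))‖ ≤ D.bound R ∧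
      ‖z t‖ ≤ D.bound R := by
  have hE := h.energy_le ht
  have hE0 := D.energy_initial_le K n h0 h1 h2 hz hz1
  have hlow := (D.system K n).energy_lower ht (a t) (z t)
  have hΨ := (D.system K n).Ψ_nonneg (a t)
  have hA := (D.system K n).norm_D_sq_le (a t)
  change _ ≤ _ * Real.exp (800 * D.Z ^ 8 * D.T) at hE
  change ‖cutD n (a t)‖ ^ 2 ≤ ‖a t‖ * ‖cutD n (cutD n (a t))‖ at hA
  change 1 / 4 * (‖z t‖ ^ 2 + _ + ‖cutD n (cutD n (a t))‖ ^ 2) + _ + _ ≤ _ at hlow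
  have hexp := Real.exp_pos (800 * D.Z ^ 8 * D.T)
  have hEn : (D.system K n).energy t (a t) (z t) ≤
      (2 * R ^ 2 + 1 / 6 * R ^ 4 + 3 * D.Z * R ^ 2 + 163 * D.Z ^ 8 * R ^ 2 + 1) *
        Real.exp (800 * D.Z ^ 8 * D.T) := by
    refine le_trans (by linarith) (hE.trans ?_)
    gcongr
  have key : ∀ x : ℝ, x ^ 2 ≤ 4 * (D.system K n).energy t (a t) (z t) → x ≤ D.bound R :=
    fun x hx => Real.le_sqrt_of_sq_le (hx.trans (by linarith))
  have n1 := sq_nonneg ‖z t‖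
  have n2 := sq_nonneg ‖a t‖
  have n3 := sq_nonneg ‖cutD n (cutD n (a t))‖
  have n4 := sq_nonneg ⟪z t, (D.system K n).k ((D.system K n).ζ t)⟫_ℝ
  refine ⟨key _ ?_, key _ ?_, key _ ?_, key _ ?_⟩
  · linarith
  · nlinarith [sq_nonneg (‖a t‖ - ‖cutD n (cutD n (a t))‖)]
  · linarith
  · linarith

end BeamData

/-! ### Low-pass filters on physical space -/

/-- The projection of `L²(ℝ)` onto the functions with frequencies in `[-n, n]`. -/
def lowPass (n : ℕ) : L2 →L[ℝ] L2 := synth.comp ((cutP n).comp analysis)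

theorem lowPass_apply (n : ℕ) (w : L2) : lowPass n w = synth (cutP n (analysis w)) := rfl

theorem norm_lowPass_le (n : ℕ) (w : L2) : ‖lowPass n w‖ ≤ ‖w‖ :=
  (norm_synth_le _).trans ((norm_cutP_le n _).trans (norm_analysis w).le)

theorem tendsto_lowPass (w : L2) : Tendsto (fun n => lowPass n w) atTop (𝓝 w) := by
  have h := (synth.continuous.tendsto _).comp (tendsto_cutP (analysis w))
  rwa [synth_analysis] at h

theorem inner_synth_cutP (n : ℕ) (a : Freq) (w : L2) :
    ⟪synth (cutP n a), w⟫_ℝ = ⟪a, cutP n (analysis w)⟫_ℝ := by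
  rw [inner_synth, cutP_symm]

theorem IsWeakDeriv.abs_bandRep_le {w w' : L2} (h : IsWeakDeriv w w') {C : ℝ} (h1 : ‖w‖ ≤ C)
    (h2 : ‖w'‖ ≤ C) (n : ℕ) (x : ℝ) : |bandRep n (analysis w) x| ≤ 2 * C := by
  have hC : 0 ≤ C := (norm_nonneg _).trans h1
  refine abs_le_of_sq_le_sq ((bandRep_sq_le n _ x).trans ?_) (by positivity)
  rw [norm_analysis, ← h.cutP_analysis]
  have h3 : ‖cutP n (analysis w')‖ ≤ C :=
    (norm_cutP_le n _).trans ((norm_analysis w').le.trans h2)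
  have : ‖w‖ * ‖cutP n (analysis w')‖ ≤ C * C := mul_le_mul h1 h3 (norm_nonneg _) hC
  nlinarith

theorem cutD_analysis_d01 (n : ℕ) (w : H2) :
    cutD n (analysis (d w 0)) = cutP n (analysis (d w 1)) :=
  ((isWeakDeriv_d01 w).cutP_analysis n).symm

theorem cutD_cutD_analysis (n : ℕ) (w : H2) :
    cutD n (cutD n (analysis (d w 0))) = cutP n (analysis (d w 2)) := by
  rw [cutD_analysis_d01, cutD_cutP, (isWeakDeriv_d12 w).cutP_analysis]

theorem tendsto_H2 {ι : Type*} {l : Filter ι} {w : ι → H2} {x : H2}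
    (h : ∀ j, Tendsto (fun i => d (w i) j) l (𝓝 (d x j))) : Tendsto w l (𝓝 x) := by
  rw [tendsto_iff_norm_sub_tendsto_zero]
  have h1 : Tendsto (fun i => ‖w i - x‖ ^ 2) l (𝓝 0) := by
    have h2 : ∀ j, Tendsto (fun i => ‖d (w i) j - d x j‖ ^ 2) l (𝓝 0) := fun j => by
      simpa using (tendsto_iff_norm_sub_tendsto_zero.1 (h j)).pow 2
    have h3 := ((h2 0).add (h2 1)).add (h2 2)
    simp only [add_zero] at h3
    refine h3.congr fun i => ?_
    rw [norm_sq_H2]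
    rfl
  simpa using h1.sqrt

theorem continuous_bandH2 (n : ℕ) : Continuous (bandH2 n) := by
  refine continuous_iff_continuousAt.2 fun a => tendsto_H2 fun j => ?_
  fin_cases j
  · exact (synth.comp (cutP n)).continuous.tendsto a
  · exact (synth.comp (cutD n)).continuous.tendsto a
  · exact (synth.comp ((cutD n).comp (cutD n))).continuous.tendsto a

theorem tendsto_bandH2_analysis (w : H2) :
    Tendsto (fun n => bandH2 n (analysis (d w 0))) atTop (𝓝 w) := by
  refine tendsto_H2 fun j => ?_
  fin_cases j
  · exact tendsto_lowPass _
  · refine (tendsto_lowPass (d w 1)).congr fun n => ?_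
    exact congrArg synth (cutD_analysis_d01 n w).symm
  · refine (tendsto_lowPass (d w 2)).congr fun n => ?_
    exact congrArg synth (cutD_cutD_analysis n w).symm

theorem norm_bandH2_le {n : ℕ} {a : Freq} {C : ℝ} (h0 : ‖a‖ ≤ C) (h1 : ‖cutD n a‖ ≤ C)
    (h2 : ‖cutD n (cutD n a)‖ ≤ C) : ‖bandH2 n a‖ ≤ 2 * C := by
  have hC : 0 ≤ C := (norm_nonneg _).trans h0
  refine (sq_le_sq₀ (norm_nonneg _) (by positivity)).1 ?_
  rw [norm_sq_H2, d_bandH2_zero, d_bandH2_one, d_bandH2_two]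
  have e0 : ‖synth (cutP n a)‖ ^ 2 ≤ C ^ 2 := by
    gcongr
    exact (norm_synth_le _).trans ((norm_cutP_le n a).trans h0)
  have e1 : ‖synth (cutD n a)‖ ^ 2 ≤ C ^ 2 := by
    gcongr
    exact (norm_synth_le _).trans h1
  have e2 : ‖synth (cutD n (cutD n a))‖ ^ 2 ≤ C ^ 2 := by
    gcongr
    exact (norm_synth_le _).trans h2
  nlinarith

/-! ### Weak compactness for functions of time -/

theorem secondCountableTopology_L2 : SecondCountableTopology L2 := by
  have : Fact ((2 : ℝ≥0∞) ≠ ⊤) := ⟨by simp⟩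
  exact Lp.SecondCountableTopology

instance instSeparableSpaceSobolevH (k : ℕ) : TopologicalSpace.SeparableSpace (sobolevH k) := by
  have := secondCountableTopology_L2
  have : SecondCountableTopology (PiLp 2 fun _ : Fin (k + 1) => L2) :=
    (PiLp.homeomorph 2 fun _ : Fin (k + 1) => L2).secondCountableTopology
  infer_instance

section Time

variable {T : ℝ}

theorem memLp_of_continuousOn {E : Type*} [NormedAddCommGroup E] {g : ℝ → E}
    (hg : ContinuousOn g (Icc 0 T)) (p : ℝ≥0∞) : MemLp g p (volume.restrict (Icc 0 T)) := by
  obtain ⟨C, hC⟩ := isCompact_Icc.exists_bound_of_continuousOn hg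
  exact MemLp.of_bound (hg.aestronglyMeasurable measurableSet_Icc) C
    ((ae_restrict_iff' measurableSet_Icc).2 (Eventually.of_forall hC))

theorem tendsto_integral_of_bounded (hT : 0 ≤ T) {C : ℝ} {g : ℕ → ℝ → ℝ} {h : ℝ → ℝ}
    (hc : ∀ n, ContinuousOn (g n) (Icc 0 T)) (hb : ∀ n, ∀ t ∈ Icc 0 T, |g n t| ≤ C)
    (hl : ∀ t ∈ Icc 0 T, Tendsto (fun n => g n t) atTop (𝓝 (h t))) :
    Tendsto (fun n => ∫ t in (0 : ℝ)..T, g n t) atTop (𝓝 (∫ t in (0 : ℝ)..T, h t)) := by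
  have hsub : uIoc 0 T ⊆ Icc 0 T := by
    rw [uIoc_of_le hT]
    exact Ioc_subset_Icc_self
  refine intervalIntegral.tendsto_integral_filter_of_dominated_convergence (fun _ => C)
    (Eventually.of_forall fun n => ?_) (Eventually.of_forall fun n => ?_)
    intervalIntegrable_const ?_
  · exact ((hc n).mono hsub).aestronglyMeasurable measurableSet_uIoc
  · exact Eventually.of_forall fun t ht => hb n t (hsub ht)
  · exact Eventually.of_forall fun t ht => hl t (hsub ht)

/-- The Bochner space `L²(0,T; L²(ℝ))`. -/
abbrev TimeL2 (T : ℝ) : Type := Lp L2 2 (volume.restrict (Icc 0 T))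

theorem inner_timeL2 (hT : 0 ≤ T) (z : TimeL2 T) {g : ℝ → L2}
    (hg : MemLp g 2 (volume.restrict (Icc 0 T))) :
    ⟪z, hg.toLp⟫_ℝ = ∫ t in (0 : ℝ)..T, ⟪z t, g t⟫_ℝ := by
  rw [L2.inner_def, intervalIntegral.integral_of_le hT, ← integral_Icc_eq_integral_Ioc]
  refine integral_congr_ae ?_
  filter_upwards [hg.coeFn_toLp] with t ht
  rw [ht]

theorem inner_timeL2_toLp (hT : 0 ≤ T) {z g : ℝ → L2} (hz : MemLp z 2 (volume.restrict (Icc 0 T)))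
    (hg : MemLp g 2 (volume.restrict (Icc 0 T))) :
    ⟪hz.toLp, hg.toLp⟫_ℝ = ∫ t in (0 : ℝ)..T, ⟪z t, g t⟫_ℝ := by
  rw [inner_timeL2 hT, intervalIntegral.integral_of_le hT, intervalIntegral.integral_of_le hT,
    ← integral_Icc_eq_integral_Ioc, ← integral_Icc_eq_integral_Ioc]
  refine integral_congr_ae ?_
  filter_upwards [hz.coeFn_toLp] with t ht
  rw [ht]

/-- Uniformly bounded functions with values in `L²(ℝ)` have a subsequence that converges weakly in
`L²(0,T; L²(ℝ))`, and the limit obeys the same bound. -/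
theorem exists_weak_limit_timeL2 (hT : 0 ≤ T) {C : ℝ} {z : ℕ → ℝ → L2}
    (hz : ∀ n, ContinuousOn (z n) (Icc 0 T)) (hb : ∀ n, ∀ t ∈ Icc 0 T, ‖z n t‖ ≤ C) :
    ∃ (W : ℝ → L2) (φ : ℕ → ℕ), StrictMono φ ∧ MemLp W ⊤ (volume.restrict (Icc 0 T)) ∧
      ∀ g : ℝ → L2, MemLp g 2 (volume.restrict (Icc 0 T)) →
        Tendsto (fun i => ∫ t in (0 : ℝ)..T, ⟪z (φ i) t, g t⟫_ℝ) atTop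
          (𝓝 (∫ t in (0 : ℝ)..T, ⟪W t, g t⟫_ℝ)) := by
  have := secondCountableTopology_L2
  have : Fact ((2 : ℝ≥0∞) ≠ ⊤) := ⟨by simp⟩
  have : SecondCountableTopology (TimeL2 T) := Lp.SecondCountableTopology
  have hm : ∀ n, MemLp (z n) 2 (volume.restrict (Icc 0 T)) := fun n =>
    memLp_of_continuousOn (hz n) 2
  have hC : 0 ≤ C := (norm_nonneg _).trans (hb 0 0 (left_mem_Icc.2 hT))
  have hbd : ∀ n, ‖(hm n).toLp‖ ≤
      (volume.restrict (Icc 0 T)).real univ ^ (2 : ℝ≥0∞).toReal⁻¹ * C := by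
    intro n
    refine Lp.norm_le_of_ae_bound hC ?_
    filter_upwards [(hm n).coeFn_toLp, ae_restrict_mem measurableSet_Icc] with t h1 h2
    rw [h1]
    exact hb n t h2
  obtain ⟨W, φ, hφ, hW⟩ := exists_weakTendsto_subseq hbd
  have hlim : ∀ g : ℝ → L2, MemLp g 2 (volume.restrict (Icc 0 T)) →
      Tendsto (fun i => ∫ t in (0 : ℝ)..T, ⟪z (φ i) t, g t⟫_ℝ) atTop
        (𝓝 (∫ t in (0 : ℝ)..T, ⟪W t, g t⟫_ℝ)) := fun g hg => by
    have h := hW.inner hg.toLp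
    rw [inner_timeL2 hT] at h
    exact h.congr fun i => inner_timeL2_toLp hT (hm _) hg
  refine ⟨W, φ, hφ, ?_, hlim⟩
  have hW2 := Lp.memLp W
  have hWn : Integrable (fun t => ‖W t‖) (volume.restrict (Icc 0 T)) :=
    (hW2.integrable (by norm_num)).norm
  have key : ∀ᵐ t ∂(volume.restrict (Icc 0 T)), ‖W t‖ ^ 2 ≤ C * ‖W t‖ := by
    refine ae_le_of_forall_setIntegral_le hW2.norm.integrable_sq (hWn.const_mul C)
      fun s hs _ => ?_
    have hg : MemLp (s.indicator W) 2 (volume.restrict (Icc 0 T)) := hW2.indicator hs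
    have h := hlim _ hg
    have e : ∀ v : ℝ → L2, ∫ t in (0 : ℝ)..T, ⟪v t, s.indicator W t⟫_ℝ =
        ∫ t in s, ⟪v t, W t⟫_ℝ ∂(volume.restrict (Icc 0 T)) := fun v => by
      rw [intervalIntegral.integral_of_le hT, ← integral_Icc_eq_integral_Ioc,
        ← integral_indicator hs]
      refine integral_congr_ae (Eventually.of_forall fun t => ?_)
      by_cases ht : t ∈ s <;> simp [ht]
    simp only [e, real_inner_self_eq_norm_sq] at h
    refine le_of_tendsto' h fun i => ?_
    refine integral_mono_ae ?_ (hWn.const_mul C).integrableOn ?_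
    · refine Integrable.integrableOn ?_
      refine (L2.integrable_inner (𝕜 := ℝ) (hm (φ i)).toLp W).congr ?_
      filter_upwards [(hm (φ i)).coeFn_toLp] with t ht
      rw [ht]
    · filter_upwards [ae_restrict_of_ae (ae_restrict_mem measurableSet_Icc)] with t ht
      exact (real_inner_le_norm _ _).trans
        (mul_le_mul_of_nonneg_right (hb _ t ht) (norm_nonneg _))
  refine memLp_top_of_bound hW2.1 C ?_
  filter_upwards [key] with t ht
  rcases (norm_nonneg (W t)).eq_or_lt with h0 | h0
  · rwa [← h0]
  · exact le_of_mul_le_mul_right (by rwa [← sq]) h0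

end Time

section Limit

variable {T : ℝ}

/-- `U` with velocity `W` is the weak limit of the functions `u n` with velocities `z n`. -/
structure IsWeakLimit (T C : ℝ) (u : ℕ → ℝ → H2) (z : ℕ → ℝ → L2) (U : ℝ → H2) (W : ℝ → L2) :
    Prop where
  weakTendsto : ∀ t ∈ Icc 0 T, WeakTendsto (fun i => u i t) (U t)
  memLp : MemLp U ⊤ (volume.restrict (Icc 0 T))
  memLp_velocity : MemLp W ⊤ (volume.restrict (Icc 0 T))
  norm_le : ∀ t ∈ Icc 0 T, ‖U t‖ ≤ C
  lipschitz : ∀ s ∈ Icc 0 T, ∀ t ∈ Icc 0 T, ‖d (U t) 0 - d (U s) 0‖ ≤ C * |t - s|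
  isWeakTimeDeriv : IsWeakTimeDeriv T (fun t => d (U t) 0) W
  tendsto_velocity : ∀ g : ℝ → L2, ContinuousOn g (Icc 0 T) →
    Tendsto (fun i => ∫ t in (0 : ℝ)..T, ⟪z i t, g t⟫_ℝ) atTop
      (𝓝 (∫ t in (0 : ℝ)..T, ⟪W t, g t⟫_ℝ))

/-- A function with values in `H²(ℝ)` that is continuous into `L²(ℝ)` is measurable, as the limit of
its low-pass filtered versions. -/
theorem aestronglyMeasurable_of_continuousOn {U : ℝ → H2}
    (h : ContinuousOn (fun t => d (U t) 0) (Icc 0 T)) :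
    AEStronglyMeasurable U (volume.restrict (Icc 0 T)) := by
  refine aestronglyMeasurable_of_tendsto_ae atTop (f := fun n t => bandH2 n (analysis (d (U t) 0)))
    (fun n => ?_) (Eventually.of_forall fun t => tendsto_bandH2_analysis (U t))
  exact (((continuous_bandH2 n).comp analysis.continuous).comp_continuousOn h).aestronglyMeasurable
    measurableSet_Icc

theorem isWeakTimeDeriv_of_tendsto (hT : 0 ≤ T) {C : ℝ} {u : ℕ → ℝ → L2} {z : ℕ → ℝ → L2}
    {U W : ℝ → L2} (hu : ∀ n, ∀ t ∈ Icc 0 T, ‖u n t‖ ≤ C)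
    (hd : ∀ n, ∀ t ∈ Icc 0 T, HasDerivAt (u n) (z n t) t)
    (hzc : ∀ n, ContinuousOn (z n) (Icc 0 T))
    (hU : ContinuousOn U (Icc 0 T)) (hW : MemLp W ⊤ (volume.restrict (Icc 0 T)))
    (hlim : ∀ t ∈ Icc 0 T, WeakTendsto (fun n => u n t) (U t))
    (hlimz : ∀ g : ℝ → L2, ContinuousOn g (Icc 0 T) →
      Tendsto (fun n => ∫ t in (0 : ℝ)..T, ⟪z n t, g t⟫_ℝ) atTop
        (𝓝 (∫ t in (0 : ℝ)..T, ⟪W t, g t⟫_ℝ))) : IsWeakTimeDeriv T U W := by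
  intro φ hφ hc hs
  have hφc := hφ.continuous
  have hφd : Continuous (deriv φ) := hφ.continuous_deriv (by simp)
  have hφ0 : φ 0 = 0 := image_eq_zero_of_notMem_tsupport fun h => (hs h).1.false
  have hφT : φ T = 0 := image_eq_zero_of_notMem_tsupport fun h => (hs h).2.false
  have huc : ∀ n, ContinuousOn (u n) (Icc 0 T) := fun n t ht =>
    (hd n t ht).continuousAt.continuousWithinAt
  have hWi : IntervalIntegrable W volume 0 T := by
    rw [intervalIntegrable_iff_integrableOn_Icc_of_le hT]
    exact hW.integrable le_top
  have hi1 : IntervalIntegrable (fun t => deriv φ t • U t) volume 0 T :=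
    (hφd.continuousOn.smul hU).intervalIntegrable_of_Icc hT
  have hi2 : IntervalIntegrable (fun t => φ t • W t) volume 0 T :=
    hWi.continuousOn_smul hφc.continuousOn
  refine ext_inner_left ℝ fun w => ?_
  have e1 := (innerSL ℝ w).intervalIntegral_comp_comm hi1
  have e2 := (innerSL ℝ w).intervalIntegral_comp_comm hi2
  simp only [innerSL_apply_apply, real_inner_smul_right] at e1 e2
  rw [inner_neg_right, ← e1, ← e2]
  have l1 : Tendsto (fun n => ∫ t in (0 : ℝ)..T, deriv φ t * ⟪w, u n t⟫_ℝ) atTop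
      (𝓝 (∫ t in (0 : ℝ)..T, deriv φ t * ⟪w, U t⟫_ℝ)) := by
    obtain ⟨B, hB⟩ := isCompact_Icc.exists_bound_of_continuousOn (hφd.continuousOn (s := Icc 0 T))
    refine tendsto_integral_of_bounded hT (C := B * (‖w‖ * C))
      (fun n => hφd.continuousOn.mul (continuousOn_const.inner (huc n))) (fun n t ht => ?_)
      fun t ht => ?_
    · rw [abs_mul]
      have h1 := hB t ht
      refine mul_le_mul h1 ((abs_real_inner_le_norm _ _).trans ?_) (abs_nonneg _)
        ((norm_nonneg _).trans h1)
      exact mul_le_mul_of_nonneg_left (hu n t ht) (norm_nonneg _)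
    · have := ((hlim t ht).inner w).const_mul (deriv φ t)
      simpa only [real_inner_comm w] using this
  have l2 := (hlimz (fun t => φ t • w) (by fun_prop)).neg
  refine tendsto_nhds_unique l1 ?_
  have e3 : ∫ t in (0 : ℝ)..T, φ t * ⟪w, W t⟫_ℝ = ∫ t in (0 : ℝ)..T, ⟪W t, φ t • w⟫_ℝ := by
    simp only [real_inner_smul_right, real_inner_comm w]
  rw [e3]
  refine l2.congr fun n => ?_
  have hparts := intervalIntegral.integral_mul_deriv_eq_deriv_mul (a := 0) (b := T) (u := φ)
    (v := fun t => ⟪w, u n t⟫_ℝ) (u' := deriv φ) (v' := fun t => ⟪w, z n t⟫_ℝ)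
    (fun t _ => (hφ.differentiable (by simp) t).hasDerivAt)
    (fun t ht => by
      rw [uIcc_of_le hT] at ht
      simpa using (hasDerivAt_const t w).inner ℝ (hd n t ht))
    (hφd.intervalIntegrable _ _)
    ((continuousOn_const.inner (hzc n)).intervalIntegrable_of_Icc hT)
  rw [hφ0, hφT] at hparts
  simp only [real_inner_smul_right, real_inner_comm w] at hparts ⊢
  linarith

/-- Bounded approximations of the displacement, with bounded velocities, have a subsequence with a
weak limit. -/
theorem exists_isWeakLimit (hT : 0 ≤ T) {C : ℝ} {u : ℕ → ℝ → H2} {z : ℕ → ℝ → L2}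
    (hu : ∀ n, ∀ t ∈ Icc 0 T, ‖u n t‖ ≤ C) (hz : ∀ n, ∀ t ∈ Icc 0 T, ‖z n t‖ ≤ C)
    (hd : ∀ n, ∀ t ∈ Icc 0 T, HasDerivAt (fun r => d (u n r) 0) (z n t) t)
    (hzc : ∀ n, ContinuousOn (z n) (Icc 0 T)) {w₀ : L2}
    (h0 : Tendsto (fun n => d (u n 0) 0) atTop (𝓝 w₀)) :
    ∃ (U : ℝ → H2) (W : ℝ → L2) (φ : ℕ → ℕ), StrictMono φ ∧
      IsWeakLimit T C (fun i => u (φ i)) (fun i => z (φ i)) U W := by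
  obtain ⟨W, φ, hφ, hW, hlim⟩ := exists_weak_limit_timeL2 hT hzc hz
  have hC : 0 ≤ C := (norm_nonneg _).trans (hz 0 0 (left_mem_Icc.2 hT))
  have hftc : ∀ n, ∀ t ∈ Icc 0 T, ∀ w : L2, ⟪d (u n t) 0, w⟫_ℝ =
      ⟪d (u n 0) 0, w⟫_ℝ + ∫ r in (0 : ℝ)..T, ⟪z n r, (Ioc 0 t).indicator (fun _ => w) r⟫_ℝ := by
    intro n t ht w
    have hsub : uIcc 0 t ⊆ Icc 0 T := by
      rw [uIcc_of_le ht.1]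
      exact Icc_subset_Icc_right ht.2
    have h1 := intervalIntegral.integral_eq_sub_of_hasDerivAt (a := 0) (b := t)
      (f := fun r => ⟪d (u n r) 0, w⟫_ℝ) (f' := fun r => ⟪z n r, w⟫_ℝ)
      (fun r hr => by simpa using (hd n r (hsub hr)).inner ℝ (hasDerivAt_const r w))
      ((((hzc n).mono hsub).inner continuousOn_const).intervalIntegrable)
    have h2 : ∫ r in (0 : ℝ)..T, ⟪z n r, (Ioc 0 t).indicator (fun _ => w) r⟫_ℝ =
        ∫ r in (0 : ℝ)..t, ⟪z n r, w⟫_ℝ := by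
      rw [intervalIntegral.integral_of_le hT, intervalIntegral.integral_of_le ht.1]
      have e : (fun r => ⟪z n r, (Ioc 0 t).indicator (fun _ => w) r⟫_ℝ) =
          (Ioc 0 t).indicator fun r => ⟪z n r, w⟫_ℝ := by
        ext r
        by_cases hr : r ∈ Ioc 0 t <;> simp [hr]
      rw [e, setIntegral_indicator measurableSet_Ioc,
        inter_eq_self_of_subset_right (Ioc_subset_Ioc_right ht.2)]
    rw [h2, h1]
    ring
  have hex : ∀ t ∈ Icc 0 T, ∃ x : H2, WeakTendsto (fun i => u (φ i) t) x := by
    intro t ht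
    have hconv : ∀ w : L2, Tendsto (fun i => ⟪d (u (φ i) t) 0, w⟫_ℝ) atTop
        (𝓝 (⟪w₀, w⟫_ℝ + ∫ r in (0 : ℝ)..T, ⟪W r, (Ioc 0 t).indicator (fun _ => w) r⟫_ℝ)) := by
      intro w
      have h1 := ((h0.comp hφ.tendsto_atTop).inner (tendsto_const_nhds (x := w))).add
        (hlim _ ((memLp_const w).indicator (measurableSet_Ioc (a := 0) (b := t))))
      exact h1.congr fun i => (hftc _ t ht w).symm
    have := secondCountableTopology_L2
    obtain ⟨y, ψ, hψ, hy⟩ := exists_weakTendsto_subseq (u := fun i => d (u (φ i) t) 0)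
      fun i => (norm_d_le _ _).trans (hu _ t ht)
    have hy' : WeakTendsto (fun i => dL 2 0 (u (φ i) t)) y := weakTendsto_of_inner fun w => by
      rw [tendsto_nhds_unique (hy.inner w) ((hconv w).comp hψ.tendsto_atTop)]
      exact hconv w
    obtain ⟨x, -, hx⟩ := exists_weakTendsto_of_injective (A := dL 2 0) (fun v w h => H2_ext h)
      (fun i => hu (φ i) t ht) hy'
    exact ⟨x, hx⟩
  choose! U hU using hex
  have hLip : ∀ s ∈ Icc 0 T, ∀ t ∈ Icc 0 T, ‖d (U t) 0 - d (U s) 0‖ ≤ C * |t - s| := by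
    intro s hs t ht
    refine WeakTendsto.norm_le (u := fun i => d (u (φ i) t) 0 - d (u (φ i) s) 0) (fun l => ?_)
      fun i => ?_
    · simp only [map_sub]
      exact ((hU t ht).map (dL 2 0) l).sub ((hU s hs).map (dL 2 0) l)
    · exact (convex_Icc 0 T).norm_image_sub_le_of_norm_hasDerivWithin_le
        (fun r hr => (hd (φ i) r hr).hasDerivWithinAt) (hz (φ i)) hs ht
  have hcont : ContinuousOn (fun t => d (U t) 0) (Icc 0 T) := by
    refine LipschitzOnWith.continuousOn (K := C.toNNReal) (LipschitzOnWith.of_dist_le_mul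
      fun t ht s hs => ?_)
    rw [dist_eq_norm, Real.dist_eq, Real.coe_toNNReal C hC]
    exact hLip s hs t ht
  have hnorm : ∀ t ∈ Icc 0 T, ‖U t‖ ≤ C := fun t ht => (hU t ht).norm_le fun i => hu _ t ht
  have hcontlim : ∀ g : ℝ → L2, ContinuousOn g (Icc 0 T) →
    Tendsto (fun i => ∫ t in (0 : ℝ)..T, ⟪z (φ i) t, g t⟫_ℝ) atTop
      (𝓝 (∫ t in (0 : ℝ)..T, ⟪W t, g t⟫_ℝ)) := fun g hg => hlim g (memLp_of_continuousOn hg 2)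
  refine ⟨U, W, φ, hφ, hU, ?_, hW, hnorm, hLip, ?_, hcontlim⟩
  · exact memLp_top_of_bound (aestronglyMeasurable_of_continuousOn hcont) C
      ((ae_restrict_iff' measurableSet_Icc).2 (Eventually.of_forall hnorm))
  · exact isWeakTimeDeriv_of_tendsto hT (fun n t ht => (norm_d_le _ _).trans (hu _ t ht))
      (fun n => hd (φ n)) (fun n => hzc _) hcont hW (fun t ht => (hU t ht).map (dL 2 0)) hcontlim

end Limit

/-! ### Passage to the limit -/

theorem IsWeakDeriv.ae_eq_zero_outside {w w' : L2} (h : IsWeakDeriv w w') {M : ℝ}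
    (hw : ∀ᵐ x : ℝ, M < |x| → w x = 0) : ∀ᵐ x : ℝ, M < |x| → w' x = 0 := by
  have ho : IsOpen {x : ℝ | M < |x|} := isOpen_lt continuous_const continuous_abs
  refine ho.ae_eq_zero_of_integral_contDiff_smul_eq_zero
    (((Lp.memLp w').locallyIntegrable one_le_two).locallyIntegrableOn _) fun φ hφ hc hs => ?_
  have h1 := h φ hφ hc
  have h2 : ∫ x, w x * deriv φ x = 0 := by
    refine integral_eq_zero_of_ae ?_
    filter_upwards [hw] with x hx
    by_cases hxM : M < |x|
    · simp [hx hxM]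
    · have : deriv φ x = 0 :=
        image_eq_zero_of_notMem_tsupport fun h' => hxM (hs (tsupport_deriv_subset h'))
      simp [this]
  simp only [smul_eq_mul, mul_comm (φ _)]
  linarith

theorem integrable_of_ae_eq_zero_outside {y : L2} {M : ℝ}
    (hy : ∀ᵐ x : ℝ, M < |x| → y x = 0) : Integrable y := by
  have h1 : IntegrableOn y (Icc (-M) M) := ((Lp.memLp y).restrict _).integrable one_le_two
  refine (h1.integrable_indicator measurableSet_Icc).congr ?_
  filter_upwards [hy] with x hx
  by_cases h : x ∈ Icc (-M) M
  · rw [indicator_of_mem h]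
  · rw [indicator_of_notMem h, hx]
    rwa [mem_Icc, ← abs_le, not_le] at h

theorem norm_truncCubeL_le (K : NNReal) (w : L2) : ‖truncCubeL K w‖ ≤ K ^ 2 * ‖w‖ := by
  simpa [truncCubeL] using (lipschitz_truncCube K).norm_compLp_le (truncCube_zero K) w

theorem abs_truncCube_le (K : NNReal) (s : ℝ) : |truncCube K s| ≤ K ^ 3 / 3 := by
  have hK := K.2
  rw [truncCube, abs_div, abs_pow, abs_of_pos (three_pos : (0 : ℝ) < 3)]
  gcongr
  exact abs_le.2 ⟨le_max_left _ _, max_le (by linarith) (min_le_right _ _)⟩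

/-- The cubic term is weakly continuous when tested with functions of compact support: the first
derivatives converge pointwise. -/
theorem tendsto_inner_truncCubeL {w : ℕ → H2} {x : H2} (hw : WeakTendsto w x) {C : ℝ}
    (hC : ∀ i, ‖w i‖ ≤ C) {K : NNReal} (hK : ∀ i y, |contRep (d (w i) 1) y| ≤ K) {v : ℕ → L2}
    {y : L2} (hv : Tendsto v atTop (𝓝 y)) {M : ℝ} (hy : ∀ᵐ r : ℝ, M < |r| → y r = 0) :
    Tendsto (fun i => ⟪truncCubeL K (d (w i) 1), v i⟫_ℝ) atTop
      (𝓝 (1 / 3 * ∫ r, d x 1 r ^ 3 * y r)) := by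
  have h0 : Tendsto (fun i => ⟪truncCubeL K (d (w i) 1), v i - y⟫_ℝ) atTop (𝓝 0) := by
    have h1 := (tendsto_iff_norm_sub_tendsto_zero.1 hv).const_mul ((K : ℝ) ^ 2 * C)
    rw [mul_zero] at h1
    refine squeeze_zero_norm (fun i => (abs_real_inner_le_norm _ _).trans ?_) h1
    gcongr
    exact (norm_truncCubeL_le K _).trans (by gcongr; exact (norm_d_le _ _).trans (hC i))
  have h2 : Tendsto (fun i => ⟪truncCubeL K (d (w i) 1), y⟫_ℝ) atTop
      (𝓝 (1 / 3 * ∫ r, d x 1 r ^ 3 * y r)) := by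
    rw [← integral_const_mul]
    simp only [inner_L2]
    refine tendsto_integral_of_dominated_convergence (fun r => (K : ℝ) ^ 3 / 3 * |y r|)
      (fun i => (Lp.aestronglyMeasurable _).mul (Lp.aestronglyMeasurable _))
      ((integrable_of_ae_eq_zero_outside hy).abs.const_mul _) (fun i => ?_) ?_
    · filter_upwards [coeFn_truncCubeL K (d (w i) 1)] with r hr
      rw [hr, norm_mul]
      exact mul_le_mul_of_nonneg_right (abs_truncCube_le K _) (abs_nonneg _)
    · have e : ∀ᵐ r : ℝ, ∀ i, truncCubeL K (d (w i) 1) r = contRep (d (w i) 1) r ^ 3 / 3 := by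
        rw [ae_all_iff]
        intro i
        filter_upwards [coeFn_truncCubeL K (d (w i) 1),
          (isWeakDeriv_d12 (w i)).coeFn_eq_contRep] with r h1 h2
        rw [h1, h2, truncCube_of_abs_le (hK i r)]
      filter_upwards [e, (isWeakDeriv_d12 x).coeFn_eq_contRep] with r hr hx
      simp only [hr, hx]
      have := (((hw (traceL 1 r)).pow 3).div_const 3).mul_const (y r)
      refine this.trans_eq ?_
      congr 1
      simp only [traceL_one]
      ring
  simpa [inner_sub_right] using h0.add h2

theorem continuous_kernel (n : ℕ) : Continuous (kernel n) :=
  continuous_iff_continuousAt.2 fun x => (hasDerivAt_kernel n x).continuousAt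

theorem bandRep_eq_traceL (n : ℕ) (a : Freq) (x : ℝ) :
    bandRep n a x = traceL 0 x (bandH2 n a) := by
  rw [traceL_zero, d_bandH2_zero, contRep_synth_cutP]

theorem bandRep_cutD_eq_traceL (n : ℕ) (a : Freq) (x : ℝ) :
    bandRep n (cutD n a) x = traceL 1 x (bandH2 n a) := by
  rw [traceL_one, d_bandH2_one, contRep_synth_cutD]

theorem inner_cutD_cutD_analysis (n : ℕ) (a : Freq) (w : H2) :
    ⟪cutD n (cutD n a), cutD n (cutD n (cutP n (analysis (d w 0))))⟫_ℝ =
      ⟪d (bandH2 n a) 2, d w 2⟫_ℝ := by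
  rw [cutD_cutP, cutD_cutD_analysis, ← inner_synth_cutP, cutP_cutD, d_bandH2_two]

theorem inner_cubicForce_analysis (K : NNReal) (n : ℕ) (a : Freq) (w : H2) :
    ⟪cubicForce K n a, cutP n (analysis (d w 0))⟫_ℝ =
      ⟪truncCubeL K (d (bandH2 n a) 1), lowPass n (d w 1)⟫_ℝ := by
  rw [inner_cubicForce, cutD_cutP, cutD_analysis_d01, d_bandH2_one, lowPass_apply]

namespace BeamData

variable (D : BeamData)

theorem continuous_ζ : Continuous D.ζ :=
  continuous_iff_continuousAt.2 fun t => (D.hasDerivAt_ζ t).continuousAt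

theorem continuous_ζ' : Continuous D.ζ' :=
  continuous_iff_continuousAt.2 fun t => (D.hasDerivAt_ζ' t).continuousAt

theorem continuousOn_bandRep (n : ℕ) {g : ℝ → Freq} {I : Set ℝ} (hg : ContinuousOn g I) :
    ContinuousOn (fun t => bandRep n (g t) (D.ζ t)) I :=
  hg.inner ((continuous_kernel n).comp D.continuous_ζ).continuousOn

/-- Weak limits of solutions of the frequency-truncated problems satisfy the weak formulation of
the beam equation. -/
theorem weak_form_of_isWeakLimit {K : NNReal} {σ : ℕ → ℕ} (hσ : Tendsto σ atTop atTop)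
    {a z z' : ℕ → ℝ → Freq} (h : ∀ i, (D.system K (σ i)).IsSolution (a i) (z i) (z' i))
    {w₀ w₁ w₀' w₁' : L2} (hw₀ : IsWeakDeriv w₀ w₀') (hw₁ : IsWeakDeriv w₁ w₁')
    (ha0 : ∀ i, a i 0 = cutP (σ i) (analysis w₀)) (hz0 : ∀ i, z i 0 = cutP (σ i) (analysis w₁))
    {C : ℝ} (hb : ∀ i, ∀ t ∈ Icc 0 D.T, ‖bandH2 (σ i) (a i t)‖ ≤ C) (hK : 2 * C ≤ K)
    {U : ℝ → H2} {W : ℝ → L2} (hU : IsWeakLimit D.T C (fun i t => bandH2 (σ i) (a i t))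
      (fun i t => synth (cutP (σ i) (z i t))) U W)
    {V V' V'' : ℝ → H2} (hV : ∀ t, HasDerivAt V (V' t) t) (hV' : ∀ t, HasDerivAt V' (V'' t) t)
    (hV'' : Continuous V'') (hVT : V D.T = 0) (hVT' : V' D.T = 0) {M : ℝ}
    (hM : ∀ t ∈ Icc 0 D.T, ∀ᵐ x : ℝ, M < |x| → d (V t) 0 x = 0) :
    (∫ t in (0 : ℝ)..D.T, ∫ x, W t x * d (V' t) 0 x)
      - (∫ t in (0 : ℝ)..D.T, ∫ x, d (U t) 2 x * d (V t) 2 x)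
      - 1 / 3 * (∫ t in (0 : ℝ)..D.T, ∫ x, d (U t) 1 x ^ 3 * d (V t) 1 x)
      - (∫ t in (0 : ℝ)..D.T, ∫ x, D.ν * d (D.p t) 0 x * d (U t) 2 x * d (V t) 0 x)
      - contRep w₀ (D.ζ 0) * contRep (d (V' 0) 0) (D.ζ 0)
      - (∫ t in (0 : ℝ)..D.T, contRep (d (U t) 0) (D.ζ t) * contRep (d (V'' t) 0) (D.ζ t))
      - (∫ t in (0 : ℝ)..D.T, D.ζ' t * contRep (d (U t) 1) (D.ζ t) *
          contRep (d (V' t) 0) (D.ζ t))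
      - (∫ t in (0 : ℝ)..D.T, D.ζ' t * contRep (d (U t) 0) (D.ζ t) *
          contRep (d (V' t) 1) (D.ζ t))
      + (∫ t in (0 : ℝ)..D.T, ∫ x, d (D.f t) 0 x * d (V t) 0 x)
      + (∫ t in (0 : ℝ)..D.T, D.P t * contRep (d (V t) 0) (D.ζ t))
      + (∫ x, w₁ x * d (V 0) 0 x)
      + contRep w₁ (D.ζ 0) * contRep (d (V 0) 0) (D.ζ 0) = 0 := by
  have hT := D.hT.le
  have hZ : 0 ≤ D.Z := zero_le_one.trans D.one_le_Z
  have h0T : (0 : ℝ) ∈ Icc 0 D.T := left_mem_Icc.2 hT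
  have hC : 0 ≤ C := (norm_nonneg _).trans (hb 0 0 h0T)
  have ca : ∀ i, ContinuousOn (a i) (Icc 0 D.T) := fun i t ht =>
    ((h i).hasDerivAt t ht).continuousAt.continuousWithinAt
  have cV : Continuous V := continuous_iff_continuousAt.2 fun t => (hV t).continuousAt
  have cV' : Continuous V' := continuous_iff_continuousAt.2 fun t => (hV' t).continuousAt
  -- the spectrum of an `H²` function, cut off to the band of the `i`-th approximation
  let A : ℕ → H2 →L[ℝ] Freq := fun i => (cutP (σ i)).comp (analysis.comp (dL 2 0))
  have hA : ∀ i w, A i w = cutP (σ i) (analysis (d w 0)) := fun i w => rfl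
  obtain ⟨B₀, hB₀⟩ := isCompact_Icc.exists_bound_of_continuousOn (cV.continuousOn (s := Icc 0 D.T))
  obtain ⟨B₁, hB₁⟩ := isCompact_Icc.exists_bound_of_continuousOn (cV'.continuousOn (s := Icc 0 D.T))
  obtain ⟨B₂, hB₂⟩ := isCompact_Icc.exists_bound_of_continuousOn
    (hV''.continuousOn (s := Icc 0 D.T))
  have hB₀n : 0 ≤ B₀ := (norm_nonneg _).trans (hB₀ 0 h0T)
  have hB₁n : 0 ≤ B₁ := (norm_nonneg _).trans (hB₁ 0 h0T)
  have hB₂n : 0 ≤ B₂ := (norm_nonneg _).trans (hB₂ 0 h0T)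
  have tr0 : ∀ i, ∀ t ∈ Icc 0 D.T, |bandRep (σ i) (a i t) (D.ζ t)| ≤ 2 * C := fun i t ht => by
    rw [bandRep_eq_traceL]
    exact (abs_trace_le _ 0 _).trans (by linarith [hb i t ht])
  have tr1 : ∀ i, ∀ t ∈ Icc 0 D.T, |bandRep (σ i) (cutD (σ i) (a i t)) (D.ζ t)| ≤ 2 * C :=
    fun i t ht => by
      rw [bandRep_cutD_eq_traceL]
      exact (abs_trace_le _ 1 _).trans (by linarith [hb i t ht])
  have trA0 : ∀ i (w : H2) {B : ℝ} (x : ℝ), ‖w‖ ≤ B → |bandRep (σ i) (A i w) x| ≤ 2 * B :=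
    fun i w B x hw => by
      rw [hA, bandRep_cutP]
      exact (isWeakDeriv_d01 w).abs_bandRep_le ((norm_d_le _ _).trans hw)
        ((norm_d_le _ _).trans hw) _ _
  have trA1 : ∀ i (w : H2) {B : ℝ} (x : ℝ), ‖w‖ ≤ B →
      |bandRep (σ i) (cutD (σ i) (A i w)) x| ≤ 2 * B :=
    fun i w B x hw => by
      rw [hA, cutD_cutP, cutD_analysis_d01, bandRep_cutP]
      exact (isWeakDeriv_d12 w).abs_bandRep_le ((norm_d_le _ _).trans hw)
        ((norm_d_le _ _).trans hw) _ _
  have limA0 : ∀ (w : H2) x, Tendsto (fun i => bandRep (σ i) (A i w) x) atTop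
      (𝓝 (contRep (d w 0) x)) := fun w x => by
    simp only [hA, bandRep_cutP]
    exact ((isWeakDeriv_d01 w).tendsto_bandRep x).comp hσ
  have limA1 : ∀ (w : H2) x, Tendsto (fun i => bandRep (σ i) (cutD (σ i) (A i w)) x) atTop
      (𝓝 (contRep (d w 1) x)) := fun w x => by
    simp only [hA, cutD_cutP, cutD_analysis_d01, bandRep_cutP]
    exact ((isWeakDeriv_d12 w).tendsto_bandRep x).comp hσ
  have limU0 : ∀ t ∈ Icc 0 D.T, ∀ x, Tendsto (fun i => bandRep (σ i) (a i t) x) atTop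
      (𝓝 (contRep (d (U t) 0) x)) := fun t ht x => by
    simp only [bandRep_eq_traceL]
    exact hU.weakTendsto t ht (traceL 0 x)
  have limU1 : ∀ t ∈ Icc 0 D.T, ∀ x, Tendsto (fun i => bandRep (σ i) (cutD (σ i) (a i t)) x) atTop
      (𝓝 (contRep (d (U t) 1) x)) := fun t ht x => by
    simp only [bandRep_cutD_eq_traceL]
    exact hU.weakTendsto t ht (traceL 1 x)
  have limL : ∀ w : L2, Tendsto (fun i => lowPass (σ i) w) atTop (𝓝 w) := fun w =>
    (tendsto_lowPass w).comp hσ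
  have cA : ∀ i {v : ℝ → H2}, Continuous v → ContinuousOn (fun t => A i (v t)) (Icc 0 D.T) :=
    fun i v hv => ((A i).continuous.comp hv).continuousOn
  -- The velocities converge weakly in time only, so this is the one term whose integrand need not
  -- converge at each time; the others converge by dominated convergence.
  have l1 : Tendsto (fun i => ∫ t in (0 : ℝ)..D.T, ⟪z i t, A i (V' t)⟫_ℝ) atTop
      (𝓝 (∫ t in (0 : ℝ)..D.T, ∫ x, W t x * d (V' t) 0 x)) := by
    simp only [← inner_L2, hA, ← inner_synth_cutP]
    exact hU.tendsto_velocity (fun t => d (V' t) 0) ((dL 2 0).continuous.comp cV').continuousOn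
  have l2 : Tendsto (fun i => ∫ t in (0 : ℝ)..D.T, ⟪cutD (σ i) (cutD (σ i) (a i t)),
      cutD (σ i) (cutD (σ i) (A i (V t)))⟫_ℝ) atTop
      (𝓝 (∫ t in (0 : ℝ)..D.T, ∫ x, d (U t) 2 x * d (V t) 2 x)) := by
    refine tendsto_integral_of_bounded hT (C := C * B₀) (fun i => ?_) (fun i t ht => ?_)
      fun t ht => ?_
    · have := ca i
      have := cA i cV
      fun_prop
    · rw [hA, inner_cutD_cutD_analysis]
      exact (abs_real_inner_le_norm _ _).trans (mul_le_mul ((norm_d_le _ _).trans (hb i t ht))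
        ((norm_d_le _ _).trans (hB₀ t ht)) (norm_nonneg _) hC)
    · simp only [hA, inner_cutD_cutD_analysis]
      rw [← inner_L2]
      exact ((hU.weakTendsto t ht).map (dL 2 2)).inner _
  have l3 : Tendsto (fun i => ∫ t in (0 : ℝ)..D.T, ⟪cubicForce K (σ i) (a i t), A i (V t)⟫_ℝ) atTop
      (𝓝 (∫ t in (0 : ℝ)..D.T, 1 / 3 * ∫ x, d (U t) 1 x ^ 3 * d (V t) 1 x)) := by
    refine tendsto_integral_of_bounded hT (C := K ^ 2 * C * B₀) (fun i => ?_) (fun i t ht => ?_)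
      fun t ht => ?_
    · exact ((lipschitz_cubicForce K (σ i)).continuous.comp_continuousOn (ca i)).inner (cA i cV)
    · rw [hA, inner_cubicForce_analysis]
      refine (abs_real_inner_le_norm _ _).trans (mul_le_mul ?_ ?_ (norm_nonneg _) (by positivity))
      · refine (norm_truncCubeL_le K _).trans ?_
        gcongr
        exact (norm_d_le _ _).trans (hb i t ht)
      · exact (norm_lowPass_le _ _).trans ((norm_d_le _ _).trans (hB₀ t ht))
    · simp only [hA, inner_cubicForce_analysis]
      exact tendsto_inner_truncCubeL (hU.weakTendsto t ht) (fun i => hb i t ht)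
        (fun i y => (abs_trace_le _ 1 y).trans (by linarith [hb i t ht])) (limL _)
        ((isWeakDeriv_d01 (V t)).ae_eq_zero_outside (hM t ht))
  have l4 : Tendsto (fun i => ∫ t in (0 : ℝ)..D.T,
      ⟪analysis (D.ν • D.loadMul t (synth (cutD (σ i) (cutD (σ i) (a i t))))), A i (V t)⟫_ℝ) atTop
      (𝓝 (∫ t in (0 : ℝ)..D.T, ∫ x, D.ν * d (D.p t) 0 x * d (U t) 2 x * d (V t) 0 x)) := by
    have hload : ∀ t w, ‖D.ν • D.loadMul t w‖ ≤ D.Z * ‖w‖ := fun t w => by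
      rw [norm_smul]
      exact D.norm_loadMul_le t w
    refine tendsto_integral_of_bounded hT (C := D.Z * C * B₀) (fun i => ?_) (fun i t ht => ?_)
      fun t ht => ?_
    · have h1 : ContinuousOn (fun t => synth (cutD (σ i) (cutD (σ i) (a i t)))) (Icc 0 D.T) := by
        have := ca i
        fun_prop
      have h2 := D.continuous_loadMul.continuousOn.clm_apply h1
      exact (analysis.continuous.comp_continuousOn (h2.const_smul D.ν)).inner (cA i cV)
    · rw [hA, inner_analysis]
      refine (abs_real_inner_le_norm _ _).trans (mul_le_mul ?_ ?_ (norm_nonneg _) (by positivity))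
      · refine (hload t _).trans ?_
        gcongr
        exact (norm_d_le (bandH2 (σ i) (a i t)) 2).trans (hb i t ht)
      · exact (norm_lowPass_le _ _).trans ((norm_d_le _ _).trans (hB₀ t ht))
    · simp only [hA, inner_analysis]
      have h1 := ((hU.weakTendsto t ht).map ((D.ν • D.loadMul t).comp (dL 2 2))).inner_strong
        (C := D.Z * C) (fun i => (hload t _).trans ?_) (limL (d (V t) 0))
      · refine h1.trans_eq ?_
        rw [inner_L2]
        congr 1
        refine integral_congr_ae ?_
        filter_upwards [D.coeFn_loadMul t (d (U t) 2),
          Lp.coeFn_smul D.ν (D.loadMul t (d (U t) 2))] with x h2 h3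
        change (D.ν • D.loadMul t (d (U t) 2)) x * _ = _
        rw [h3, Pi.smul_apply, h2, smul_eq_mul]
        ring
      · gcongr
        exact (norm_d_le (bandH2 (σ i) (a i t)) 2).trans (hb i t ht)
  have l5 : Tendsto (fun i => bandRep (σ i) (a i 0) (D.ζ 0) * bandRep (σ i) (A i (V' 0)) (D.ζ 0))
      atTop (𝓝 (contRep w₀ (D.ζ 0) * contRep (d (V' 0) 0) (D.ζ 0))) := by
    refine Tendsto.mul ?_ (limA0 _ _)
    simp only [ha0, bandRep_cutP]
    exact (hw₀.tendsto_bandRep _).comp hσ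
  have l6 : Tendsto (fun i => ∫ t in (0 : ℝ)..D.T, bandRep (σ i) (a i t) (D.ζ t) *
      bandRep (σ i) (A i (V'' t)) (D.ζ t)) atTop
      (𝓝 (∫ t in (0 : ℝ)..D.T, contRep (d (U t) 0) (D.ζ t) * contRep (d (V'' t) 0) (D.ζ t))) := by
    refine tendsto_integral_of_bounded hT (C := 2 * C * (2 * B₂)) (fun i => ?_) (fun i t ht => ?_)
      fun t ht => ?_
    · exact (D.continuousOn_bandRep _ (ca i)).mul (D.continuousOn_bandRep _ (cA i hV''))
    · rw [abs_mul]
      exact mul_le_mul (tr0 i t ht) (trA0 i _ _ (hB₂ t ht)) (abs_nonneg _) (by positivity)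
    · exact (limU0 t ht _).mul (limA0 _ _)
  have l7 : Tendsto (fun i => ∫ t in (0 : ℝ)..D.T, D.ζ' t *
      bandRep (σ i) (cutD (σ i) (a i t)) (D.ζ t) * bandRep (σ i) (A i (V' t)) (D.ζ t)) atTop
      (𝓝 (∫ t in (0 : ℝ)..D.T, D.ζ' t * contRep (d (U t) 1) (D.ζ t) *
        contRep (d (V' t) 0) (D.ζ t))) := by
    refine tendsto_integral_of_bounded hT (C := D.Z * (2 * C) * (2 * B₁)) (fun i => ?_)
      (fun i t ht => ?_) fun t ht => ?_
    · exact (D.continuous_ζ'.continuousOn.mul (D.continuousOn_bandRep _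
        ((cutD (σ i)).continuous.comp_continuousOn (ca i)))).mul
        (D.continuousOn_bandRep _ (cA i cV'))
    · rw [abs_mul, abs_mul]
      exact mul_le_mul (mul_le_mul (D.ζ'_le t ht) (tr1 i t ht) (abs_nonneg _) hZ)
        (trA0 i _ _ (hB₁ t ht)) (abs_nonneg _) (by positivity)
    · exact ((limU1 t ht _).const_mul _).mul (limA0 _ _)
  have l8 : Tendsto (fun i => ∫ t in (0 : ℝ)..D.T, D.ζ' t *
      bandRep (σ i) (a i t) (D.ζ t) * bandRep (σ i) (cutD (σ i) (A i (V' t))) (D.ζ t)) atTop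
      (𝓝 (∫ t in (0 : ℝ)..D.T, D.ζ' t * contRep (d (U t) 0) (D.ζ t) *
        contRep (d (V' t) 1) (D.ζ t))) := by
    refine tendsto_integral_of_bounded hT (C := D.Z * (2 * C) * (2 * B₁)) (fun i => ?_)
      (fun i t ht => ?_) fun t ht => ?_
    · exact (D.continuous_ζ'.continuousOn.mul (D.continuousOn_bandRep _ (ca i))).mul
        (D.continuousOn_bandRep _ ((cutD (σ i)).continuous.comp_continuousOn (cA i cV')))
    · rw [abs_mul, abs_mul]
      exact mul_le_mul (mul_le_mul (D.ζ'_le t ht) (tr0 i t ht) (abs_nonneg _) hZ)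
        (trA1 i _ _ (hB₁ t ht)) (abs_nonneg _) (by positivity)
    · exact ((limU0 t ht _).const_mul _).mul (limA1 _ _)
  have l9 : Tendsto (fun i => ∫ t in (0 : ℝ)..D.T, ⟪analysis (d (D.f t) 0), A i (V t)⟫_ℝ) atTop
      (𝓝 (∫ t in (0 : ℝ)..D.T, ∫ x, d (D.f t) 0 x * d (V t) 0 x)) := by
    refine tendsto_integral_of_bounded hT (C := D.Z * B₀) (fun i => ?_) (fun i t ht => ?_)
      fun t ht => ?_
    · exact (analysis.continuous.comp ((dL 2 0).continuous.comp
        D.continuous_f)).continuousOn.inner (cA i cV)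
    · rw [hA, inner_analysis]
      exact (abs_real_inner_le_norm _ _).trans (mul_le_mul ((norm_d_le _ _).trans (D.f_le t))
        ((norm_lowPass_le _ _).trans ((norm_d_le _ _).trans (hB₀ t ht))) (norm_nonneg _) hZ)
    · simp only [hA, inner_analysis]
      rw [← inner_L2]
      exact tendsto_const_nhds.inner (limL _)
  have l10 : Tendsto (fun i => ∫ t in (0 : ℝ)..D.T, D.P t * bandRep (σ i) (A i (V t)) (D.ζ t)) atTop
      (𝓝 (∫ t in (0 : ℝ)..D.T, D.P t * contRep (d (V t) 0) (D.ζ t))) := by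
    refine tendsto_integral_of_bounded hT (C := D.Z * (2 * B₀)) (fun i => ?_) (fun i t ht => ?_)
      fun t ht => ?_
    · exact D.continuous_P.continuousOn.mul (D.continuousOn_bandRep _ (cA i cV))
    · rw [abs_mul]
      exact mul_le_mul (D.P_le t) (trA0 i _ _ (hB₀ t ht)) (abs_nonneg _) hZ
    · exact (limA0 _ _).const_mul _
  have l11 : Tendsto (fun i => ⟪z i 0, A i (V 0)⟫_ℝ) atTop (𝓝 (∫ x, w₁ x * d (V 0) 0 x)) := by
    simp only [hA, ← inner_synth_cutP, hz0, cutP_cutP]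
    rw [← inner_L2]
    exact (limL w₁).inner tendsto_const_nhds
  have l12 : Tendsto (fun i => bandRep (σ i) (z i 0) (D.ζ 0) * bandRep (σ i) (A i (V 0)) (D.ζ 0))
      atTop (𝓝 (contRep w₁ (D.ζ 0) * contRep (d (V 0) 0) (D.ζ 0))) := by
    refine Tendsto.mul ?_ (limA0 _ _)
    simp only [hz0, bandRep_cutP]
    exact (hw₁.tendsto_bandRep _).comp hσ
  rw [intervalIntegral.integral_const_mul] at l3
  have hsum := (((((((((((l1.sub l2).sub l3).sub l4).sub l5).sub l6).sub l7).sub l8).add l9).add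
    l10).add l11).add l12)
  refine tendsto_nhds_unique ((tendsto_congr fun i => ?_).1 hsum) tendsto_const_nhds
  exact (h i).weak_form hT (b := fun t => A i (V t)) (b' := fun t => A i (V' t))
    (b'' := fun t => A i (V'' t)) (fun t => (A i).hasFDerivAt.comp_hasDerivAt t (hV t))
    (fun t => (A i).hasFDerivAt.comp_hasDerivAt t (hV' t)) ((A i).continuous.comp hV'')
    ((congrArg (A i) hVT).trans (map_zero _)) ((congrArg (A i) hVT').trans (map_zero _))

end BeamData

/-! ### Continuity in the fractional Sobolev norms -/

theorem IsWeakDeriv.coeFn_analysis {w w' : L2} (h : IsWeakDeriv w w') :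
    ∀ᵐ ξ : ℝ, analysis w' ξ = 2 * Real.pi * Complex.I * ξ * analysis w ξ := by
  have h1 : ∀ᵐ ξ : ℝ, ∀ n : ℕ, band n ξ * analysis w' ξ = derivSymbol n ξ * analysis w ξ := by
    rw [ae_all_iff]
    intro n
    filter_upwards [coeFn_cutP n (analysis w'), coeFn_cutD n (analysis w)] with ξ h2 h3
    rw [← h2, ← h3, h.cutP_analysis]
  filter_upwards [h1] with ξ hξ
  obtain ⟨n, hn⟩ := exists_nat_ge |ξ|
  have h2 := hξ n
  have hb : band n ξ = 1 := by
    rw [band, indicator_of_mem (mem_Icc.2 (abs_le.1 hn))]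
  rw [derivSymbol, hb] at h2
  linear_combination h2

theorem norm_analysis_d_two (w : H2) :
    ∀ᵐ ξ : ℝ, ‖analysis (d w 2) ξ‖ = (2 * Real.pi * ξ) ^ 2 * ‖analysis (d w 0) ξ‖ := by
  filter_upwards [(isWeakDeriv_d01 w).coeFn_analysis, (isWeakDeriv_d12 w).coeFn_analysis]
    with ξ h1 h2
  rw [h2, h1]
  simp only [norm_mul, Complex.norm_I, Complex.norm_real, Complex.norm_ofNat, Real.norm_eq_abs]
  rw [← sq_abs (2 * Real.pi * ξ), abs_mul, abs_mul, abs_two]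
  ring

theorem exists_rpow_le {s : ℝ} (hs : s < 2) {ε : ℝ} (hε : 0 < ε) :
    ∃ C : ℝ, 0 ≤ C ∧ ∀ r : ℝ, 1 ≤ r → r ^ (s / 2) ≤ ε * r + C := by
  have h := tendsto_rpow_neg_atTop (y := 1 - s / 2) (by linarith)
  obtain ⟨R, hR⟩ := eventually_atTop.1 (h.eventually_le_const hε)
  refine ⟨max 1 R ^ |s / 2|, by positivity, fun r hr => ?_⟩
  have h1 : (1 : ℝ) ≤ max 1 R := le_max_left _ _
  rcases le_total (max 1 R) r with hle | hle
  · have h2 := hR r ((le_max_right _ _).trans hle)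
    have e : r ^ (s / 2) = r ^ (-(1 - s / 2)) * r := by
      rw [← Real.rpow_add_one (by positivity)]
      congr 1
      ring
    have : 0 ≤ max 1 R ^ |s / 2| := by positivity
    rw [e]
    nlinarith
  · have h2 : r ^ (s / 2) ≤ r ^ |s / 2| := Real.rpow_le_rpow_of_exponent_le hr (le_abs_self _)
    have h3 : r ^ |s / 2| ≤ max 1 R ^ |s / 2| :=
      Real.rpow_le_rpow (by linarith) hle (abs_nonneg _)
    have : 0 ≤ ε * r := by positivity
    linarith

/-- Interpolation: for `s < 2` the `H^s` norm is controlled by a small multiple of the `H²` norm and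
a large multiple of the `L²` norm. -/
theorem exists_fracNorm_le {s : ℝ} (hs : s < 2) {ε : ℝ} (hε : 0 < ε) :
    ∃ C : ℝ, 0 ≤ C ∧ ∀ (G : H2) (g : ℝ → ℝ), Integrable g → g =ᵐ[volume] d G 0 →
      fracNorm s g ≤ ENNReal.ofReal (ε * ‖G‖ + C * ‖d G 0‖) := by
  obtain ⟨C, hC, hpow⟩ := exists_rpow_le hs (half_pos hε)
  refine ⟨C, hC, fun G g hg hG => ?_⟩
  have hg2 : MemLp (fun x => (g x : ℂ)) 2 volume := ((memLp_congr_ae hG).2 (Lp.memLp _)).ofReal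
  have hg1 : Integrable (fun x => (g x : ℂ)) volume := hg.ofReal
  have hFg := coeFn_fourier_toLp hg1 hg2
  have e : hg2.toLp = Complex.ofRealCLM.compLp (d G 0) := by
    refine Lp.ext ?_
    filter_upwards [hg2.coeFn_toLp, Complex.ofRealCLM.coeFn_compLp (d G 0), hG] with x h1 h2 h3
    rw [h1, h2, h3, Complex.ofRealCLM_apply]
  rw [e, ← analysis_apply] at hFg
  have hb : ∀ᵐ ξ : ℝ, ‖(1 + ξ ^ 2) ^ (s / 2) • 𝓕 (fun x : ℝ => (g x : ℂ)) ξ‖ ≤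
      (ε / 2 + C) * ‖analysis (d G 0) ξ‖ + ε / 2 * ‖analysis (d G 2) ξ‖ := by
    filter_upwards [hFg, norm_analysis_d_two G] with ξ h1 h2
    rw [← h1, norm_smul, Real.norm_of_nonneg (by positivity), h2]
    have h3 := hpow (1 + ξ ^ 2) (by nlinarith)
    have h4 : ξ ^ 2 ≤ (2 * Real.pi * ξ) ^ 2 := by
      have := Real.pi_gt_three
      rw [mul_pow]
      exact le_mul_of_one_le_left (sq_nonneg ξ) (by nlinarith)
    have h5 : (1 + ξ ^ 2) ^ (s / 2) ≤ ε / 2 + C + ε / 2 * (2 * Real.pi * ξ) ^ 2 := by nlinarith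
    calc _ ≤ (ε / 2 + C + ε / 2 * (2 * Real.pi * ξ) ^ 2) * ‖analysis (d G 0) ξ‖ := by gcongr
      _ = _ := by ring
  have hn : ∀ (c : ℝ) (a : Freq), 0 ≤ c →
      eLpNorm (fun ξ => c * ‖a ξ‖) 2 volume = ENNReal.ofReal (c * ‖a‖) := fun c a hc => by
    have h1 := eLpNorm_const_smul c (fun ξ => ‖a ξ‖) 2 (volume : Measure ℝ)
    rw [eLpNorm_norm, ← Lp.enorm_def, ← ofReal_norm, ← ofReal_norm,
      ← ENNReal.ofReal_mul (norm_nonneg _), Real.norm_of_nonneg hc] at h1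
    exact h1
  refine (eLpNorm_mono_ae_real hb).trans ((eLpNorm_add_le
    ((Lp.aestronglyMeasurable _).norm.const_mul _) ((Lp.aestronglyMeasurable _).norm.const_mul _)
    one_le_two).trans ?_)
  rw [hn _ _ (by positivity), hn _ _ (by positivity), norm_analysis, norm_analysis,
    ← ENNReal.ofReal_add (by positivity) (by positivity)]
  refine ENNReal.ofReal_le_ofReal ?_
  have h0 := norm_d_le G 0
  have h2 := norm_d_le G 2
  nlinarith

section Cutoff

variable {χ : ℝ → ℝ}

theorem memLp_top_of_cutoff (hχ : Continuous χ) (hc : HasCompactSupport χ) :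
    MemLp χ ∞ (volume : Measure ℝ) := hχ.memLp_of_hasCompactSupport hc

theorem coeFn_mulL_cutoff (hχ : MemLp χ ∞ (volume : Measure ℝ)) (w : L2) :
    mulL ℝ hχ.toLp w =ᵐ[volume] fun x => χ x * w x := by
  filter_upwards [coeFn_mulL hχ.toLp w, hχ.coeFn_toLp] with x h1 h2
  rw [h1, h2]

/-- The product rule for weak derivatives. -/
theorem IsWeakDeriv.mul_cutoff {w w' : L2} (h : IsWeakDeriv w w') (hχ : ContDiff ℝ ∞ χ)
    (h0 : MemLp χ ∞ (volume : Measure ℝ)) (h1 : MemLp (deriv χ) ∞ (volume : Measure ℝ)) :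
    IsWeakDeriv (mulL ℝ h0.toLp w) (mulL ℝ h1.toLp w + mulL ℝ h0.toLp w') := by
  intro φ hφ hcφ
  have hcχ : Continuous (deriv χ) := hχ.continuous_deriv (by simp)
  have hcd : Continuous (deriv φ) := hφ.continuous_deriv (by simp)
  have hprod := h (fun x => χ x * φ x) (hχ.mul hφ) hcφ.mul_left
  have e : ∀ x, deriv (fun x => χ x * φ x) x = deriv χ x * φ x + χ x * deriv φ x := fun x =>
    ((hχ.differentiable (by simp) x).hasDerivAt.mul
      (hφ.differentiable (by simp) x).hasDerivAt).deriv
  have i1 : Integrable fun x => w x * (deriv χ x * φ x) :=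
    integrable_mul_of_compactSupport w (hcχ.mul hφ.continuous) hcφ.mul_left
  have i2 : Integrable fun x => w x * (χ x * deriv φ x) :=
    integrable_mul_of_compactSupport w (hχ.continuous.mul hcd) hcφ.deriv.mul_left
  simp only [e, mul_add] at hprod
  rw [integral_add i1 i2] at hprod
  rw [integral_add_mul _ _ hφ.continuous hcφ]
  have e1 : ∫ x, mulL ℝ h0.toLp w x * deriv φ x = ∫ x, w x * (χ x * deriv φ x) := by
    refine integral_congr_ae ?_
    filter_upwards [coeFn_mulL_cutoff h0 w] with x hx
    rw [hx]; ring
  have e2 : ∫ x, mulL ℝ h1.toLp w x * φ x = ∫ x, w x * (deriv χ x * φ x) := by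
    refine integral_congr_ae ?_
    filter_upwards [coeFn_mulL_cutoff h1 w] with x hx
    rw [hx]; ring
  have e3 : ∫ x, mulL ℝ h0.toLp w' x * φ x = ∫ x, w' x * (χ x * φ x) := by
    refine integral_congr_ae ?_
    filter_upwards [coeFn_mulL_cutoff h0 w'] with x hx
    rw [hx]; ring
  rw [e1, e2, e3]
  linarith

/-- Multiplication by a smooth cutoff is bounded on `H²(ℝ)`. -/
theorem exists_mul_cutoff (hχ : ContDiff ℝ ∞ χ) (hc : HasCompactSupport χ) :
    ∃ B : ℝ, 0 ≤ B ∧ ∀ w : H2, ∃ G : H2, (d G 0 =ᵐ[volume] fun x => χ x * d w 0 x) ∧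
      ‖G‖ ≤ B * ‖w‖ ∧ ‖d G 0‖ ≤ B * ‖d w 0‖ := by
  have hχ1 : ContDiff ℝ ∞ (deriv χ) := hχ.iterate_deriv 1
  have hχ2 : ContDiff ℝ ∞ (deriv (deriv χ)) := hχ.iterate_deriv 2
  have h0 := memLp_top_of_cutoff hχ.continuous hc
  have h1 := memLp_top_of_cutoff hχ1.continuous hc.deriv
  have h2 := memLp_top_of_cutoff hχ2.continuous hc.deriv.deriv
  set m0 := mulL ℝ h0.toLp with hm0
  set m1 := mulL ℝ h1.toLp with hm1
  set m2 := mulL ℝ h2.toLp with hm2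
  have hd1 : ∀ w : H2, IsWeakDeriv (m0 (d w 0)) (m1 (d w 0) + m0 (d w 1)) := fun w =>
    (isWeakDeriv_d01 w).mul_cutoff hχ h0 h1
  have hd2 : ∀ w : H2, IsWeakDeriv (m1 (d w 0) + m0 (d w 1))
      ((m2 (d w 0) + m1 (d w 1)) + (m1 (d w 1) + m0 (d w 2))) := fun w =>
    ((isWeakDeriv_d01 w).mul_cutoff hχ1 h1 h2).add ((isWeakDeriv_d12 w).mul_cutoff hχ h0 h1)
  set B := ‖m0‖ + ‖m1‖ + ‖m2‖ with hB
  have n0 := norm_nonneg m0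
  have n1 := norm_nonneg m1
  have n2 := norm_nonneg m2
  have hBn : 0 ≤ B := by positivity
  refine ⟨7 * B, by positivity, fun w => ⟨mkH2 _ _ _ (hd1 w) (hd2 w),
    coeFn_mulL_cutoff h0 (d w 0), ?_, ?_⟩⟩
  · have hw := norm_nonneg w
    have hle : ∀ j (m : L2 →L[ℝ] L2), ‖m‖ ≤ B → ‖m (d w j)‖ ≤ B * ‖w‖ := fun j m hm =>
      (m.le_opNorm _).trans (mul_le_mul hm (norm_d_le w j) (norm_nonneg _) hBn)
    have f0 : ∀ j, ‖m0 (d w j)‖ ≤ B * ‖w‖ := fun j => hle j m0 (by linarith)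
    have f1 : ∀ j, ‖m1 (d w j)‖ ≤ B * ‖w‖ := fun j => hle j m1 (by linarith)
    have f2 : ∀ j, ‖m2 (d w j)‖ ≤ B * ‖w‖ := fun j => hle j m2 (by linarith)
    have b0 := f0 0
    have b1 : ‖m1 (d w 0) + m0 (d w 1)‖ ≤ 2 * (B * ‖w‖) :=
      (norm_add_le _ _).trans (by linarith [f1 0, f0 1])
    have b2 : ‖(m2 (d w 0) + m1 (d w 1)) + (m1 (d w 1) + m0 (d w 2))‖ ≤ 4 * (B * ‖w‖) :=
      (norm_add_le _ _).trans (by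
        linarith [norm_add_le (m2 (d w 0)) (m1 (d w 1)), norm_add_le (m1 (d w 1)) (m0 (d w 2)),
          f2 0, f1 1, f0 2])
    have hBw : 0 ≤ B * ‖w‖ := by positivity
    refine (sq_le_sq₀ (norm_nonneg _) (by positivity)).1 ?_
    rw [norm_sq_H2, d_mkH2_zero, d_mkH2_one, d_mkH2_two]
    have q0 := pow_le_pow_left₀ (norm_nonneg _) b0 2
    have q1 := pow_le_pow_left₀ (norm_nonneg _) b1 2
    have q2 := pow_le_pow_left₀ (norm_nonneg _) b2 2
    nlinarith
  · rw [d_mkH2_zero]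
    refine (m0.le_opNorm _).trans (mul_le_mul_of_nonneg_right ?_ (norm_nonneg _))
    linarith

/-- Boundedness in `H²(ℝ)` and continuity in `L²(ℝ)` give continuity in `H^s_loc(ℝ)` for `s < 2`. -/
theorem continuousOnHLoc_of_lipschitz {s : ℝ} (hs : s < 2) {I : Set ℝ} {U : ℝ → H2} {C : ℝ}
    (hC : 0 ≤ C) (hU : ∀ t ∈ I, ‖U t‖ ≤ C)
    (hL : ∀ s ∈ I, ∀ t ∈ I, ‖d (U t) 0 - d (U s) 0‖ ≤ C * |t - s|) {u : ℝ → ℝ → ℝ}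
    (hu : ∀ t ∈ I, u t =ᵐ[volume] d (U t) 0) : ContinuousOnHLoc s I u := by
  intro χ hχ hc
  obtain ⟨B, hB, hmul⟩ := exists_mul_cutoff hχ hc
  have hint : ∀ {w : L2} {v : ℝ → ℝ}, v =ᵐ[volume] w → Integrable fun x => χ x * v x :=
    fun {w v} hv => (integrable_mul_of_compactSupport w hχ.continuous hc).congr (by
      filter_upwards [hv] with x hx
      rw [hx, mul_comm])
  refine ⟨fun t ht => ?_, fun t₀ ht₀ => ?_⟩
  · obtain ⟨G, hG, -, -⟩ := hmul (U t)
    have e : (fun x => χ x * u t x) =ᵐ[volume] d G 0 := by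
      filter_upwards [hG, hu t ht] with x h1 h2
      rw [h1, h2]
    refine ⟨(memLp_congr_ae e).2 (Lp.memLp _), ?_⟩
    obtain ⟨C₁, -, hfrac⟩ := exists_fracNorm_le hs one_pos
    exact (hfrac G _ (hint (hu t ht)) e).trans_lt ENNReal.ofReal_lt_top
  · rw [ENNReal.tendsto_nhds_zero]
    intro δ hδ
    rcases eq_or_ne δ ⊤ with rfl | hδt
    · exact Eventually.of_forall fun _ => le_top
    have hδr : 0 < δ.toReal := ENNReal.toReal_pos hδ.ne' hδt
    obtain ⟨C₁, hC₁, hfrac⟩ := exists_fracNorm_le hs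
      (ε := δ.toReal / 2 / (B * (2 * C) + 1)) (by positivity)
    have hlim : Tendsto (fun t => C₁ * (B * (C * |t - t₀|))) (𝓝[I] t₀) (𝓝 0) := by
      have : Continuous fun t => C₁ * (B * (C * |t - t₀|)) := by fun_prop
      have h := this.tendsto t₀
      simp only [sub_self, abs_zero, mul_zero] at h
      exact h.mono_left nhdsWithin_le_nhds
    filter_upwards [hlim.eventually_le_const (half_pos hδr), self_mem_nhdsWithin] with t h1 ht
    obtain ⟨G, hG, hG1, hG2⟩ := hmul (U t - U t₀)
    have ed : d (U t - U t₀) 0 = d (U t) 0 - d (U t₀) 0 := rfl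
    have hv : (fun x => u t x - u t₀ x) =ᵐ[volume] d (U t - U t₀) 0 := by
      filter_upwards [hu t ht, hu t₀ ht₀, Lp.coeFn_sub (d (U t) 0) (d (U t₀) 0)] with x a1 a2 a3
      rw [ed, a3, a1, a2, Pi.sub_apply]
    have e : (fun x => χ x * (u t x - u t₀ x)) =ᵐ[volume] d G 0 := by
      filter_upwards [hG, hv] with x a1 a2
      rw [a1, ← a2]
    refine (hfrac G _ (hint hv) e).trans (ENNReal.ofReal_le_of_le_toReal ?_)
    have hn : ‖U t - U t₀‖ ≤ 2 * C :=
      (norm_sub_le _ _).trans (by linarith [hU t ht, hU t₀ ht₀])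
    have hG1' : ‖G‖ ≤ B * (2 * C) := hG1.trans (by gcongr)
    have hG2' : ‖d G 0‖ ≤ B * (C * |t - t₀|) := hG2.trans (by
      gcongr
      rw [ed]
      exact hL t₀ ht₀ t ht)
    have p1 : δ.toReal / 2 / (B * (2 * C) + 1) * ‖G‖ ≤ δ.toReal / 2 := by
      rw [div_mul_eq_mul_div, div_le_iff₀ (by positivity)]
      gcongr
      linarith
    have p2 : C₁ * ‖d G 0‖ ≤ C₁ * (B * (C * |t - t₀|)) := by gcongr
    linarith

end Cutoff

/-! ### Existence of weak solutions -/

namespace BeamData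

variable (D : BeamData)

/-- Bounded weak limits of the frequency-truncated solutions exist. The truncation height of the
nonlinearity is chosen beyond the reach of the solutions. -/
theorem exists_weak_solution (u₀ : H2) (u₁ : H1) :
    ∃ (U : ℝ → H2) (W : ℝ → L2) (C : ℝ), 0 ≤ C ∧ MemLp U ⊤ (volume.restrict (Icc 0 D.T)) ∧
      MemLp W ⊤ (volume.restrict (Icc 0 D.T)) ∧ (∀ t ∈ Icc 0 D.T, ‖U t‖ ≤ C) ∧
      (∀ s ∈ Icc 0 D.T, ∀ t ∈ Icc 0 D.T, ‖d (U t) 0 - d (U s) 0‖ ≤ C * |t - s|) ∧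
      IsWeakTimeDeriv D.T (fun t => d (U t) 0) W ∧ d (U 0) 0 = d u₀ 0 ∧
      ∀ (V V' V'' : ℝ → H2), (∀ t, HasDerivAt V (V' t) t) → (∀ t, HasDerivAt V' (V'' t) t) →
        Continuous V'' → V D.T = 0 → V' D.T = 0 → ∀ M : ℝ,
        (∀ t ∈ Icc 0 D.T, ∀ᵐ x : ℝ, M < |x| → d (V t) 0 x = 0) →
        (∫ t in (0 : ℝ)..D.T, ∫ x, W t x * d (V' t) 0 x)
          - (∫ t in (0 : ℝ)..D.T, ∫ x, d (U t) 2 x * d (V t) 2 x)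
          - 1 / 3 * (∫ t in (0 : ℝ)..D.T, ∫ x, d (U t) 1 x ^ 3 * d (V t) 1 x)
          - (∫ t in (0 : ℝ)..D.T, ∫ x, D.ν * d (D.p t) 0 x * d (U t) 2 x * d (V t) 0 x)
          - contRep (d u₀ 0) (D.ζ 0) * contRep (d (V' 0) 0) (D.ζ 0)
          - (∫ t in (0 : ℝ)..D.T, contRep (d (U t) 0) (D.ζ t) * contRep (d (V'' t) 0) (D.ζ t))
          - (∫ t in (0 : ℝ)..D.T, D.ζ' t * contRep (d (U t) 1) (D.ζ t) *
              contRep (d (V' t) 0) (D.ζ t))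
          - (∫ t in (0 : ℝ)..D.T, D.ζ' t * contRep (d (U t) 0) (D.ζ t) *
              contRep (d (V' t) 1) (D.ζ t))
          + (∫ t in (0 : ℝ)..D.T, ∫ x, d (D.f t) 0 x * d (V t) 0 x)
          + (∫ t in (0 : ℝ)..D.T, D.P t * contRep (d (V t) 0) (D.ζ t))
          + (∫ x, d u₁ 0 x * d (V 0) 0 x)
          + contRep (d u₁ 0) (D.ζ 0) * contRep (d (V 0) 0) (D.ζ 0) = 0 := by
  have hT := D.hT.le
  have h0T : (0 : ℝ) ∈ Icc 0 D.T := left_mem_Icc.2 hT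
  have hu₁ : IsWeakDeriv (d u₁ 0) (d u₁ 1) := u₁.2 0
  set R := ‖u₀‖ + ‖u₁‖ with hR
  have hR0 : ‖u₀‖ ≤ R := by linarith [norm_nonneg u₁]
  have hR1 : ‖u₁‖ ≤ R := by linarith [norm_nonneg u₀]
  set C := 2 * D.bound R with hCdef
  have hbound : 0 ≤ D.bound R := Real.sqrt_nonneg _
  have hC : 0 ≤ C := by positivity
  -- Slopes are bounded by twice the `H²` norm, so at this height nothing is truncated.
  let K : NNReal := ⟨2 * C, by positivity⟩
  choose a z z' ha0 hz0 hsol using fun n => (D.system K n).exists_isSolution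
    (cutP n (analysis (d u₀ 0))) (cutP n (analysis (d u₁ 0)))
  have hle : ∀ n (w : L2), ‖cutP n (analysis w)‖ ≤ ‖w‖ := fun n w =>
    (norm_cutP_le n _).trans (norm_analysis w).le
  have hbd := fun n t (ht : t ∈ Icc 0 D.T) => D.solution_bounds (R := R) (hsol n)
    (by rw [ha0]; exact (hle _ _).trans ((norm_d_le _ _).trans hR0))
    (by
      rw [ha0, cutD_cutP, cutD_analysis_d01]
      exact (hle _ _).trans ((norm_d_le _ _).trans hR0))
    (by
      rw [ha0, cutD_cutP, cutD_cutD_analysis]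
      exact (hle _ _).trans ((norm_d_le _ _).trans hR0))
    (by rw [hz0]; exact (hle _ _).trans ((norm_d_le _ _).trans hR1))
    (by
      rw [hz0, cutD_cutP, ← hu₁.cutP_analysis]
      exact (hle _ _).trans ((norm_d_le _ _).trans hR1)) ht
  have hub : ∀ n, ∀ t ∈ Icc 0 D.T, ‖bandH2 n (a n t)‖ ≤ C := fun n t ht =>
    norm_bandH2_le (hbd n t ht).1 (hbd n t ht).2.1 (hbd n t ht).2.2.1
  have hinit : Tendsto (fun n => d (bandH2 n (a n 0)) 0) atTop (𝓝 (d u₀ 0)) := by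
    refine (tendsto_lowPass (d u₀ 0)).congr fun n => ?_
    rw [d_bandH2_zero, ha0, cutP_cutP, lowPass_apply]
  obtain ⟨U, W, φ, hφ, hU⟩ := exists_isWeakLimit hT (u := fun n t => bandH2 n (a n t))
    (z := fun n t => synth (cutP n (z n t))) hub
    (fun n t ht => (norm_synth_le _).trans ((norm_cutP_le n _).trans
      ((hbd n t ht).2.2.2.trans (by linarith))))
    (fun n t ht => (synth.comp (cutP n)).hasFDerivAt.comp_hasDerivAt t ((hsol n).hasDerivAt t ht))
    (fun n t ht => ((synth.comp (cutP n)).continuous.continuousAt.comp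
      ((hsol n).hasDerivAt_velocity t ht).continuousAt).continuousWithinAt) hinit
  refine ⟨U, W, C, hC, hU.memLp, hU.memLp_velocity, hU.norm_le, hU.lipschitz, hU.isWeakTimeDeriv,
    ?_, ?_⟩
  · exact ((hU.weakTendsto 0 h0T).map (dL 2 0)).unique fun l =>
      (l.continuous.tendsto _).comp (hinit.comp hφ.tendsto_atTop)
  · intro V V' V'' hV hV' hV'' hVT hVT' M hM
    exact D.weak_form_of_isWeakLimit hφ.tendsto_atTop (fun i => hsol (φ i)) (isWeakDeriv_d01 u₀)
      hu₁ (fun i => ha0 _) (fun i => hz0 _) (fun i => hub _) le_rfl hU hV hV' hV'' hVT hVT' hM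

end BeamData

/-- The data of the equation, extended from `[0, T]` to all times. -/
theorem exists_beamData {T : ℝ} (hT : 0 < T) (ν : ℝ) {ζ P : ℝ → ℝ}
    (hζ : ContDiffOn ℝ 2 ζ (Icc 0 T)) (hP : ContinuousOn P (Icc 0 T)) {f p : ℝ → H2}
    (hf : ContinuousOn f (Icc 0 T)) (hp : ContinuousOn p (Icc 0 T)) :
    ∃ D : BeamData, D.T = T ∧ D.ν = ν ∧ ∀ t ∈ Icc 0 T, D.ζ t = ζ t ∧
      D.ζ' t = derivWithin ζ (Icc 0 T) t ∧ D.P t = P t ∧ D.f t = f t ∧ D.p t = p t := by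
  obtain ⟨Z, Z', Z'', hZ, hZ', hZ'', hZe⟩ := exists_extension_of_contDiffOn hT hζ
  have hext : ∀ {E : Type} [NormedAddCommGroup E] {g : ℝ → E}, ContinuousOn g (Icc 0 T) →
      Continuous fun t => g (projIcc 0 T hT.le t) := fun hg =>
    (continuousOn_iff_continuous_domRestrict.1 hg).comp continuous_projIcc
  have hZ'c : Continuous Z' := continuous_iff_continuousAt.2 fun t => (hZ' t).continuousAt
  obtain ⟨B₁, hB₁⟩ := isCompact_Icc.exists_bound_of_continuousOn (hZ'c.continuousOn (s := Icc 0 T))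
  obtain ⟨B₂, hB₂⟩ := isCompact_Icc.exists_bound_of_continuousOn (hZ''.continuousOn (s := Icc 0 T))
  obtain ⟨B₃, hB₃⟩ := isCompact_Icc.exists_bound_of_continuousOn hP
  obtain ⟨B₄, hB₄⟩ := isCompact_Icc.exists_bound_of_continuousOn hf
  obtain ⟨B₅, hB₅⟩ := isCompact_Icc.exists_bound_of_continuousOn
    (toLinf.continuous.comp_continuousOn hp)
  have h0T : (0 : ℝ) ∈ Icc 0 T := left_mem_Icc.2 hT.le
  have n1 : 0 ≤ B₁ := (norm_nonneg _).trans (hB₁ 0 h0T)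
  have n2 : 0 ≤ B₂ := (norm_nonneg _).trans (hB₂ 0 h0T)
  have n3 : 0 ≤ B₃ := (norm_nonneg _).trans (hB₃ 0 h0T)
  have n4 : 0 ≤ B₄ := (norm_nonneg _).trans (hB₄ 0 h0T)
  have n5 : 0 ≤ |ν| * B₅ := mul_nonneg (abs_nonneg _) ((norm_nonneg _).trans (hB₅ 0 h0T))
  let D : BeamData :=
    { T := T
      hT := hT
      ν := ν
      ζ := Z
      ζ' := Z'
      ζ'' := Z''
      P := fun t => P (projIcc 0 T hT.le t)
      f := fun t => f (projIcc 0 T hT.le t)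
      p := fun t => p (projIcc 0 T hT.le t)
      hasDerivAt_ζ := hZ
      hasDerivAt_ζ' := hZ'
      continuous_P := hext hP
      continuous_f := hext hf
      continuous_p := hext hp
      Z := 1 + B₁ + B₂ + B₃ + B₄ + |ν| * B₅
      one_le_Z := by linarith
      ζ'_le := fun t ht => (hB₁ t ht).trans (by linarith)
      ζ''_le := fun t ht => (hB₂ t ht).trans (by linarith)
      p_le := fun t => (mul_le_mul_of_nonneg_left (hB₅ _ (projIcc 0 T hT.le t).2)
        (abs_nonneg ν)).trans (by linarith)
      f_le := fun t => (hB₄ _ (projIcc 0 T hT.le t).2).trans (by linarith)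
      P_le := fun t => (hB₃ _ (projIcc 0 T hT.le t).2).trans (by linarith) }
  refine ⟨D, rfl, rfl, fun t ht => ⟨(hZe t ht).1, (hZe t ht).2.1, ?_⟩⟩
  simp only [D, projIcc_of_mem hT.le ht, and_self]

end GaoBeam

end

theorem theorem1 (T : ℝ) (hT : 0 < T) (ν : ℝ) (u₀ : GaoBeam.H2) (u₁ : GaoBeam.H1)
    (ζ P : ℝ → ℝ) (hζ : ContDiffOn ℝ 2 ζ (Icc 0 T)) (hP : ContDiffOn ℝ 2 P (Icc 0 T))
    (f p : ℝ → GaoBeam.H2) (hf : ContinuousOn f (Icc 0 T)) (hp : ContinuousOn p (Icc 0 T)) :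
    ∃ (u : ℝ → ℝ → ℝ) (U : ℝ → GaoBeam.H2) (ut : ℝ → GaoBeam.L2),
      -- `u ∈ C⁰([0,T); H^{2-α}_loc(ℝ))` for every `α ∈ (0,2)`
      (∀ α ∈ Ioo (0 : ℝ) 2, GaoBeam.ContinuousOnHLoc (2 - α) (Ico 0 T) u) ∧
      -- `u ∈ L^∞(0,T; H²(ℝ))`, with `U` the function `u` seen with values in `H²(ℝ)`
      MemLp U ⊤ (volume.restrict (Icc 0 T)) ∧
      (∀ᵐ t ∂(volume.restrict (Icc 0 T)), u t =ᵐ[volume] GaoBeam.d (U t) 0) ∧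
      -- `u_t ∈ L^∞(0,T; L²(ℝ))`
      MemLp ut ⊤ (volume.restrict (Icc 0 T)) ∧
      GaoBeam.IsWeakTimeDeriv T (fun t => GaoBeam.d (U t) 0) ut ∧
      -- the weak formulation
      (∀ v : ℝ → GaoBeam.H2, GaoBeam.IsTestFunction T v →
        GaoBeam.weakForm T ν u₀ u₁ ζ P f p U ut v = 0) ∧
      -- the initial condition
      u 0 =ᵐ[volume] GaoBeam.d u₀ 0 := by
  obtain ⟨D, rfl, rfl, hD⟩ := GaoBeam.exists_beamData hT ν hζ hP.continuousOn hf hp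
  obtain ⟨U, W, C, hC, hU, hW, hUC, hUL, hUW, hU0, hweak⟩ := D.exists_weak_solution u₀ u₁
  have h0T : (0 : ℝ) ∈ Icc 0 D.T := left_mem_Icc.2 hT.le
  have hrep : ∀ t, GaoBeam.contRep (GaoBeam.d (U t) 0) =ᵐ[volume] GaoBeam.d (U t) 0 := fun t =>
    (GaoBeam.isWeakDeriv_d01 (U t)).coeFn_eq_contRep.symm
  refine ⟨fun t => GaoBeam.contRep (GaoBeam.d (U t) 0), U, W, fun α hα => ?_, hU,
    Eventually.of_forall hrep, hW, hUW, fun v hv => ?_, hU0 ▸ hrep 0⟩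
  · exact GaoBeam.continuousOnHLoc_of_lipschitz (by linarith [hα.1]) hC
      (fun t ht => hUC t (Ico_subset_Icc_self ht))
      (fun s hs t ht => hUL s (Ico_subset_Icc_self hs) t (Ico_subset_Icc_self ht))
      fun t _ => hrep t
  · obtain ⟨V, V', V'', hV, hV', hV'', hVe⟩ :=
      GaoBeam.exists_extension_of_contDiffOn hT hv.contDiffOn
    obtain ⟨T', hT', M, hM⟩ := hv.compact_support
    have hTT : D.T ∈ Icc 0 D.T := right_mem_Icc.2 hT.le
    have hvT : v D.T = 0 := (hM D.T hTT).1 hT'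
    have hVT : V D.T = 0 := (hVe _ hTT).1.trans hvT
    -- `v` vanishes near `T`, and with it the derivative from the left.
    have hVT' : V' D.T = 0 := by
      have h : v =ᶠ[𝓝[Icc 0 D.T] D.T] fun _ => 0 := by
        filter_upwards [self_mem_nhdsWithin,
          mem_nhdsWithin_of_mem_nhds (lt_mem_nhds hT')] with t ht ht'
        exact (hM t ht).1 ht'
      rw [(hVe _ hTT).2.1, h.derivWithin_eq hvT]
      simp
    have key := hweak V V' V'' hV hV' hV'' hVT hVT' M fun t ht => by
      rw [(hVe t ht).1]
      exact (hM t ht).2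
    have ic : ∀ {F G : ℝ → ℝ}, (∀ t ∈ Icc 0 D.T, F t = G t) →
        ∫ t in (0 : ℝ)..D.T, F t = ∫ t in (0 : ℝ)..D.T, G t := fun h =>
      intervalIntegral.integral_congr fun t ht => h t (by rwa [uIcc_of_le hT.le] at ht)
    refine Eq.trans ?_ key
    dsimp only [GaoBeam.weakForm]
    refine congrArg₂ (· + ·) (congrArg₂ (· + ·) (congrArg₂ (· + ·) (congrArg₂ (· + ·)
      (congrArg₂ (· - ·) (congrArg₂ (· - ·) (congrArg₂ (· - ·) (congrArg₂ (· - ·)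
      (congrArg₂ (· - ·) (congrArg₂ (· - ·) (congrArg₂ (· - ·) ?_ ?_) (congrArg (1 / 3 * ·) ?_))
        ?_) ?_) ?_) ?_) ?_) ?_) ?_) ?_) ?_
    · exact ic fun t ht => by rw [(hVe t ht).2.1]
    · exact ic fun t ht => by rw [(hVe t ht).1]
    · exact ic fun t ht => by rw [(hVe t ht).1]
    · exact ic fun t ht => by rw [(hVe t ht).1, (hD t ht).2.2.2.2]
    · rw [(hVe 0 h0T).2.1, (hD 0 h0T).1]
    · exact ic fun t ht => by rw [(hVe t ht).2.2, (hD t ht).1]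
    · exact ic fun t ht => by rw [(hVe t ht).2.1, (hD t ht).1, (hD t ht).2.1]
    · exact ic fun t ht => by rw [(hVe t ht).2.1, (hD t ht).1, (hD t ht).2.1]
    · exact ic fun t ht => by rw [(hVe t ht).1, (hD t ht).2.2.2.1]
    · exact ic fun t ht => by rw [(hVe t ht).1, (hD t ht).1, (hD t ht).2.2.1]
    · rw [(hVe 0 h0T).1]
    · rw [(hVe 0 h0T).1, (hD 0 h0T).1]
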